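/- Let $\xi$ be a complex random variable with $\mathbb{E}|\xi|^2=1$. For $p\in[0,1]$ let $A_n\sim\Delta_n(\xi,p)$ be the $n\times n$ random matrix whose entries are independent and distributed as $\delta\xi$, with $\delta\sim\mathrm{Ber}(p)$ independent of $\xi$. Let $\sigma_1(M)\ge\sigma_2(M)\ge\cdots$ be the right singular values of a matrix $M$, with $\sigma_j(M)=0$ when $j$ exceeds the number of columns, and put $-\log 0=+\infty$. Put $d=pn$ and $A^*_{n,z}=d^{-1/2}A_n-zI_n$. For $\varepsilon>0$ (small) let $m=\lfloor(1-\varepsilon)n\rfloor$ and $r_0=\lfloor(1-\varepsilon/4)m\rfloor$. For $t\in\frac12\mathbb{Z}\cap[m,n]$ let $A^*_{t,z}$ be the top left $\lfloor t\rfloor\times\lceil t\rceil$ submatrix of $A^*_{n,z}$, and set $$T_{r,t}(z)=-\frac1n\sum_{j=1}^{r}\log\sigma_j(A^*_{t,z}),\qquad U_n(z)=T_{n,n}(z)=-\frac1n\sum_{j=1}^{n}\log\sigma_j(A^*_{n,z}),\qquad T_n(z)=T_{r_0,m}(z)=-\frac1n\sum_{j=1}^{r_0}\log\sigma_j(A^*_{m,z}).$$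 For $C>0$ let $$\delta_r=\begin{cases} n^{-1}\big(\log\frac{n}{n-r+1}\big)^2 & \text{if } r<n(1-d^{-1/4}),\\ C\,n^{-1}(\log d)^8\big(\log\frac{n}{n-r+1}\big)^8 & \text{if } r\ge n(1-d^{-1/4}).\end{cases}$$ Define $r(t)$ for $t\in\frac12\mathbb{Z}\cap[m,n]$ by $r(m)=r_0$, and $r(t+\tfrac12)=r(t)+1$ if $T_{r(t)+1,\,t+1/2}(z)\le T_{r(t),\,t}(z)+\delta_{r(t)+1}$, and $r(t+\tfrac12)=r(t)$ otherwise. Let $h(t)=t-r(t)$. Then there is a constant $C_0>0$, depending only on $\xi$, such that the following holds. Let $p=p_n\in[0,1/2]$ with $p_nn\to\infty$, and let $\varepsilon=\varepsilon_n\to0$ sufficiently slowly; that is, there is a sequence of positive reals $\varepsilon^0_n\to0$, depending only on $\xi$ and $(p_n)$, such that the following is true for every sequence $\varepsilon_n\to0$ with $\varepsilon_n\ge\varepsilon^0_n$ for all large $n$. For every fixed $z\in\mathbb{C}\setminus\{0\}$, as $n\to\infty$: 1. for every fixed $C\ge C_0$, $\ \mathbb{P}(h(n)=0)=1-o(1)$;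 2. $U_n(z)\le T_n(z)+o(1)$ with probability $1-o(1)$; that is, there is a deterministic sequence $\eta_n\to0$ with $\mathbb{P}\big(U_n(z)\le T_n(z)+\eta_n\big)\to1$. -/

import Mathlib

open MeasureTheory Filter Topology

noncomputable section

/-- The law of `δ * ξ`, where `δ ∼ Ber(p)` (value `1` with probability `p`, else `0`) and
`ξ ∼ ν` are independent. -/
def sparseEntryLaw (ν : Measure ℂ) (p : unitInterval) : Measure ℂ :=
  ((ProbabilityTheory.bernoulliMeasure (1 : ℂ) 0 p).prod ν).map (fun q => q.1 * q.2)

/-- The law of an `n × n` array of independent entries, each distributed as `Ber(p) * ξ` with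
`ξ ∼ ν`. -/
def sparseArrayLaw (n : ℕ) (ν : Measure ℂ) (p : unitInterval) : Measure (Fin n → Fin n → ℂ) :=
  Measure.pi fun _ => Measure.pi fun _ => sparseEntryLaw ν p

/-- The rescaled and shifted matrix `d^{-1/2} A - z I`. -/
def shiftedMatrix {n : ℕ} (A : Fin n → Fin n → ℂ) (d : ℝ) (z : ℂ) : Matrix (Fin n) (Fin n) ℂ :=
  (((Real.sqrt d)⁻¹ : ℝ) : ℂ) • Matrix.of A - z • (1 : Matrix (Fin n) (Fin n) ℂ)

/-- The top left block formed by the first `a` rows and the first `b` columns (for `a, b ≤ n`). -/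
def leadingBlock {n : ℕ} (M : Matrix (Fin n) (Fin n) ℂ) (a b : ℕ) :
    Matrix {i : Fin n // (i : ℕ) < a} {j : Fin n // (j : ℕ) < b} ℂ :=
  M.submatrix Subtype.val Subtype.val

/-- The matrix at time `t = s / 2`: the top left block with `⌊t⌋` rows and `⌈t⌉` columns. -/
def blockAtTime {n : ℕ} (M : Matrix (Fin n) (Fin n) ℂ) (s : ℕ) :
    Matrix {i : Fin n // (i : ℕ) < s / 2} {j : Fin n // (j : ℕ) < (s + 1) / 2} ℂ :=
  leadingBlock M (s / 2) ((s + 1) / 2)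

/-- The `j`-th largest right singular value `σ_j(M)`, numbered from `j = 1`. It is `0` when `j`
exceeds the number of columns. -/
def sigmaValue {ι κ : Type*} [Fintype ι] [Fintype κ] [DecidableEq κ]
    (M : Matrix ι κ ℂ) (j : ℕ) : ℝ :=
  (Matrix.toEuclideanLin M).singularValues (j - 1)

/-- The sum `-(1/n) ∑_{j=1}^r log σ_j(M)`, as an extended real number: it is `+∞` when one of these
singular values is `0` (`ENNReal.log 0 = ⊥`). -/
def logSum {ι κ : Type*} [Fintype ι] [Fintype κ] [DecidableEq κ]
    (n : ℕ) (M : Matrix ι κ ℂ) (r : ℕ) : EReal :=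
  -((((n : ℝ)⁻¹ : ℝ) : EReal) *
    ∑ j ∈ Finset.Icc 1 r, ENNReal.log (ENNReal.ofReal (sigmaValue M j)))

/-- The size `m = (1 - ε) n` of the principal minor, rounded down. -/
def minorSize (n : ℕ) (ε : ℝ) : ℕ := ⌊(1 - ε) * (n : ℝ)⌋₊

/-- The number `(1 - ε/4) m` of singular values kept in the truncated sum, rounded down. -/
def keptCount (n : ℕ) (ε : ℝ) : ℕ := ⌊(1 - ε / 4) * (minorSize n ε : ℝ)⌋₊

/-- `U_n(z) = -(1/n) ∑_{j=1}^n log σ_j(d^{-1/2} A - z I)`. -/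
def logPotential {n : ℕ} (A : Fin n → Fin n → ℂ) (d : ℝ) (z : ℂ) : EReal :=
  logSum n (shiftedMatrix A d z) n

/-- `T_n(z) = -(1/n) ∑_{j=1}^{(1-ε/4)m} log σ_j(B)`, where `B` is the top left `m × m` principal
minor of `d^{-1/2} A - z I`. -/
def truncatedLogPotential {n : ℕ} (A : Fin n → Fin n → ℂ) (d ε : ℝ) (z : ℂ) : EReal :=
  logSum n (leadingBlock (shiftedMatrix A d z) (minorSize n ε) (minorSize n ε)) (keptCount n ε)

/-- The error `δ_r` that is allowed when the `r`-th singular value is taken into the sum. -/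
def stepError (n : ℕ) (d C : ℝ) (r : ℕ) : ℝ :=
  if (r : ℝ) < n * (1 - d ^ (-(1 / 4 : ℝ))) then
    (n : ℝ)⁻¹ * Real.log (n / (n - r + 1)) ^ 2
  else
    C * (n : ℝ)⁻¹ * Real.log d ^ 8 * Real.log (n / (n - r + 1)) ^ 8

open Classical in
/-- The process `r(t)` at time `t = m + k / 2`. It starts at `r(m) = (1 - ε/4) m`, and
`r(t + 1/2)` is `r(t) + 1` if `T_{r(t)+1, t+1/2}(z) ≤ T_{r(t), t}(z) + δ_{r(t)+1}` and `r(t)`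
otherwise, where `T_{r,t}(z)` is the log sum of the top `r` singular values at time `t`. -/
def takenCount {n : ℕ} (A : Fin n → Fin n → ℂ) (d C ε : ℝ) (z : ℂ) : ℕ → ℕ
  | 0 => keptCount n ε
  | k + 1 =>
    let r := takenCount A d C ε z k
    let s := 2 * minorSize n ε + k
    if logSum n (blockAtTime (shiftedMatrix A d z) (s + 1)) (r + 1) ≤
        logSum n (blockAtTime (shiftedMatrix A d z) s) r + (stepError n d C (r + 1) : EReal)
    then r + 1 else r

/-- The height `h(t) = t - r(t)` at time `t = m + k / 2`. -/
def height {n : ℕ} (A : Fin n → Fin n → ℂ) (d C ε : ℝ) (z : ℂ) (k : ℕ) : ℝ :=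
  (minorSize n ε : ℝ) + (k : ℝ) / 2 - (takenCount A d C ε z k : ℝ)

/-- The height `h(n)` at the final time `t = n`, reached after `2 (n - m)` half-steps. -/
def finalHeight {n : ℕ} (A : Fin n → Fin n → ℂ) (d C ε : ℝ) (z : ℂ) : ℝ :=
  height A d C ε z (2 * (n - minorSize n ε))

end

/-!
The minor grows by half-steps, which add a row or a column in turn. If `r` of the singular values
are taken into the sum, then adding a row multiplies the product of the top singular values by at
least the length of the projection of the new row to the bottom right singular space, when the
number of factors goes up from `r` to `r + 1` (`prod_singularValues_mul_norm_row_le`). Columns are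
rows of the conjugate transpose. So a step can fail to take a new singular value only if that
projection is shorter than `exp (-n δ)`, where `δ` is the allowed error, and this is to be shown
unlikely given the past (`exists_measureReal_rowFails_le`). There are two regimes.

* When the bottom singular space has dimension more than about `n d ^ (-1/4)`, its coordinate
  projections are large on average. The square of the length of the projection has mean comparable
  to the dimension over `n`, and a second moment computation, with Bessel's inequality for the
  cross terms, shows that the length is rarely much smaller
  (`measureReal_ball_sum_le_of_bessel`).
* Otherwise, the bottom singular space `H` is an approximate kernel of the past block: if the
  norm of the block on `H` exceeds `exp (-n δ)`, the step cannot fail, because an added row decreases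
  no singular value (`RowFails.norm_le`). A Littlewood–Offord inequality (`measureReal_ball_sum_le`)
  bounds the probability that the projection is short, provided that more than `n log d / (4 d)`
  columns have a non-negligible coordinate projection to `H`. This holds because the pattern of
  nonzero entries expands (`Expanding`, `measureReal_not_expanding_le`): for every smaller set `S`
  of columns there are rows which meet `S` only in one column with a substantial entry. Such a row
  forces the projection of its column to be small, as soon as those outside `S` are small
  (`Peelable.mul_norm_coordProj_le`). After few rounds of such peeling, nearly all
  projections are small, which contradicts the dimension of `H` (`finrank_half_lt_of_peelable`,
  `lt_card_filter_coordProj`).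

Twice the height is an integer which goes up by `1` when a step fails and down by `1` otherwise.
Since failure has a small conditional probability, a potential argument with a weight exponential in
the height and the elapsed time shows that it ends below `2` with high probability
(`measure_two_le_height_le`; failures need not be controlled while the height is negligible
against the remaining time), hence at `0` by parity (`exists_measure_finalHeight_ne_zero_le`).
The conditional probability of an event given the past is expressed by resampling the new row or
column. The argument needs the initial product of singular values to be nonzero, that is, an initial
minor of rank at least `r₀`. This follows from the second moment bound, by exposing the rows of the
minor one at a time (`sub_mul_measure_topProd_eq_zero_le`).

When the final height is `0`, the sum of the allowed errors bounds the difference of the two log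
potentials (`logPotential_le_of_finalHeight_eq_zero`). It tends to `0`, as it is a Riemann sum
for the integral of a power of `log (1 / x)` over a short interval at `0`, and the factor
`(log d) ^ 8` occurs only on an interval of length `d ^ (-1/4)` (`tendsto_sum_stepError`). The
constant `C₀ = 1` and the lower bound `d ^ (-1/8)` for `ε` suffice.
-/

/-! ### Variational characterisation of singular values -/

section SingularValues

open Module InnerProductSpace

theorem finrank_map_of_forall_eq_zero {E F : Type*} [AddCommGroup E] [Module ℂ E]
    [AddCommGroup F] [Module ℂ F] (T : E →ₗ[ℂ] F) (V : Submodule ℂ E)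
    (h : ∀ x ∈ V, T x = 0 → x = 0) :
    finrank ℂ (V.map T) = finrank ℂ V := by
  rw [← LinearMap.range_domRestrict]
  refine LinearMap.finrank_range_of_inj ?_
  rw [← LinearMap.ker_eq_bot, LinearMap.ker_eq_bot']
  rintro ⟨x, hx⟩ h0
  exact Subtype.ext (h x hx h0)

/-- The isometry sending the standard basis to a given orthonormal family. -/
noncomputable def isometryOfOrthonormal {E ι : Type*} [NormedAddCommGroup E]
    [InnerProductSpace ℂ E] [Fintype ι] {v : ι → E} (hv : Orthonormal ℂ v) :
    EuclideanSpace ℂ ι →ₗᵢ[ℂ] E :=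
  LinearMap.isometryOfInner ((EuclideanSpace.basisFun ι ℂ).toBasis.constr ℂ v) (by
    intro x y
    simp only [Module.Basis.constr_apply_fintype]
    rw [sum_inner, PiLp.inner_apply]
    refine Finset.sum_congr rfl fun i _ => ?_
    rw [inner_smul_left, hv.inner_right_fintype]
    simp [mul_comm])

theorem isometryOfOrthonormal_apply {E ι : Type*} [NormedAddCommGroup E]
    [InnerProductSpace ℂ E] [Fintype ι] {v : ι → E} (hv : Orthonormal ℂ v)
    (x : EuclideanSpace ℂ ι) : isometryOfOrthonormal hv x = ∑ i, x i • v i := by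
  change ((EuclideanSpace.basisFun ι ℂ).toBasis.constr ℂ v) x = _
  simp [Module.Basis.constr_apply_fintype]

variable {E F : Type*} [NormedAddCommGroup E] [InnerProductSpace ℂ E] [FiniteDimensional ℂ E]
  [NormedAddCommGroup F] [InnerProductSpace ℂ F] [FiniteDimensional ℂ F]

/-- An orthonormal basis of right singular vectors. -/
noncomputable def rightSingularBasis (T : E →ₗ[ℂ] F) :
    OrthonormalBasis (Fin (finrank ℂ E)) ℂ E :=
  T.isSymmetric_adjoint_comp_self.eigenvectorBasis rfl

theorem inner_apply_rightSingularBasis (T : E →ₗ[ℂ] F) (i : Fin (finrank ℂ E)) (x : E) :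
    ⟪T (rightSingularBasis T i), T x⟫_ℂ =
      (T.singularValues i : ℂ) ^ 2 * ⟪rightSingularBasis T i, x⟫_ℂ := by
  have h := T.isSymmetric_adjoint_comp_self.apply_eigenvectorBasis rfl i
  rw [← LinearMap.adjoint_inner_left]
  have h2 : LinearMap.adjoint T (T (rightSingularBasis T i)) =
      ((T.singularValues i : ℂ) ^ 2) • rightSingularBasis T i := by
    have := T.sq_singularValues_fin rfl i
    rw [← Complex.ofReal_pow, this]
    exact h
  rw [h2, inner_smul_left]
  simp

/-- Pythagoras in the basis of right singular vectors. -/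
theorem norm_sq_apply_eq_sum (T : E →ₗ[ℂ] F) (x : E) :
    ‖T x‖ ^ 2 = ∑ i : Fin (finrank ℂ E), T.singularValues i ^ 2 * ‖⟪rightSingularBasis T i, x⟫_ℂ‖ ^ 2 := by
  have hx := (rightSingularBasis T).sum_repr' x
  have h1 : ⟪T x, T x⟫_ℂ =
      ∑ i : Fin (finrank ℂ E), ((T.singularValues i ^ 2 * ‖⟪rightSingularBasis T i, x⟫_ℂ‖ ^ 2 : ℝ) : ℂ) := by
    conv_lhs => rw [← hx]
    rw [map_sum, sum_inner]
    refine Finset.sum_congr rfl fun i _ => ?_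
    rw [map_smul, inner_smul_left, ← map_sum, hx, inner_apply_rightSingularBasis, mul_left_comm,
      RCLike.conj_mul]
    push_cast; rfl
  rw [inner_self_eq_norm_sq_to_K, ← Complex.ofReal_sum] at h1
  exact Complex.ofReal_injective (by simpa using h1)

theorem norm_sq_eq_sum_inner (T : E →ₗ[ℂ] F) (x : E) :
    ‖x‖ ^ 2 = ∑ i, ‖⟪rightSingularBasis T i, x⟫_ℂ‖ ^ 2 :=
  ((rightSingularBasis T).sum_sq_norm_inner_right x).symm

/-- The span of the right singular vectors with index less than `j`. -/
noncomputable def topSpace (T : E →ₗ[ℂ] F) (j : ℕ) : Submodule ℂ E :=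
  Submodule.span ℂ (rightSingularBasis T '' {i | (i : ℕ) < j})

theorem mem_topSpace_orthogonal_iff (T : E →ₗ[ℂ] F) (j : ℕ) (x : E) :
    x ∈ (topSpace T j)ᗮ ↔ ∀ i : Fin (finrank ℂ E), (i : ℕ) < j →
      ⟪rightSingularBasis T i, x⟫_ℂ = 0 := by
  constructor
  · intro h i hi
    exact (Submodule.mem_orthogonal _ _).1 h _ (Submodule.subset_span ⟨i, hi, rfl⟩)
  · intro h
    rw [Submodule.mem_orthogonal]
    intro u hu
    induction hu using Submodule.span_induction with
    | mem x hx => obtain ⟨i, hi, rfl⟩ := hx; exact h i hi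
    | zero => simp
    | add x y _ _ hx hy => rw [inner_add_left, hx, hy, add_zero]
    | smul a x _ hx => rw [inner_smul_left, hx, mul_zero]

theorem inner_eq_zero_of_mem_topSpace (T : E →ₗ[ℂ] F) {j : ℕ} {x : E} (hx : x ∈ topSpace T j)
    {i : Fin (finrank ℂ E)} (hi : j ≤ i) : ⟪rightSingularBasis T i, x⟫_ℂ = 0 := by
  induction hx using Submodule.span_induction with
  | mem x hx =>
    obtain ⟨l, hl, rfl⟩ := hx
    have hl' : (l : ℕ) < j := hl
    exact (rightSingularBasis T).orthonormal.2 (by rintro rfl; omega)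
  | zero => simp
  | add x y _ _ hx hy => rw [inner_add_right, hx, hy, add_zero]
  | smul a x _ hx => rw [inner_smul_right, hx, mul_zero]

theorem finrank_topSpace (T : E →ₗ[ℂ] F) {j : ℕ} (hj : j ≤ finrank ℂ E) :
    finrank ℂ (topSpace T j) = j := by
  classical
  have hli : LinearIndepOn ℂ id (rightSingularBasis T '' {i | (i : ℕ) < j}) :=
    ((rightSingularBasis T).orthonormal.linearIndependent.linearIndepOn_id.mono
      (Set.image_subset_range _ _))
  have h1 := finrank_span_set_eq_card hli
  rw [topSpace, h1, Set.toFinset_card, Set.card_image_of_injective _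
    (rightSingularBasis T).orthonormal.linearIndependent.injective, ← Set.toFinset_card]
  simp only [Set.toFinset_ofPred]
  rw [Fin.card_filter_val_lt]
  omega

theorem finrank_topSpace_orthogonal (T : E →ₗ[ℂ] F) {j : ℕ} (hj : j ≤ finrank ℂ E) :
    finrank ℂ (topSpace T j)ᗮ = finrank ℂ E - j := by
  have := Submodule.finrank_add_finrank_orthogonal (topSpace T j)
  rw [finrank_topSpace T hj] at this
  omega

theorem norm_apply_le_of_mem_topSpace_orthogonal (T : E →ₗ[ℂ] F) {j : ℕ} {x : E}
    (hx : x ∈ (topSpace T j)ᗮ) : ‖T x‖ ≤ T.singularValues j * ‖x‖ := by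
  rw [mem_topSpace_orthogonal_iff] at hx
  refine le_of_sq_le_sq ?_ (mul_nonneg (T.singularValues_nonneg j) (norm_nonneg x))
  rw [norm_sq_apply_eq_sum, mul_pow, norm_sq_eq_sum_inner T, Finset.mul_sum]
  refine Finset.sum_le_sum fun i _ => ?_
  by_cases hi : (i : ℕ) < j
  · simp [hx i hi]
  · gcongr
    · exact T.singularValues_nonneg _
    · exact T.singularValues_antitone (not_lt.1 hi)

theorem le_norm_apply_of_mem_topSpace (T : E →ₗ[ℂ] F) {j : ℕ} {x : E}
    (hx : x ∈ topSpace T (j + 1)) : T.singularValues j * ‖x‖ ≤ ‖T x‖ := by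
  refine le_of_sq_le_sq ?_ (norm_nonneg _)
  rw [norm_sq_apply_eq_sum, mul_pow, norm_sq_eq_sum_inner T, Finset.mul_sum]
  refine Finset.sum_le_sum fun i _ => ?_
  by_cases hi : (i : ℕ) < j + 1
  · gcongr
    · exact T.singularValues_nonneg _
    · exact T.singularValues_antitone (Nat.lt_succ_iff.1 hi)
  · simp [inner_eq_zero_of_mem_topSpace T hx (not_lt.1 hi)]

/-- The lower half of the Courant–Fischer principle. -/
theorem le_singularValues_of_forall_mem (T : E →ₗ[ℂ] F) {j : ℕ} {c : ℝ} (V : Submodule ℂ E)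
    (hV : j < finrank ℂ V) (h : ∀ x ∈ V, c * ‖x‖ ≤ ‖T x‖) : c ≤ T.singularValues j := by
  have hE : finrank ℂ V ≤ finrank ℂ E := Submodule.finrank_le V
  have hne : V ⊓ (topSpace T j)ᗮ ≠ ⊥ := by
    intro hbot
    have h1 := Submodule.finrank_add_finrank_le_of_disjoint (disjoint_iff.2 hbot)
    rw [finrank_topSpace_orthogonal T (by omega)] at h1
    omega
  obtain ⟨x, hx, hx0⟩ := Submodule.exists_mem_ne_zero_of_ne_bot hne
  have h1 := (h x hx.1).trans (norm_apply_le_of_mem_topSpace_orthogonal T hx.2)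
  exact le_of_mul_le_mul_right h1 (norm_pos_iff.2 hx0)

/-- Compressing a linear map by an isometry on the right and a contraction on the left does not
increase its singular values. -/
theorem singularValues_comp_le {E' F' : Type*} [NormedAddCommGroup E'] [InnerProductSpace ℂ E']
    [FiniteDimensional ℂ E'] [NormedAddCommGroup F'] [InnerProductSpace ℂ F']
    [FiniteDimensional ℂ F'] (T : E →ₗ[ℂ] F) (S : E' →ₗ[ℂ] F') (A : E' →ₗᵢ[ℂ] E)
    (h : ∀ x, ‖S x‖ ≤ ‖T (A x)‖) (j : ℕ) : S.singularValues j ≤ T.singularValues j := by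
  by_cases hj : j < finrank ℂ E'
  · refine le_singularValues_of_forall_mem T ((topSpace S (j + 1)).map A.toLinearMap) ?_ ?_
    · rw [finrank_map_of_forall_eq_zero _ _ fun x _ hx =>
          (map_eq_zero_iff A A.injective).1 hx,
        finrank_topSpace S hj]
      omega
    · rintro _ ⟨x, hx, rfl⟩
      simpa using (le_norm_apply_of_mem_topSpace S hx).trans (h x)
  · rw [S.singularValues_of_finrank_le (not_lt.1 hj)]
    exact T.singularValues_nonneg j

/-- Weyl's inequality: singular values are Lipschitz in the operator norm. -/
theorem singularValues_le_add (S T : E →ₗ[ℂ] F) {K : ℝ} (h : ∀ x, ‖S x - T x‖ ≤ K * ‖x‖) (j : ℕ)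
    (hK : 0 ≤ K) : S.singularValues j ≤ T.singularValues j + K := by
  by_cases hj : j < finrank ℂ E
  · rw [← sub_le_iff_le_add]
    refine le_singularValues_of_forall_mem T (topSpace S (j + 1)) ?_ fun x hx => ?_
    · rw [finrank_topSpace S hj]; omega
    · have h1 := le_norm_apply_of_mem_topSpace S hx
      have h2 := norm_sub_norm_le (S x) (T x)
      have h3 := h x
      rw [sub_mul]; linarith
  · rw [S.singularValues_of_finrank_le (not_lt.1 hj)]
    exact add_nonneg (T.singularValues_nonneg j) hK

/-- The image of the top right singular space is a test space for the adjoint. -/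
theorem singularValues_le_adjoint (T : E →ₗ[ℂ] F) (j : ℕ) :
    T.singularValues j ≤ (LinearMap.adjoint T).singularValues j := by
  rcases (T.singularValues_nonneg j).eq_or_lt with h0 | hpos
  · rw [← h0]; exact LinearMap.singularValues_nonneg _ _
  have hj : j < finrank ℂ E := by
    by_contra hj
    rw [T.singularValues_of_finrank_le (not_lt.1 hj)] at hpos
    exact lt_irrefl _ hpos
  have hinj : ∀ x ∈ topSpace T (j + 1), T x = 0 → x = 0 := by
    intro x hx h0
    have := le_norm_apply_of_mem_topSpace T hx
    rw [h0, norm_zero] at this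
    have h2 : ‖x‖ ≤ 0 := nonpos_of_mul_nonpos_right this hpos
    simpa using h2
  refine le_singularValues_of_forall_mem _ ((topSpace T (j + 1)).map T) ?_ ?_
  · rw [finrank_map_of_forall_eq_zero T _ hinj, finrank_topSpace T hj]; omega
  · rintro _ ⟨x, hx, rfl⟩
    rcases eq_or_ne x 0 with rfl | hx0
    · simp
    have h1 : ‖T x‖ ^ 2 ≤ ‖LinearMap.adjoint T (T x)‖ * ‖x‖ := by
      have h2 : ⟪LinearMap.adjoint T (T x), x⟫_ℂ = ((‖T x‖ ^ 2 : ℝ) : ℂ) := by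
        rw [LinearMap.adjoint_inner_left, inner_self_eq_norm_sq_to_K]; norm_cast
      have h3 := norm_inner_le_norm (𝕜 := ℂ) (LinearMap.adjoint T (T x)) x
      rw [h2, Complex.norm_real, Real.norm_of_nonneg (by positivity)] at h3
      exact h3
    have h4 := le_norm_apply_of_mem_topSpace T hx
    have hxp := norm_pos_iff.2 hx0
    refine le_of_mul_le_mul_right ?_ hxp
    calc T.singularValues j * ‖T x‖ * ‖x‖ = (T.singularValues j * ‖x‖) * ‖T x‖ := by ring
      _ ≤ ‖T x‖ * ‖T x‖ := by gcongr
      _ = ‖T x‖ ^ 2 := by ring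
      _ ≤ _ := h1

theorem singularValues_adjoint (T : E →ₗ[ℂ] F) (j : ℕ) :
    (LinearMap.adjoint T).singularValues j = T.singularValues j := by
  refine le_antisymm ?_ (singularValues_le_adjoint T j)
  simpa using singularValues_le_adjoint (LinearMap.adjoint T) j

/-- The determinant of a compression to orthonormal families is at most the product of the top
singular values. -/
theorem norm_det_inner_le_prod_singularValues {ι : Type*} [Fintype ι] [DecidableEq ι]
    (T : E →ₗ[ℂ] F) {u : ι → F} {v : ι → E} (hu : Orthonormal ℂ u) (hv : Orthonormal ℂ v) :
    ‖(Matrix.of fun i j => ⟪u i, T (v j)⟫_ℂ).det‖ ≤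
      ∏ i ∈ Finset.range (Fintype.card ι), T.singularValues i := by
  let A := isometryOfOrthonormal hv
  let S : EuclideanSpace ℂ ι →ₗ[ℂ] EuclideanSpace ℂ ι :=
    Matrix.toEuclideanLin (Matrix.of fun i j => ⟪u i, T (v j)⟫_ℂ)
  have hS : ∀ x, ‖S x‖ ≤ ‖T (A x)‖ := by
    intro x
    refine le_of_sq_le_sq ?_ (norm_nonneg _)
    have h1 : ∀ i, S x i = ⟪u i, T (A x)⟫_ℂ := by
      intro i
      rw [isometryOfOrthonormal_apply, map_sum, inner_sum]
      simp [S, Matrix.toLpLin_apply, Matrix.mulVec, dotProduct, inner_smul_right, mul_comm]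
    rw [EuclideanSpace.norm_sq_eq]
    simp_rw [h1]
    exact hu.sum_inner_products_le (s := Finset.univ) (T (A x))
  have h2 : ‖(Matrix.of fun i j => ⟪u i, T (v j)⟫_ℂ).det‖ = S.normDet := by
    rw [LinearMap.normDet_eq_norm_det]
    congr 1
    simp [S, Matrix.toEuclideanLin]
  rw [h2, LinearMap.normDet_eq_prod_singularValues, finrank_euclideanSpace]
  exact Finset.prod_le_prod (fun i _ => S.singularValues_nonneg i)
    fun i _ => singularValues_comp_le T S A hS i

end SingularValues

/-! ### Appending a row -/

section RowStep

open Module InnerProductSpace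

/-- The map `T'` extends `T` by one more coordinate, the functional `x ↦ ⟪a, x⟫`. The top `r` singular
vectors of `T`, together with the projection of `a` to their orthogonal complement, form a test family
on which the compression of `T'` is triangular. -/
theorem prod_singularValues_mul_norm_le {E F F' : Type*}
    [NormedAddCommGroup E] [InnerProductSpace ℂ E] [FiniteDimensional ℂ E]
    [NormedAddCommGroup F] [InnerProductSpace ℂ F] [FiniteDimensional ℂ F]
    [NormedAddCommGroup F'] [InnerProductSpace ℂ F'] [FiniteDimensional ℂ F']
    (T : E →ₗ[ℂ] F) (T' : E →ₗ[ℂ] F') (J : F →ₗᵢ[ℂ] F') (e : F') (a : E)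
    (hJ : ∀ y x, ⟪J y, T' x⟫_ℂ = ⟪y, T x⟫_ℂ) (he : ‖e‖ = 1) (heJ : ∀ y, ⟪J y, e⟫_ℂ = 0)
    (hea : ∀ x, ⟪e, T' x⟫_ℂ = ⟪a, x⟫_ℂ) {r : ℕ} (hr : ∀ j < r, 0 < T.singularValues j) :
    (∏ j ∈ Finset.range r, T.singularValues j) * ‖(topSpace T r)ᗮ.starProjection a‖ ≤
      ∏ j ∈ Finset.range (r + 1), T'.singularValues j := by
  set H := (topSpace T r)ᗮ with hH
  set b := H.starProjection a with hb
  have hbH : b ∈ H := Submodule.starProjection_apply_mem _ _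
  rcases eq_or_ne b 0 with h0 | h0
  · rw [h0, norm_zero, mul_zero]
    exact Finset.prod_nonneg fun i _ => T'.singularValues_nonneg i
  have hrn : r ≤ finrank ℂ E := by
    by_contra! hlt
    exact (hr _ hlt).ne' (T.singularValues_of_finrank_le le_rfl)
  have hbn : ‖b‖ ≠ 0 := norm_ne_zero_iff.2 h0
  let c : Fin r → Fin (finrank ℂ E) := Fin.castLE hrn
  let v : Fin r ⊕ Unit → E :=
    Sum.elim (fun i => rightSingularBasis T (c i)) fun _ => ((‖b‖ : ℂ)⁻¹) • b
  let u : Fin r ⊕ Unit → F' :=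
    Sum.elim (fun i => J (((T.singularValues i : ℂ)⁻¹) • T (rightSingularBasis T (c i))))
      fun _ => e
  have hσ : ∀ i : Fin r, (T.singularValues i : ℂ) ≠ 0 := fun i => by
    exact_mod_cast (hr i i.2).ne'
  have hvb : ∀ i : Fin r, ⟪rightSingularBasis T (c i), b⟫_ℂ = 0 := fun i =>
    (mem_topSpace_orthogonal_iff T r b).1 hbH (c i) i.2
  have hcinj : Function.Injective c := Fin.castLE_injective hrn
  have hvv : ∀ i j : Fin r, ⟪rightSingularBasis T (c i), rightSingularBasis T (c j)⟫_ℂ =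
      if i = j then 1 else 0 := fun i j => by
    rw [orthonormal_iff_ite.1 (rightSingularBasis T).orthonormal]
    simp [hcinj.eq_iff]
  have hTT : ∀ (i : Fin r) (x : E), ⟪T (rightSingularBasis T (c i)), T x⟫_ℂ =
      (T.singularValues i : ℂ) ^ 2 * ⟪rightSingularBasis T (c i), x⟫_ℂ := fun i x =>
    inner_apply_rightSingularBasis T (c i) x
  have hbb : ⟪b, b⟫_ℂ = (‖b‖ : ℂ) ^ 2 := inner_self_eq_norm_sq_to_K b
  have hbn' : (‖b‖ : ℂ) ≠ 0 := by exact_mod_cast hbn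
  have hv : Orthonormal ℂ v := by
    rw [orthonormal_iff_ite]
    rintro (i | i) (j | j)
    · simp [v, hvv]
    · simp [v, inner_smul_right, hvb]
    · simp only [v, Sum.elim_inr, Sum.elim_inl, inner_smul_left]
      rw [← inner_conj_symm, hvb]
      simp
    · simp only [v, Sum.elim_inr, inner_smul_left, inner_smul_right, hbb]
      simp
      field_simp
  have hu : Orthonormal ℂ u := by
    rw [orthonormal_iff_ite]
    rintro (i | i) (j | j)
    · simp only [u, Sum.elim_inl, LinearIsometry.inner_map_map, inner_smul_left, inner_smul_right,
        hTT, hvv]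
      by_cases hij : i = j
      · subst hij
        have := hσ i
        simp
        field_simp
      · simp [hij]
    · simp only [u, Sum.elim_inl, Sum.elim_inr, heJ]
      simp
    · simp only [u, Sum.elim_inr, Sum.elim_inl]
      rw [← inner_conj_symm, heJ]
      simp
    · simp only [u, Sum.elim_inr]
      rw [inner_self_eq_norm_sq_to_K, he]
      simp
  have hdet := norm_det_inner_le_prod_singularValues T' hu hv
  have hmat : (Matrix.of fun i j => ⟪u i, T' (v j)⟫_ℂ) =
      Matrix.fromBlocks (Matrix.diagonal fun i : Fin r => (T.singularValues i : ℂ)) 0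
        (Matrix.of fun _ j => ⟪u (Sum.inr ()), T' (v (Sum.inl j))⟫_ℂ)
        (Matrix.of fun _ _ => (‖b‖ : ℂ)) := by
    ext i j
    rcases i with i | i <;> rcases j with j | j
    · simp only [Matrix.of_apply, Matrix.fromBlocks_apply₁₁, u, v, Sum.elim_inl, hJ,
        inner_smul_left, hTT, hvv]
      by_cases hij : i = j
      · subst hij
        have := hσ i
        simp
        field_simp
      · simp [hij]
    · simp only [Matrix.of_apply, Matrix.fromBlocks_apply₁₂, u, v, Sum.elim_inl, Sum.elim_inr, hJ,
        inner_smul_left, inner_smul_right, map_smul, hTT, hvb]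
      simp
    · rfl
    · simp only [Matrix.of_apply, Matrix.fromBlocks_apply₂₂, u, v, Sum.elim_inr, hea,
        inner_smul_right]
      have : ⟪a, b⟫_ℂ = (‖b‖ : ℂ) ^ 2 := by
        rw [← hbb, ← sub_eq_zero, ← inner_sub_left]
        exact Submodule.starProjection_inner_eq_zero a b hbH
      rw [this]
      field_simp
  rw [hmat, Matrix.det_fromBlocks_zero₁₂, Matrix.det_diagonal] at hdet
  simp only [Matrix.det_unique, Matrix.of_apply, norm_mul, norm_prod, Complex.norm_real,
    Fintype.card_sum, Fintype.card_fin, Fintype.card_unit, norm_norm] at hdet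
  convert! hdet using 2
  rw [Finset.prod_range]
  refine Finset.prod_congr rfl fun i _ => ?_
  rw [Real.norm_of_nonneg (T.singularValues_nonneg _)]

end RowStep

section Matrices

open Module InnerProductSpace

theorem toEuclideanLin_apply_coord {ι κ : Type*} [Fintype κ] [DecidableEq κ] (M : Matrix ι κ ℂ) (x : EuclideanSpace ℂ κ) (i : ι) :
    Matrix.toEuclideanLin M x i = ∑ j, M i j * x j := by
  simp [Matrix.toLpLin_apply, Matrix.mulVec, dotProduct]

theorem orthonormal_single_comp {κ κ' : Type*} [Fintype κ'] [DecidableEq κ'] {g : κ → κ'} (hg : Function.Injective g) :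
    Orthonormal ℂ fun j => EuclideanSpace.single (g j) (1 : ℂ) := by
  have := (EuclideanSpace.orthonormal_single (𝕜 := ℂ) (ι := κ')).comp g hg
  simpa [Function.comp_def] using this

variable {ι κ ι' κ' : Type*} [Fintype ι] [Fintype κ] [Fintype ι'] [Fintype κ']
  [DecidableEq κ] [DecidableEq κ']

/-- Interlacing: passing to a submatrix does not increase singular values. -/
theorem singularValues_submatrix_le (N : Matrix ι' κ' ℂ) {f : ι → ι'} {g : κ → κ'}
    (hf : Function.Injective f) (hg : Function.Injective g) (j : ℕ) :
    (Matrix.toEuclideanLin (N.submatrix f g)).singularValues j ≤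
      (Matrix.toEuclideanLin N).singularValues j := by
  classical
  refine singularValues_comp_le _ _ (isometryOfOrthonormal (orthonormal_single_comp hg))
    (fun x => ?_) j
  refine le_of_sq_le_sq ?_ (norm_nonneg _)
  rw [EuclideanSpace.norm_sq_eq, EuclideanSpace.norm_sq_eq]
  have h1 : ∀ i, Matrix.toEuclideanLin (N.submatrix f g) x i =
      Matrix.toEuclideanLin N (isometryOfOrthonormal (orthonormal_single_comp hg) x) (f i) := by
    intro i
    rw [isometryOfOrthonormal_apply, map_sum, toEuclideanLin_apply_coord]
    simp only [map_smul, Matrix.submatrix_apply, WithLp.ofLp_sum, WithLp.ofLp_smul,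
      Finset.sum_apply, Pi.smul_apply, smul_eq_mul]
    refine Finset.sum_congr rfl fun j _ => ?_
    rw [toEuclideanLin_apply_coord, mul_comm]
    simp
  simp_rw [h1]
  rw [← Finset.sum_image (s := Finset.univ) (g := f)
    (f := fun i' => ‖Matrix.toEuclideanLin N
      (isometryOfOrthonormal (orthonormal_single_comp hg) x) i'‖ ^ 2) hf.injOn]
  exact Finset.sum_le_univ_sum_of_nonneg fun i => sq_nonneg _

/-- Appending a row to a matrix multiplies the product of the top singular values by at least the
length of the projection of the (conjugated) row to the bottom right singular space. -/
theorem prod_singularValues_mul_norm_row_le [DecidableEq ι'] (M : Matrix ι κ ℂ) (N : Matrix ι' κ ℂ)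
    {f : ι → ι'} (hf : Function.Injective f) (hM : M = N.submatrix f id) {i₀ : ι'}
    (hi₀ : ∀ i, f i ≠ i₀) {r : ℕ}
    (hr : ∀ j < r, 0 < (Matrix.toEuclideanLin M).singularValues j) :
    (∏ j ∈ Finset.range r, (Matrix.toEuclideanLin M).singularValues j) *
        ‖(topSpace (Matrix.toEuclideanLin M) r)ᗮ.starProjection
          (WithLp.toLp 2 fun j => star (N i₀ j))‖ ≤
      ∏ j ∈ Finset.range (r + 1), (Matrix.toEuclideanLin N).singularValues j := by
  classical
  refine prod_singularValues_mul_norm_le _ _ (isometryOfOrthonormal (orthonormal_single_comp hf))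
    (EuclideanSpace.single i₀ (1 : ℂ)) _ ?_ ?_ ?_ ?_ hr
  · intro y x
    rw [isometryOfOrthonormal_apply, sum_inner, PiLp.inner_apply]
    refine Finset.sum_congr rfl fun i _ => ?_
    rw [inner_smul_left, EuclideanSpace.inner_single_left, toEuclideanLin_apply_coord,
      toEuclideanLin_apply_coord, hM]
    simp [mul_comm]
  · simp
  · intro y
    rw [isometryOfOrthonormal_apply, sum_inner]
    refine Finset.sum_eq_zero fun i _ => ?_
    rw [inner_smul_left, EuclideanSpace.inner_single_left]
    simp [hi₀ i]
  · intro x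
    rw [EuclideanSpace.inner_single_left, toEuclideanLin_apply_coord, PiLp.inner_apply]
    simp [mul_comm]

theorem singularValues_conjTranspose [DecidableEq ι] (M : Matrix ι κ ℂ) (j : ℕ) :
    (Matrix.toEuclideanLin M.conjTranspose).singularValues j =
      (Matrix.toEuclideanLin M).singularValues j := by
  rw [Matrix.toEuclideanLin_conjTranspose_eq_adjoint, singularValues_adjoint]

theorem continuous_singularValues (j : ℕ) :
    Continuous fun M : Matrix ι κ ℂ => (Matrix.toEuclideanLin M).singularValues j := by
  let Φ : Matrix ι κ ℂ →ₗ[ℂ] (EuclideanSpace ℂ κ →L[ℂ] EuclideanSpace ℂ ι) :=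
    LinearMap.toContinuousLinearMap.toLinearMap ∘ₗ (Matrix.toEuclideanLin (𝕜 := ℂ)).toLinearMap
  have hΦ : Continuous Φ := Φ.continuous_of_finiteDimensional
  have key : ∀ M N : Matrix ι κ ℂ, (Matrix.toEuclideanLin M).singularValues j ≤
      (Matrix.toEuclideanLin N).singularValues j + ‖Φ M - Φ N‖ := by
    intro M N
    refine singularValues_le_add _ _ (fun x => ?_) j (norm_nonneg _)
    exact (Φ M - Φ N).le_opNorm x
  rw [continuous_iff_continuousAt]
  intro M
  have h0 : Tendsto (fun N => ‖Φ N - Φ M‖) (𝓝 M) (𝓝 0) := by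
    simpa using ((hΦ.sub continuous_const).norm.tendsto M : Tendsto (fun N => ‖Φ N - Φ M‖) _ _)
  refine tendsto_iff_norm_sub_tendsto_zero.2 (squeeze_zero (fun _ => norm_nonneg _) (fun N => ?_) h0)
  rw [Real.norm_eq_abs, abs_le]
  have h1 := key M N
  have h2 := key N M
  rw [norm_sub_rev] at h1
  constructor <;> linarith

end Matrices

/-! ### Log sums and products of singular values -/

section LogSum

variable {ι κ ι' κ' : Type*} [Fintype ι] [Fintype κ] [DecidableEq κ]
  [Fintype ι'] [Fintype κ'] [DecidableEq κ']

/-- The product `σ_1(M) ⋯ σ_r(M)` of the top `r` singular values. -/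
noncomputable def topProd (M : Matrix ι κ ℂ) (r : ℕ) : ℝ :=
  ∏ j ∈ Finset.range r, (Matrix.toEuclideanLin M).singularValues j

theorem topProd_nonneg (M : Matrix ι κ ℂ) (r : ℕ) : 0 ≤ topProd M r :=
  Finset.prod_nonneg fun _ _ => LinearMap.singularValues_nonneg _ _

theorem topProd_pos_iff (M : Matrix ι κ ℂ) (r : ℕ) :
    0 < topProd M r ↔ ∀ j < r, 0 < (Matrix.toEuclideanLin M).singularValues j := by
  rw [(topProd_nonneg M r).lt_iff_ne, ne_comm, topProd, Finset.prod_ne_zero_iff]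
  simp only [Finset.mem_range, LinearMap.singularValues_pos_iff_ne_zero]

theorem topProd_succ (M : Matrix ι κ ℂ) (r : ℕ) :
    topProd M (r + 1) = topProd M r * (Matrix.toEuclideanLin M).singularValues r :=
  Finset.prod_range_succ _ _

theorem logSum_eq_of_pos (n : ℕ) {M : Matrix ι κ ℂ} {r : ℕ} (h : 0 < topProd M r) :
    logSum n M r = ((-((n : ℝ)⁻¹ * Real.log (topProd M r)) : ℝ) : EReal) := by
  rw [topProd_pos_iff] at h
  have h1 : ∀ j ∈ Finset.Icc 1 r, ENNReal.log (ENNReal.ofReal (sigmaValue M j)) =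
      ((Real.log (sigmaValue M j) : ℝ) : EReal) := fun j hj => by
    rw [Finset.mem_Icc] at hj
    exact ENNReal.log_ofReal_of_pos (h _ (by omega))
  rw [logSum, Finset.sum_congr rfl h1, topProd, Real.log_prod fun j hj =>
    (h j (Finset.mem_range.1 hj)).ne', EReal.coe_neg, EReal.coe_mul]
  congr 2
  let φ : ℝ →+ EReal := ⟨⟨((↑) : ℝ → EReal), EReal.coe_zero⟩, EReal.coe_add⟩
  refine (map_sum φ _ _).symm.trans (congrArg ((↑) : ℝ → EReal) ?_)
  have hIcc : Finset.Icc 1 r = Finset.Ico (0 + 1) (r + 1) := by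
    ext j; simp only [Finset.mem_Icc, Finset.mem_Ico]; omega
  rw [hIcc, Finset.range_eq_Ico, ← Finset.sum_Ico_add' (fun j => Real.log (sigmaValue M j)) 0 r 1]
  rfl

/-- The junk-free value of the log sum when one of its singular values vanishes. -/
theorem logSum_eq_top {n : ℕ} (hn : 0 < n) {M : Matrix ι κ ℂ} {r : ℕ} (h : ¬ 0 < topProd M r) :
    logSum n M r = ⊤ := by
  rw [topProd_pos_iff] at h
  push Not at h
  obtain ⟨j, hj, h0⟩ := h
  have hterm : ENNReal.log (ENNReal.ofReal (sigmaValue M (j + 1))) = ⊥ := by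
    rw [sigmaValue, Nat.add_sub_cancel, ENNReal.ofReal_of_nonpos h0, ENNReal.log_zero]
  have hsum : ∑ j ∈ Finset.Icc 1 r, ENNReal.log (ENNReal.ofReal (sigmaValue M j)) = ⊥ := by
    rw [← Finset.add_sum_erase _ _ (Finset.mem_Icc.2 ⟨Nat.succ_le_succ (Nat.zero_le j), hj⟩)]
    rw [hterm, EReal.bot_add]
  rw [logSum, hsum, EReal.coe_mul_bot_of_pos (by positivity), EReal.neg_bot]

theorem topProd_le_of_forall_le {M : Matrix ι κ ℂ} {N : Matrix ι' κ' ℂ}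
    (h : ∀ j, (Matrix.toEuclideanLin M).singularValues j ≤
      (Matrix.toEuclideanLin N).singularValues j) (r : ℕ) : topProd M r ≤ topProd N r :=
  Finset.prod_le_prod (fun _ _ => LinearMap.singularValues_nonneg _ _) fun j _ => h j

theorem logSum_le_logSum {n : ℕ} (hn : 0 < n) {M : Matrix ι κ ℂ} {N : Matrix ι' κ' ℂ} {r : ℕ}
    (h : topProd M r ≤ topProd N r) : logSum n N r ≤ logSum n M r := by
  by_cases h0 : 0 < topProd M r
  · rw [logSum_eq_of_pos n h0, logSum_eq_of_pos n (h0.trans_le h), EReal.coe_le_coe_iff]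
    have := Real.log_le_log h0 h
    have h2 : 0 ≤ (n : ℝ)⁻¹ := by positivity
    nlinarith [mul_le_mul_of_nonneg_left this h2]
  · rw [logSum_eq_top hn h0]; exact le_top

/-- The condition for taking one more singular value, in multiplicative form. -/
theorem logSum_succ_le_iff {n : ℕ} (hn : 0 < n) {M : Matrix ι κ ℂ} {N : Matrix ι' κ' ℂ} {r : ℕ}
    (h0 : 0 < topProd M r) (δ : ℝ) :
    logSum n N (r + 1) ≤ logSum n M r + (δ : EReal) ↔
      topProd M r * Real.exp (-(n * δ)) ≤ topProd N (r + 1) := by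
  have hn' : (0 : ℝ) < n := by exact_mod_cast hn
  have hpos : 0 < topProd M r * Real.exp (-(n * δ)) := mul_pos h0 (Real.exp_pos _)
  rw [logSum_eq_of_pos n h0, ← EReal.coe_add]
  by_cases h1 : 0 < topProd N (r + 1)
  · rw [logSum_eq_of_pos n h1, EReal.coe_le_coe_iff, ← Real.log_le_log_iff hpos h1,
      Real.log_mul h0.ne' (Real.exp_pos _).ne', Real.log_exp, ← mul_le_mul_iff_right₀ hn']
    field_simp
    constructor <;> intro h <;> linarith
  · rw [logSum_eq_top hn h1]
    constructor
    · intro h; exact absurd (top_le_iff.1 h) (EReal.coe_ne_top _)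
    · intro h; exact absurd (hpos.trans_le h) h1

theorem le_card_of_topProd_pos [DecidableEq ι] {M : Matrix ι κ ℂ} {r : ℕ}
    (h : 0 < topProd M r) : r ≤ Fintype.card ι ∧ r ≤ Fintype.card κ := by
  rw [topProd_pos_iff] at h
  constructor
  · by_contra! hlt
    have := h _ hlt
    rw [← singularValues_conjTranspose, LinearMap.singularValues_of_finrank_le _ (by simp)] at this
    exact lt_irrefl _ this
  · by_contra! hlt
    have := h _ hlt
    rw [LinearMap.singularValues_of_finrank_le _ (by simp)] at this
    exact lt_irrefl _ this

theorem topProd_conjTranspose [DecidableEq ι] (M : Matrix ι κ ℂ) (r : ℕ) :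
    topProd M.conjTranspose r = topProd M r := by
  simp only [topProd, singularValues_conjTranspose]

theorem continuous_topProd (r : ℕ) : Continuous fun M : Matrix ι κ ℂ => topProd M r :=
  continuous_finsetProd _ fun j _ => continuous_singularValues j

end LogSum

/-! ### Approximate kernels and sparse column sets -/

section Peeling

open Module InnerProductSpace

variable {ι κ : Type*} [Fintype ι] [Fintype κ] [DecidableEq κ]

/-- The projection of a standard basis vector to a subspace. -/
noncomputable def coordProj (H : Submodule ℂ (EuclideanSpace ℂ κ)) (j : κ) : EuclideanSpace ℂ κ :=
  H.starProjection (EuclideanSpace.single j 1)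

theorem starProjection_eq_sum (H : Submodule ℂ (EuclideanSpace ℂ κ)) (x : κ → ℂ) :
    H.starProjection (WithLp.toLp 2 x) = ∑ j, x j • coordProj H j := by
  have h : (WithLp.toLp 2 x : EuclideanSpace ℂ κ) = ∑ j, x j • EuclideanSpace.single j (1 : ℂ) := by
    ext i
    simp [Finset.sum_apply, Pi.single_apply]
  rw [h, map_sum]
  exact Finset.sum_congr rfl fun j _ => map_smul _ _ _

theorem norm_coordProj_le_one (H : Submodule ℂ (EuclideanSpace ℂ κ)) (j : κ) :
    ‖coordProj H j‖ ≤ 1 :=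
  (H.norm_starProjection_apply_le _).trans (by simp)

theorem sum_norm_sq_coordProj (H : Submodule ℂ (EuclideanSpace ℂ κ)) :
    ∑ j, ‖coordProj H j‖ ^ 2 = finrank ℂ H := by
  let b := stdOrthonormalBasis ℂ H
  have h1 : ∀ j, ‖coordProj H j‖ ^ 2 = ∑ l, ‖(b l : EuclideanSpace ℂ κ) j‖ ^ 2 := by
    intro j
    have h2 := b.sum_sq_norm_inner_right (H.orthogonalProjectionOnto (EuclideanSpace.single j 1))
    have h3 : ‖H.orthogonalProjectionOnto (EuclideanSpace.single j (1 : ℂ))‖ = ‖coordProj H j‖ := rfl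
    rw [h3] at h2
    rw [← h2]
    refine Finset.sum_congr rfl fun l _ => ?_
    rw [Submodule.inner_orthogonalProjectionOnto_eq_of_mem_left, EuclideanSpace.inner_single_right]
    simp
  simp_rw [h1]
  rw [Finset.sum_comm]
  have h4 : ∀ l, ∑ j, ‖(b l : EuclideanSpace ℂ κ) j‖ ^ 2 = 1 := by
    intro l
    rw [← EuclideanSpace.norm_sq_eq, ← Submodule.coe_norm, b.orthonormal.1 l, one_pow]
  simp [h4]

/-- If `B` is small on `H`, then projecting a (conjugated) row of `B` to `H` gives a short
vector. -/
theorem norm_sum_row_coordProj_le (B : Matrix ι κ ℂ) (H : Submodule ℂ (EuclideanSpace ℂ κ)) {τ : ℝ}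
    (hτ0 : 0 ≤ τ) (hτ : ∀ u ∈ H, ‖Matrix.toEuclideanLin B u‖ ≤ τ * ‖u‖) (i : ι) :
    ‖∑ j, star (B i j) • coordProj H j‖ ≤ τ := by
  rw [← starProjection_eq_sum]
  set a : EuclideanSpace ℂ κ := WithLp.toLp 2 fun j => star (B i j) with ha
  set w := H.starProjection a with hw
  have hwH : w ∈ H := Submodule.starProjection_apply_mem _ _
  have h1 : ⟪a, w⟫_ℂ = Matrix.toEuclideanLin B w i := by
    rw [toEuclideanLin_apply_coord, PiLp.inner_apply]
    simp [ha, mul_comm]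
  have h2 : ⟪w, w⟫_ℂ = ⟪a, w⟫_ℂ := by
    rw [← sub_eq_zero, ← inner_sub_left, ← neg_sub, inner_neg_left]
    rw [Submodule.starProjection_inner_eq_zero a w hwH, neg_zero]
  have h3 : ‖w‖ ^ 2 ≤ τ * ‖w‖ := by
    have h4 : ‖⟪w, w⟫_ℂ‖ = ‖w‖ ^ 2 := by
      rw [inner_self_eq_norm_sq_to_K]; simp
    rw [← h4, h2, h1]
    exact (PiLp.norm_apply_le _ i).trans (hτ w hwH)
  rcases (norm_nonneg w).eq_or_lt with h0 | h0
  · rw [← h0]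
    exact hτ0
  · rw [sq] at h3
    exact le_of_mul_le_mul_right h3 h0

/-- The column `j` can be peeled from the set `S` of columns of `B` if some row of `B` has a large
entry in column `j`, vanishes in the other columns of `S`, and has bounded `ℓ¹` norm outside `S`. -/
def Peelable (B : Matrix ι κ ℂ) (c Q : ℝ) (S : Finset κ) (j : κ) : Prop :=
  ∃ i, c ≤ ‖B i j‖ ∧ (∀ j' ∈ S, j' ≠ j → B i j' = 0) ∧ ∑ j' ∈ Sᶜ, ‖B i j'‖ ≤ Q

theorem Peelable.mul_norm_coordProj_le {B : Matrix ι κ ℂ} {c Q : ℝ} {S : Finset κ} {j : κ}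
    (h : Peelable B c Q S j) (hj : j ∈ S) {H : Submodule ℂ (EuclideanSpace ℂ κ)} {τ W : ℝ}
    (hτ0 : 0 ≤ τ) (hτ : ∀ u ∈ H, ‖Matrix.toEuclideanLin B u‖ ≤ τ * ‖u‖) (hW0 : 0 ≤ W)
    (hW : ∀ j' ∉ S, ‖coordProj H j'‖ ≤ W) : c * ‖coordProj H j‖ ≤ τ + Q * W := by
  obtain ⟨i, hc, hz, hQ⟩ := h
  have h1 := norm_sum_row_coordProj_le B H hτ0 hτ i
  have h2 : ∑ j', star (B i j') • coordProj H j' =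
      star (B i j) • coordProj H j + ∑ j' ∈ Sᶜ, star (B i j') • coordProj H j' := by
    rw [← Finset.sum_add_sum_compl S, Finset.sum_eq_single_of_mem j hj]
    intro j' hj' hne
    rw [hz j' hj' hne, star_zero, zero_smul]
  have h3 : ‖∑ j' ∈ Sᶜ, star (B i j') • coordProj H j'‖ ≤ Q * W := by
    calc _ ≤ ∑ j' ∈ Sᶜ, ‖star (B i j') • coordProj H j'‖ := norm_sum_le _ _
      _ ≤ ∑ j' ∈ Sᶜ, ‖B i j'‖ * W := Finset.sum_le_sum fun j' hj' => by
          rw [norm_smul, norm_star]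
          exact mul_le_mul_of_nonneg_left (hW j' (Finset.mem_compl.1 hj')) (norm_nonneg _)
      _ = (∑ j' ∈ Sᶜ, ‖B i j'‖) * W := (Finset.sum_mul _ _ _).symm
      _ ≤ Q * W := by gcongr
  calc c * ‖coordProj H j‖ ≤ ‖B i j‖ * ‖coordProj H j‖ := by gcongr
    _ = ‖star (B i j) • coordProj H j‖ := by rw [norm_smul, norm_star]
    _ = ‖∑ j', star (B i j') • coordProj H j' - ∑ j' ∈ Sᶜ, star (B i j') • coordProj H j'‖ := by
        rw [h2, add_sub_cancel_right]
    _ ≤ _ := (norm_sub_le _ _).trans (add_le_add h1 h3)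

/-- If a fixed proportion of every column set between sizes `k / 2` and `|S₀|` can be peeled, then
an approximate kernel of dimension `k` cannot be concentrated on `S₀`. -/
theorem finrank_half_lt_of_peelable {B : Matrix ι κ ℂ} {H : Submodule ℂ (EuclideanSpace ℂ κ)}
    {c Q τ W θ q : ℝ} {S₀ : Finset κ} (hτ0 : 0 ≤ τ) (hτW : τ ≤ W)
    (hτ : ∀ u ∈ H, ‖Matrix.toEuclideanLin B u‖ ≤ τ * ‖u‖)
    (hW : ∀ j' ∉ S₀, ‖coordProj H j'‖ ≤ W) (hc : 0 < c) (hq1 : 1 ≤ q) (hq : 1 + Q ≤ q * c)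
    (hθ : θ ≤ 1)
    (hpeel : ∀ S ⊆ S₀, (finrank ℂ H : ℝ) / 2 ≤ S.card → ∀ S₁ ⊆ S,
      (1 - θ) * S.card ≤ S₁.card → ∃ j ∈ S₁, Peelable B c Q S j)
    {D : ℕ} (hD : (1 - θ) ^ D * S₀.card < (finrank ℂ H : ℝ) / 2) :
    (finrank ℂ H : ℝ) / 2 < Fintype.card κ * (W * q ^ D) ^ 2 := by
  classical
  have hW0 : 0 ≤ W := hτ0.trans hτW
  have rounds : ∀ D : ℕ, ∃ S ⊆ S₀, (∀ j ∉ S, ‖coordProj H j‖ ≤ W * q ^ D) ∧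
      ((S.card : ℝ) < (finrank ℂ H : ℝ) / 2 ∨ (S.card : ℝ) ≤ (1 - θ) ^ D * S₀.card) := by
    intro D
    induction D with
    | zero => exact ⟨S₀, subset_rfl, by simpa using hW, Or.inr (by simp)⟩
    | succ D ih =>
      obtain ⟨S, hS, hπ, hcard⟩ := ih
      have hstep : W * q ^ D ≤ W * q ^ (D + 1) := by
        gcongr
        omega
      by_cases hlt : (S.card : ℝ) < (finrank ℂ H : ℝ) / 2
      · exact ⟨S, hS, fun j hj => (hπ j hj).trans hstep, Or.inl hlt⟩
      have hle := hcard.resolve_left hlt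
      refine ⟨S.filter fun j => ¬ Peelable B c Q S j, (Finset.filter_subset _ _).trans hS, ?_,
        Or.inr ?_⟩
      · intro j hj
        by_cases hjS : j ∈ S
        · have hp : Peelable B c Q S j := by
            by_contra hp
            exact hj (Finset.mem_filter.2 ⟨hjS, hp⟩)
          have h1 := hp.mul_norm_coordProj_le hjS hτ0 hτ (by positivity) hπ
          have h2 : τ ≤ W * q ^ D := hτW.trans (le_mul_of_one_le_right hW0 (one_le_pow₀ hq1))
          have h3 : c * ‖coordProj H j‖ ≤ c * (W * q ^ (D + 1)) := by
            calc c * ‖coordProj H j‖ ≤ τ + Q * (W * q ^ D) := h1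
              _ ≤ (1 + Q) * (W * q ^ D) := by linarith
              _ ≤ (q * c) * (W * q ^ D) := by gcongr
              _ = _ := by ring
          exact le_of_mul_le_mul_left h3 hc
        · exact (hπ j hjS).trans hstep
      · by_contra! hgt
        have h1 : (1 - θ) * S.card ≤ (S.filter fun j => ¬ Peelable B c Q S j).card := by
          refine le_trans ?_ hgt.le
          rw [pow_succ', mul_assoc]
          exact mul_le_mul_of_nonneg_left hle (by linarith)
        obtain ⟨j, hj, hp⟩ := hpeel S hS (not_lt.1 hlt) _ (Finset.filter_subset _ _) h1
        exact (Finset.mem_filter.1 hj).2 hp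
  obtain ⟨S, -, hπ, hcard⟩ := rounds D
  have hlt : (S.card : ℝ) < (finrank ℂ H : ℝ) / 2 := hcard.elim id fun h => h.trans_lt hD
  have h1 := sum_norm_sq_coordProj H
  rw [← Finset.sum_add_sum_compl S] at h1
  have h2 : ∑ j ∈ S, ‖coordProj H j‖ ^ 2 ≤ S.card := by
    calc _ ≤ ∑ j ∈ S, (1 : ℝ) := Finset.sum_le_sum fun j _ =>
          pow_le_one₀ (norm_nonneg _) (norm_coordProj_le_one H j)
      _ = _ := by simp
  have h3 : ∑ j ∈ Sᶜ, ‖coordProj H j‖ ^ 2 ≤ Fintype.card κ * (W * q ^ D) ^ 2 := by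
    calc _ ≤ ∑ j ∈ Sᶜ, (W * q ^ D) ^ 2 := Finset.sum_le_sum fun j hj =>
          pow_le_pow_left₀ (norm_nonneg _) (hπ j (Finset.mem_compl.1 hj)) 2
      _ = (Sᶜ.card : ℝ) * (W * q ^ D) ^ 2 := by simp
      _ ≤ _ := by
        gcongr
        exact Finset.card_le_univ _
  linarith

end Peeling

/-! ### A Littlewood–Offord inequality in a normed space -/

section Concentration

variable {H : Type*} [NormedAddCommGroup H] [NormedSpace ℝ H]

/-- A single functional that is bounded below on finitely many vectors. It is built by adding one vector
at a time: if the functional so far is small on the new vector, it is corrected by a small multiple of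
a norming functional. This reduces vector sums to real sums at a cost exponential in the number of
vectors, which the scale can afford. -/
theorem exists_dual_forall_le (s : Finset H) :
    ∃ f : StrongDual ℝ H, ‖f‖ ≤ 1 ∧ ∀ x ∈ s, (1 / 8 : ℝ) ^ s.card * ‖x‖ ≤ |f x| := by
  classical
  induction s using Finset.induction with
  | empty => exact ⟨0, by simp, by simp⟩
  | insert x s hx ih =>
    obtain ⟨f, hf1, hf⟩ := ih
    rw [Finset.card_insert_of_notMem hx]
    set c : ℝ := (1 / 8 : ℝ) ^ s.card with hc
    have hc0 : 0 < c := by positivity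
    have hc1 : c ≤ 1 := pow_le_one₀ (by norm_num) (by norm_num)
    have hpow : (1 / 8 : ℝ) ^ (s.card + 1) = c / 8 := by rw [pow_succ, ← hc]; ring
    rw [hpow]
    by_cases hfx : c / 4 * ‖x‖ ≤ |f x|
    · refine ⟨f, hf1, fun y hy => ?_⟩
      rcases Finset.mem_insert.1 hy with rfl | hy
      · exact le_trans (by gcongr; linarith) hfx
      · exact le_trans (by gcongr; linarith) (hf y hy)
    · push Not at hfx
      obtain ⟨g, hg1, hgx⟩ := exists_dual_vector'' ℝ x
      have hgx' : g x = ‖x‖ := hgx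
      refine ⟨(1 / 2 : ℝ) • (f + (c / 2) • g), ?_, fun y hy => ?_⟩
      · rw [norm_smul]
        have h1 : ‖f + (c / 2) • g‖ ≤ 1 + c / 2 * 1 := by
          refine (norm_add_le _ _).trans (add_le_add hf1 ?_)
          rw [norm_smul, Real.norm_of_nonneg (by positivity)]
          gcongr
        rw [Real.norm_of_nonneg (by norm_num)]
        linarith
      · have happ : ((1 / 2 : ℝ) • (f + (c / 2) • g)) y = 1 / 2 * (f y + c / 2 * g y) := by
          simp only [smul_add, add_apply, smul_apply, smul_eq_mul]
          ring
        rw [happ, abs_mul, abs_of_pos (by norm_num : (0 : ℝ) < 1 / 2)]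
        have hgy : |g y| ≤ ‖y‖ := (g.le_opNorm y).trans (by
          nlinarith [norm_nonneg y])
        rcases Finset.mem_insert.1 hy with rfl | hy
        · have h2 := abs_lt.1 hfx
          have h3 : c / 4 * ‖y‖ ≤ f y + c / 2 * g y := by rw [hgx']; linarith
          have h4 := h3.trans (le_abs_self _)
          linarith
        · have h2 := hf y hy
          have h3 : |f y| - c / 2 * |g y| ≤ |f y + c / 2 * g y| := by
            have := abs_sub_abs_le_abs_sub (f y) (-(c / 2 * g y))
            rw [abs_neg, abs_mul, abs_of_pos (by positivity : 0 < c / 2), sub_neg_eq_add] at this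
            exact this
          have h4 : c / 2 * |g y| ≤ c / 2 * ‖y‖ := by gcongr
          nlinarith [norm_nonneg y]

/-- Erdős' form of the Littlewood–Offord inequality for long real numbers: subset sums within
distance `ρ` of a point become, after flipping signs, an antichain. -/
theorem card_filter_subsetSum_le {α : Type*} [Fintype α] [DecidableEq α] (a : α → ℝ) {ρ w : ℝ}
    (v : ℝ) (hw : 2 * ρ < w) (ha : ∀ j, w ≤ |a j|) :
    (Finset.univ.filter fun T : Finset α => |∑ j ∈ T, a j - v| ≤ ρ).card ≤
      (Fintype.card α).choose (Fintype.card α / 2) := by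
  let Neg : Finset α := Finset.univ.filter fun j => a j < 0
  let 𝒜 : Finset (Finset α) := (Finset.univ.filter fun T : Finset α => |∑ j ∈ T, a j - v| ≤ ρ).image
    fun T => symmDiff T Neg
  have hinj : Function.Injective fun T : Finset α => symmDiff T Neg := symmDiff_left_injective Neg
  have hsum : ∀ T : Finset α,
      ∑ j ∈ symmDiff T Neg, |a j| = ∑ j ∈ T, a j + ∑ j ∈ Neg, |a j| := by
    intro T
    have h1 : ∑ j ∈ symmDiff T Neg, |a j| = ∑ j ∈ T \ Neg, |a j| + ∑ j ∈ Neg \ T, |a j| := by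
      rw [symmDiff_def, Finset.sup_eq_union, Finset.sum_union]
      exact disjoint_sdiff_sdiff
    have h2 : ∑ j ∈ T, a j = ∑ j ∈ T \ Neg, |a j| - ∑ j ∈ T ∩ Neg, |a j| := by
      rw [← Finset.sum_sdiff (Finset.inter_subset_left (s₁ := T) (s₂ := Neg)),
        Finset.sdiff_inter_self_left, sub_eq_add_neg, ← Finset.sum_neg_distrib]
      congr 1
      · refine Finset.sum_congr rfl fun j hj => ?_
        simp only [Neg, Finset.mem_sdiff, Finset.mem_filter, Finset.mem_univ, true_and,
          not_lt] at hj
        rw [abs_of_nonneg hj.2]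
      · refine Finset.sum_congr rfl fun j hj => ?_
        simp only [Neg, Finset.mem_inter, Finset.mem_filter, Finset.mem_univ, true_and] at hj
        rw [abs_of_neg hj.2, neg_neg]
    have h3 : ∑ j ∈ Neg, |a j| = ∑ j ∈ Neg \ T, |a j| + ∑ j ∈ T ∩ Neg, |a j| := by
      rw [← Finset.sum_sdiff (Finset.inter_subset_left (s₁ := Neg) (s₂ := T)),
        Finset.sdiff_inter_self_left, Finset.inter_comm]
    rw [h1, h2, h3]; ring
  have hanti : IsAntichain (· ⊆ ·) (𝒜 : Set (Finset α)) := by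
    intro U hU V hV hne hsub
    simp only [𝒜, Finset.coe_image, Set.mem_image, Finset.mem_coe, Finset.mem_filter,
      Finset.mem_univ, true_and] at hU hV
    obtain ⟨T, hT, rfl⟩ := hU
    obtain ⟨T', hT', rfl⟩ := hV
    obtain ⟨j, hj, hjn⟩ := Finset.exists_of_ssubset (hsub.ssubset_of_ne hne)
    have h1 : ∑ j ∈ symmDiff T Neg, |a j| + |a j| ≤ ∑ j ∈ symmDiff T' Neg, |a j| := by
      rw [add_comm, ← Finset.sum_insert (f := fun j => |a j|) hjn]
      exact Finset.sum_le_sum_of_subset_of_nonneg (Finset.insert_subset hj hsub)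
        fun _ _ _ => abs_nonneg _
    rw [hsum, hsum] at h1
    have h2 := abs_le.1 hT
    have h3 := abs_le.1 hT'
    have h4 := ha j
    linarith
  calc _ = 𝒜.card := (Finset.card_image_of_injective _ hinj).symm
    _ ≤ _ := hanti.sperner

/-- Subset sums of a vector family, a subfamily of which is long, rarely lie in a small ball. -/
theorem card_filter_norm_subsetSum_le {ι : Type*} [Fintype ι] [DecidableEq ι] (x : ι → H) (v : H)
    {ρ w : ℝ} (J : Finset ι) (hρ : 2 * ρ < (1 / 8 : ℝ) ^ J.card * w) (hx : ∀ j ∈ J, w ≤ ‖x j‖) :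
    (Finset.univ.filter fun T : Finset ι => ‖∑ j ∈ T, x j - v‖ ≤ ρ).card * 2 ^ J.card ≤
      J.card.choose (J.card / 2) * 2 ^ Fintype.card ι := by
  classical
  obtain ⟨f, hf1, hf⟩ := exists_dual_forall_le (J.image x)
  -- the selections outside `J` are fixed; on each fibre the real inequality applies to `f ∘ x`
  set 𝒢 := Finset.univ.filter fun T : Finset ι => ‖∑ j ∈ T, x j - v‖ ≤ ρ with h𝒢
  have hfx : ∀ j ∈ J, (1 / 8 : ℝ) ^ J.card * w ≤ |f (x j)| := by
    intro j hj
    refine le_trans ?_ (hf (x j) (Finset.mem_image_of_mem _ hj))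
    calc (1 / 8 : ℝ) ^ J.card * w ≤ (1 / 8 : ℝ) ^ J.card * ‖x j‖ := by gcongr; exact hx j hj
      _ ≤ (1 / 8 : ℝ) ^ (J.image x).card * ‖x j‖ := by
        gcongr ?_ * _
        exact pow_le_pow_of_le_one (by norm_num) (by norm_num) Finset.card_image_le
  have himage : (𝒢.image fun T => T \ J) ⊆ (Finset.univ \ J).powerset := by
    intro U hU
    obtain ⟨T, -, rfl⟩ := Finset.mem_image.1 hU
    exact Finset.mem_powerset.2 (Finset.sdiff_subset_sdiff (Finset.subset_univ _) subset_rfl)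
  have hfiber : ∀ U ∈ 𝒢.image fun T => T \ J,
      (𝒢.filter fun T => T \ J = U).card ≤ J.card.choose (J.card / 2) := by
    intro U _
    have h1 := card_filter_subsetSum_le (fun j : J => f (x j)) (f v - ∑ j ∈ U, f (x j)) hρ
      fun j => hfx j j.2
    rw [Fintype.card_coe] at h1
    refine le_trans (Finset.card_le_card_of_injOn (fun T => T.subtype (· ∈ J)) ?_ ?_) h1
    · intro T hT
      simp only [Finset.coe_filter, Set.mem_ofPred_eq, h𝒢, Finset.mem_filter, Finset.mem_univ,
        true_and] at hT ⊢
      obtain ⟨hT, rfl⟩ := hT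
      have h2 : ∑ j ∈ T.subtype (· ∈ J), f (x j) = ∑ j ∈ T ∩ J, f (x j) := by
        rw [← Finset.filter_mem_eq_inter, ← Finset.sum_subtype_eq_sum_filter]
      rw [h2]
      have h3 : ∑ j ∈ T ∩ J, f (x j) - (f v - ∑ j ∈ T \ J, f (x j)) =
          f (∑ j ∈ T, x j - v) := by
        rw [map_sub, map_sum, ← Finset.sum_sdiff (Finset.inter_subset_left (s₁ := T) (s₂ := J)),
          Finset.sdiff_inter_self_left]
        ring
      rw [h3]
      have h4 := f.le_opNorm (∑ j ∈ T, x j - v)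
      rw [Real.norm_eq_abs] at h4
      nlinarith [norm_nonneg (∑ j ∈ T, x j - v)]
    · intro T hT T' hT' heq
      simp only [Finset.coe_filter, Set.mem_ofPred_eq] at hT hT'
      ext j
      by_cases hj : j ∈ J
      · have := Finset.ext_iff.1 heq ⟨j, hj⟩
        simpa using this
      · have := Finset.ext_iff.1 (hT.2.trans hT'.2.symm) j
        simpa [hj] using this
  have h5 : 𝒢.card ≤ J.card.choose (J.card / 2) * 2 ^ (Fintype.card ι - J.card) := by
    refine (Finset.card_le_mul_card_image 𝒢 _ hfiber).trans ?_
    gcongr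
    refine (Finset.card_le_card himage).trans ?_
    rw [Finset.card_powerset, Finset.card_sdiff_of_subset (Finset.subset_univ _),
      Finset.card_univ]
  calc 𝒢.card * 2 ^ J.card
      ≤ J.card.choose (J.card / 2) * 2 ^ (Fintype.card ι - J.card) * 2 ^ J.card := by gcongr
    _ = _ := by rw [mul_assoc, ← pow_add, Nat.sub_add_cancel (Finset.card_le_univ J)]

/-- The number of coordinates in `G` on which a product event occurs is rarely small. -/
theorem measureReal_card_filter_lt_le {ι X : Type*} [Fintype ι] [DecidableEq ι] [MeasurableSpace X]
    (P : Measure X) [IsProbabilityMeasure P] {s : Set X} (hs : MeasurableSet s) {β : ℝ}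
    (hβ : β ≤ P.real s) (G : Finset ι) [DecidablePred (· ∈ s)] (N : ℕ) :
    (Measure.pi fun _ : ι => P).real {z | (G.filter fun j => z j ∈ s).card < N} ≤
      Real.exp (N - (1 - Real.exp (-1)) * β * G.card) := by
  set e : ℝ := 1 - Real.exp (-1) with he
  have he0 : 0 < e := by rw [he]; simp
  -- Chernoff's bound: the exponential moment of minus the number of hits is a product
  let f : ι → X → ℝ := fun j x => if j ∈ G ∧ x ∈ s then Real.exp (-1) else 1
  have hfm : ∀ j, Measurable (f j) := by
    intro j
    by_cases hj : j ∈ G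
    · simp only [f, hj, true_and]
      exact Measurable.ite hs measurable_const measurable_const
    · simp only [f, hj, false_and, if_false]; exact measurable_const
  have hfle : ∀ j x, f j x ≤ 1 := by
    intro j x
    simp only [f]; split_ifs
    · simp
    · exact le_rfl
  have hf0 : ∀ j x, 0 ≤ f j x := by
    intro j x
    simp only [f]; split_ifs <;> positivity
  have hfint : ∀ j, ∫ x, f j x ∂P ≤ if j ∈ G then Real.exp (-(e * β)) else 1 := by
    intro j
    by_cases hj : j ∈ G
    · have h1 : ∀ x, f j x = 1 - e * s.indicator (fun _ => (1 : ℝ)) x := by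
        intro x
        by_cases hx : x ∈ s <;> simp [f, hj, hx, he]
      simp only [h1, hj, if_true]
      rw [integral_sub (integrable_const _) (((integrable_const _).indicator hs).const_mul _),
        integral_const_mul, integral_indicator_const _ hs]
      simp only [integral_const, probReal_univ, smul_eq_mul, mul_one]
      have h2 : 1 - e * P.real s ≤ 1 - e * β := by gcongr
      have h3 := Real.add_one_le_exp (-(e * β))
      linarith
    · simp [f, hj]
  have hprod : ∀ z : ι → X, ∏ j, f j (z j) =
      Real.exp (-((G.filter fun j => z j ∈ s).card : ℝ)) := by
    intro z
    have : ∏ j, f j (z j) = ∏ j ∈ G.filter fun j => z j ∈ s, Real.exp (-1) := by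
      rw [Finset.prod_filter, ← Finset.prod_filter_mul_prod_filter_not Finset.univ (· ∈ G)]
      rw [Finset.prod_eq_one (s := Finset.univ.filter fun j => j ∉ G), mul_one]
      · rw [Finset.filter_mem_eq_inter, Finset.univ_inter]
        exact Finset.prod_congr rfl fun j hj => by simp [f, hj]
      · intro j hj
        simp [f, (Finset.mem_filter.1 hj).2]
    rw [this, Finset.prod_const, ← Real.exp_nat_mul]
    ring_nf
  have hint : ∫ z, ∏ j, f j (z j) ∂(Measure.pi fun _ : ι => P) ≤
      Real.exp (-(e * β * G.card)) := by
    rw [integral_fintype_prod_eq_prod]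
    calc ∏ j, ∫ x, f j x ∂P ≤ ∏ j, if j ∈ G then Real.exp (-(e * β)) else 1 :=
          Finset.prod_le_prod (fun j _ => integral_nonneg (hf0 j)) fun j _ => hfint j
      _ = _ := by
        rw [Finset.prod_ite_mem, Finset.univ_inter, Finset.prod_const, ← Real.exp_nat_mul]
        ring_nf
  have hmeas : Measurable fun z : ι → X => ∏ j, f j (z j) :=
    Finset.measurable_prod _ fun j _ => (hfm j).comp (measurable_pi_apply j)
  have hnn : ∀ z : ι → X, 0 ≤ ∏ j, f j (z j) := fun z => Finset.prod_nonneg fun j _ => hf0 j _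
  have hintb : Integrable (fun z : ι → X => ∏ j, f j (z j)) (Measure.pi fun _ : ι => P) := by
    refine Integrable.of_bound hmeas.aestronglyMeasurable 1 (Eventually.of_forall fun z => ?_)
    rw [Real.norm_of_nonneg (hnn z)]
    exact Finset.prod_le_one (fun j _ => hf0 j _) fun j _ => hfle j _
  have hmarkov := mul_meas_ge_le_integral_of_nonneg (Eventually.of_forall hnn) hintb
    (Real.exp (-(N : ℝ)))
  have hsub : {z : ι → X | (G.filter fun j => z j ∈ s).card < N} ⊆
      {z | Real.exp (-(N : ℝ)) ≤ ∏ j, f j (z j)} := by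
    intro z hz
    simp only [Set.mem_ofPred_eq] at hz ⊢
    rw [hprod]
    gcongr
  have h6 : (Measure.pi fun _ : ι => P).real {z | (G.filter fun j => z j ∈ s).card < N} ≤
      (Measure.pi fun _ : ι => P).real {z | Real.exp (-(N : ℝ)) ≤ ∏ j, f j (z j)} :=
    measureReal_mono hsub
  calc _ ≤ _ := h6
    _ = Real.exp N * (Real.exp (-(N : ℝ)) * (Measure.pi fun _ : ι => P).real
        {z | Real.exp (-(N : ℝ)) ≤ ∏ j, f j (z j)}) := by
        rw [← mul_assoc, ← Real.exp_add]; simp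
    _ ≤ Real.exp N * Real.exp (-(e * β * G.card)) := by
        gcongr
        exact hmarkov.trans hint
    _ = _ := by rw [← Real.exp_add]; ring_nf

/-- Randomizing the choice between two independent copies of each coordinate: a bound for the number
of selections that fall in `E` bounds the probability of `E`. -/
theorem measureReal_le_integral_of_card_selection_le {ι X : Type*} [Fintype ι] [DecidableEq ι]
    [MeasurableSpace X] (μ : Measure X) [IsProbabilityMeasure μ] {E : Set (ι → X)}
    [DecidablePred (· ∈ E)] (hE : MeasurableSet E) {F : (ι → X × X) → ℝ}
    (hF : Integrable F (Measure.pi fun _ : ι => μ.prod μ))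
    (h : ∀ z : ι → X × X, ((Finset.univ.filter fun T : Finset ι =>
      (fun i => if i ∈ T then (z i).2 else (z i).1) ∈ E).card : ℝ) ≤ 2 ^ Fintype.card ι * F z) :
    (Measure.pi fun _ : ι => μ).real E ≤ ∫ z, F z ∂(Measure.pi fun _ : ι => μ.prod μ) := by
  let P : Measure (ι → X × X) := Measure.pi fun _ => μ.prod μ
  let sel : Finset ι → (ι → X × X) → ι → X := fun T z i => if i ∈ T then (z i).2 else (z i).1
  have hsel : ∀ T, MeasurePreserving (sel T) P (Measure.pi fun _ : ι => μ) := by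
    intro T
    have := measurePreserving_pi (fun _ : ι => μ.prod μ) (fun _ : ι => μ)
      (f := fun i => if i ∈ T then Prod.snd else Prod.fst) (fun i => by
        by_cases hi : i ∈ T
        · simpa [hi] using (measurePreserving_snd (μ := μ) (ν := μ))
        · simpa [hi] using (measurePreserving_fst (μ := μ) (ν := μ)))
    convert! this using 1
    ext z i
    by_cases hi : i ∈ T <;> simp [sel, hi]
  have hsm : ∀ T, MeasurableSet (sel T ⁻¹' E) := fun T => (hsel T).measurable hE
  have hT : ∀ T, (Measure.pi fun _ : ι => μ).real E =
      ∫ z, (sel T ⁻¹' E).indicator (1 : (ι → X × X) → ℝ) z ∂P := by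
    intro T
    rw [integral_indicator_one (hsm T), measureReal_def, measureReal_def,
      (hsel T).measure_preimage hE.nullMeasurableSet]
  have hind : ∀ {S : Set (ι → X × X)}, MeasurableSet S →
      Integrable (S.indicator (1 : (ι → X × X) → ℝ)) P := fun hS =>
    (integrable_const (1 : ℝ)).indicator hS
  have hsum : ∑ _T : Finset ι, (Measure.pi fun _ : ι => μ).real E ≤
      2 ^ Fintype.card ι * ∫ z, F z ∂P := by
    calc ∑ _T : Finset ι, (Measure.pi fun _ : ι => μ).real E
        = ∑ T : Finset ι, ∫ z, (sel T ⁻¹' E).indicator (1 : (ι → X × X) → ℝ) z ∂P :=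
          Finset.sum_congr rfl fun T _ => hT T
      _ = ∫ z, ∑ T : Finset ι, (sel T ⁻¹' E).indicator (1 : (ι → X × X) → ℝ) z ∂P :=
          (integral_finsetSum _ fun T _ => hind (hsm T)).symm
      _ ≤ ∫ z, 2 ^ Fintype.card ι * F z ∂P := by
          refine integral_mono (integrable_finsetSum _ fun T _ => hind (hsm T))
            (hF.const_mul _) fun z => le_trans (le_of_eq ?_) (h z)
          rw [Finset.card_filter]
          push_cast
          exact Finset.sum_congr rfl fun T _ => by
            by_cases h : sel T z ∈ E <;> simp [sel, Set.indicator] at h ⊢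
      _ = _ := integral_const_mul _ _
  rw [Finset.sum_const, Finset.card_univ, Fintype.card_finset, nsmul_eq_mul] at hsum
  push_cast at hsum
  exact le_of_mul_le_mul_left hsum (by positivity)

theorem measurableSet_card_filter_lt {ι X : Type*} [Fintype ι] [MeasurableSpace X] {s : Set X}
    [DecidablePred (· ∈ s)] (hs : MeasurableSet s) (G : Finset ι) (N : ℕ) :
    MeasurableSet {z : ι → X | (G.filter fun j => z j ∈ s).card < N} := by
  have hm : Measurable fun z : ι → X => (G.filter fun j => z j ∈ s).card := by
    simp only [Finset.card_filter]
    refine Finset.measurable_sum _ fun j _ => ?_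
    exact Measurable.ite ((measurable_pi_apply j) hs) measurable_const measurable_const
  exact hm (measurableSet_Iio (a := N))

/-- A Littlewood–Offord inequality in a normed space for sums of independent terms `g j (y j)`, where
the `y j` are i.i.d. with law `μ` and the terms with `j ∈ G` expand distances by at least `W`. -/
theorem measureReal_ball_sum_le {ι : Type*} [Fintype ι] [DecidableEq ι] (μ : Measure ℂ)
    [IsProbabilityMeasure μ] (g : ι → ℂ → H) (G : Finset ι) {W c β ρ : ℝ} (hW : 0 ≤ W)
    (hg : ∀ j ∈ G, ∀ y y', W * ‖y - y'‖ ≤ ‖g j y - g j y'‖)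
    (hβ : β ≤ (μ.prod μ).real {z | c ≤ ‖z.1 - z.2‖}) (N : ℕ)
    (hρ : 2 * ρ < (1 / 8 : ℝ) ^ N * (W * c)) (v : H) {E : Set (ι → ℂ)} (hE : MeasurableSet E)
    (hEv : ∀ y ∈ E, ‖∑ j, g j (y j) - v‖ ≤ ρ) :
    (Measure.pi fun _ : ι => μ).real E ≤
      Real.exp (N - (1 - Real.exp (-1)) * β * G.card) + N.choose (N / 2) / 2 ^ N := by
  classical
  let P : Measure (ι → ℂ × ℂ) := Measure.pi fun _ => μ.prod μ
  let s : Set (ℂ × ℂ) := {z | c ≤ ‖z.1 - z.2‖}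
  have hs : MeasurableSet s := measurableSet_le measurable_const (by fun_prop)
  let A : Set (ι → ℂ × ℂ) := {z | (G.filter fun j => z j ∈ s).card < N}
  have hA : MeasurableSet A := measurableSet_card_filter_lt hs G N
  have hind : Integrable (A.indicator (1 : (ι → ℂ × ℂ) → ℝ)) P :=
    (integrable_const (1 : ℝ)).indicator hA
  refine (measureReal_le_integral_of_card_selection_le μ hE
    (F := fun z => A.indicator 1 z + N.choose (N / 2) / 2 ^ N)
    (hind.add (integrable_const _)) ?_).trans ?_
  · intro z
    by_cases hz : z ∈ A
    · have h1 : ((Finset.univ.filter fun T : Finset ι =>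
          (fun i => if i ∈ T then (z i).2 else (z i).1) ∈ E).card : ℝ) ≤
          2 ^ Fintype.card ι := by
        have := Finset.card_le_univ (Finset.univ.filter fun T : Finset ι =>
          (fun i => if i ∈ T then (z i).2 else (z i).1) ∈ E)
        rw [Fintype.card_finset] at this
        exact_mod_cast this
      refine h1.trans ?_
      rw [Set.indicator_of_mem hz]
      have : (0 : ℝ) ≤ N.choose (N / 2) / 2 ^ N := by positivity
      simp only [Pi.one_apply]
      nlinarith [show (0 : ℝ) < 2 ^ Fintype.card ι by positivity]
    · rw [Set.indicator_of_notMem hz, zero_add]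
      have hz' : N ≤ (G.filter fun j => z j ∈ s).card := by
        simpa [A] using hz
      -- `N` of the pairs of copies lie at distance at least `c`; the choices there are random signs
      obtain ⟨J, hJ, hJN⟩ := Finset.exists_subset_card_eq hz'
      have h1 := card_filter_norm_subsetSum_le (fun j => g j (z j).2 - g j (z j).1)
        (v - ∑ j, g j (z j).1) (ρ := ρ) (w := W * c) J (by rw [hJN]; exact hρ) (by
          intro j hj
          have hj' := Finset.mem_filter.1 (hJ hj)
          have h2 : c ≤ ‖(z j).1 - (z j).2‖ := hj'.2
          have h3 := hg j hj'.1 (z j).2 (z j).1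
          rw [norm_sub_rev (z j).2] at h3
          exact (mul_le_mul_of_nonneg_left h2 hW).trans h3)
      rw [hJN] at h1
      have h4 : (Finset.univ.filter fun T : Finset ι =>
          (fun i => if i ∈ T then (z i).2 else (z i).1) ∈ E).card ≤
          (Finset.univ.filter fun T : Finset ι =>
            ‖∑ j ∈ T, (g j (z j).2 - g j (z j).1) - (v - ∑ j, g j (z j).1)‖ ≤ ρ).card := by
        refine Finset.card_le_card fun T hT => ?_
        simp only [Finset.mem_filter, Finset.mem_univ, true_and] at hT ⊢
        have h5 : ∑ j ∈ T, (g j (z j).2 - g j (z j).1) - (v - ∑ j, g j (z j).1) =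
            ∑ j, g j (if j ∈ T then (z j).2 else (z j).1) - v := by
          have h6 : ∀ j, g j (if j ∈ T then (z j).2 else (z j).1) =
              (if j ∈ T then g j (z j).2 - g j (z j).1 else 0) + g j (z j).1 := by
            intro j
            by_cases hj : j ∈ T <;> simp [hj]
          simp_rw [h6]
          rw [Finset.sum_add_distrib, Finset.sum_ite_mem, Finset.univ_inter]
          abel
        rw [h5]
        exact hEv _ hT
      have h7 := (Nat.mul_le_mul_right (2 ^ N) h4).trans h1
      have h8 : ((Finset.univ.filter fun T : Finset ι =>
          (fun i => if i ∈ T then (z i).2 else (z i).1) ∈ E).card : ℝ) * 2 ^ N ≤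
          N.choose (N / 2) * 2 ^ Fintype.card ι := by exact_mod_cast h7
      rw [mul_div_assoc', le_div_iff₀ (by positivity)]
      linarith
  · rw [integral_add hind (integrable_const _), integral_indicator_one hA]
    have h10 := measureReal_card_filter_lt_le (μ.prod μ) hs hβ G N
    simp only [integral_const, probReal_univ, smul_eq_mul, one_mul]
    gcongr

theorem tendsto_centralBinom_div_four_pow :
    Tendsto (fun N : ℕ => (N.centralBinom : ℝ) / 4 ^ N) atTop (𝓝 0) := by
  have hpos : ∀ N : ℕ, 0 < (N.centralBinom : ℝ) / 4 ^ N := fun N => by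
    have := N.centralBinom_pos
    positivity
  -- the product of `1 - 1 / (2 (i + 1))` decays like `1 / √N`
  have hle : ∀ N : ℕ, ((N.centralBinom : ℝ) / 4 ^ N) ^ 2 * (2 * N + 1) ≤ 1 := by
    intro N
    induction N with
    | zero => simp
    | succ N ih =>
      have h1 : ((N + 1 : ℕ) : ℝ) * ((N + 1).centralBinom : ℝ) =
          2 * (2 * N + 1) * (N.centralBinom : ℝ) := by
        exact_mod_cast Nat.succ_mul_centralBinom_succ N
      push_cast at h1 ⊢
      have hN : (0 : ℝ) < N + 1 := by positivity
      have h2 : ((N + 1).centralBinom : ℝ) / 4 ^ (N + 1) =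
          (N.centralBinom : ℝ) / 4 ^ N * ((2 * N + 1) / (2 * (N + 1))) := by
        rw [pow_succ]
        field_simp
        linarith
      rw [h2, mul_pow]
      set x := ((N.centralBinom : ℝ) / 4 ^ N) ^ 2 with hx
      have hx0 : 0 ≤ x := by positivity
      have h3 : ((2 * (N : ℝ) + 1) / (2 * (N + 1))) ^ 2 * (2 * (N + 1) + 1) ≤ 2 * N + 1 := by
        rw [div_pow, div_mul_eq_mul_div, div_le_iff₀ (by positivity)]
        nlinarith [show (0 : ℝ) ≤ N from N.cast_nonneg]
      calc x * ((2 * (N : ℝ) + 1) / (2 * (N + 1))) ^ 2 * (2 * (N + 1) + 1)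
          = x * (((2 * (N : ℝ) + 1) / (2 * (N + 1))) ^ 2 * (2 * (N + 1) + 1)) := by ring
        _ ≤ x * (2 * N + 1) := by gcongr
        _ ≤ 1 := ih
  have hsq : Tendsto (fun N : ℕ => ((N.centralBinom : ℝ) / 4 ^ N) ^ 2) atTop (𝓝 0) := by
    refine squeeze_zero (fun N => sq_nonneg _) (fun N => ?_) tendsto_one_div_add_atTop_nhds_zero_nat
    rw [le_div_iff₀ (by positivity)]
    refine le_trans ?_ (hle N)
    gcongr
    linarith [show (0 : ℝ) ≤ N from N.cast_nonneg]
  have := hsq.sqrt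
  rw [Real.sqrt_zero] at this
  exact this.congr fun N => Real.sqrt_sq (hpos N).le

end Concentration

/-! ### The law of a sparse entry and of a sparse row -/

section EntryLaw

open scoped ENNReal

theorem sparseEntryLaw_eq (ν : Measure ℂ) [IsProbabilityMeasure ν] (p : unitInterval) :
    sparseEntryLaw ν p = ENNReal.ofReal p • ν + ENNReal.ofReal (1 - p) • Measure.dirac 0 := by
  ext s hs
  have hm : Measurable fun q : ℂ × ℂ => q.1 * q.2 := by fun_prop
  rw [sparseEntryLaw, Measure.map_apply hm hs, Measure.prod_apply (hm hs),
    ProbabilityTheory.bernoulliMeasure_def]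
  rw [lintegral_add_measure, lintegral_smul_measure, lintegral_smul_measure, lintegral_dirac,
    lintegral_dirac]
  have h1 : Prod.mk (1 : ℂ) ⁻¹' ((fun q : ℂ × ℂ => q.1 * q.2) ⁻¹' s) = s := by
    ext x; simp
  have h2 : ν (Prod.mk (0 : ℂ) ⁻¹' ((fun q : ℂ × ℂ => q.1 * q.2) ⁻¹' s)) =
      Measure.dirac (0 : ℂ) s := by
    by_cases h0 : (0 : ℂ) ∈ s
    · rw [Measure.dirac_apply_of_mem h0]
      convert! measure_univ (μ := ν)
      ext x; simp [h0]
    · rw [Measure.dirac_apply' _ hs, Set.indicator_of_notMem h0]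
      convert! measure_empty (μ := ν)
      ext x; simp [h0]
  rw [h1, h2, Measure.add_apply, Measure.smul_apply, Measure.smul_apply]
  congr 2
  · ext
    simp [p.2.1]
  · ext
    simp [p.2.2]

instance (ν : Measure ℂ) [IsProbabilityMeasure ν] (p : unitInterval) :
    IsProbabilityMeasure (sparseEntryLaw ν p) :=
  Measure.isProbabilityMeasure_map (by fun_prop)

theorem sparseEntryLaw_real (ν : Measure ℂ) [IsProbabilityMeasure ν] (p : unitInterval) {s : Set ℂ}
    (hs : MeasurableSet s) : (sparseEntryLaw ν p).real s =
      p * ν.real s + (1 - p) * (s.indicator 1 0) := by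
  have hp := p.2.1
  have hp' : (0 : ℝ) ≤ 1 - p := by linarith [p.2.2]
  rw [measureReal_def, sparseEntryLaw_eq, Measure.add_apply, Measure.smul_apply,
    Measure.smul_apply, smul_eq_mul, smul_eq_mul, Measure.dirac_apply' _ hs, ENNReal.toReal_add,
    ENNReal.toReal_mul, ENNReal.toReal_mul, ENNReal.toReal_ofReal hp, ENNReal.toReal_ofReal hp',
    measureReal_def]
  · congr 2
    by_cases h : (0 : ℂ) ∈ s <;> simp [h]
  · exact ENNReal.mul_ne_top ENNReal.ofReal_ne_top (measure_ne_top _ _)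
  · refine ENNReal.mul_ne_top ENNReal.ofReal_ne_top ?_
    by_cases h : (0 : ℂ) ∈ s <;> simp [h]

variable {ν : Measure ℂ} [IsProbabilityMeasure ν] (p : unitInterval)

theorem sparseEntryLaw_real_ne_zero_le : (sparseEntryLaw ν p).real {y | y ≠ 0} ≤ p := by
  have hm : MeasurableSet {y : ℂ | y ≠ 0} := (measurableSet_singleton (0 : ℂ)).compl
  rw [sparseEntryLaw_real _ _ hm]
  have h1 := measureReal_le_one (μ := ν) (s := {y : ℂ | y ≠ 0})
  have : ({y : ℂ | y ≠ 0}).indicator (1 : ℂ → ℝ) 0 = 0 := by simp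
  rw [this]
  nlinarith [p.2.1]

theorem sparseEntryLaw_real_le_norm {c : ℝ} (hc : 0 < c) :
    (sparseEntryLaw ν p).real {y | c ≤ ‖y‖} = p * ν.real {y | c ≤ ‖y‖} := by
  rw [sparseEntryLaw_real _ _ (measurableSet_le measurable_const measurable_norm)]
  have : ({y : ℂ | c ≤ ‖y‖}).indicator (1 : ℂ → ℝ) 0 = 0 := by simp [hc]
  rw [this]; ring

theorem le_sparseEntryLaw_real_zero : 1 - (p : ℝ) ≤ (sparseEntryLaw ν p).real {0} := by
  rw [sparseEntryLaw_real _ _ (measurableSet_singleton (0 : ℂ))]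
  have h1 : 0 ≤ (p : ℝ) * ν.real {0} := mul_nonneg p.2.1 measureReal_nonneg
  simp
  linarith

/-- The second moment is finite, since a junk integral would be `0` and not `1`. -/
theorem integrable_norm_of_integral_sq (hν : ∫ x, ‖x‖ ^ 2 ∂ν = 1) :
    Integrable (fun x => ‖x‖) ν ∧ ∫ x, ‖x‖ ∂ν ≤ 1 := by
  have hsq : Integrable (fun x => ‖x‖ ^ 2) ν := by
    by_contra h
    rw [integral_undef h] at hν
    exact zero_ne_one hν
  have hle : ∀ x : ℂ, ‖x‖ ≤ (1 + ‖x‖ ^ 2) / 2 := fun x => by nlinarith [sq_nonneg (‖x‖ - 1)]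
  have hi : Integrable (fun x : ℂ => (1 + ‖x‖ ^ 2) / 2) ν :=
    ((integrable_const 1).add hsq).div_const 2
  have h1 : Integrable (fun x => ‖x‖) ν := by
    refine hi.mono' measurable_norm.aestronglyMeasurable (Eventually.of_forall fun x => ?_)
    rw [norm_norm]; exact hle x
  refine ⟨h1, (integral_mono h1 hi hle).trans ?_⟩
  rw [integral_div, integral_add (integrable_const 1) hsq, hν]
  simp

theorem integrable_norm_sparseEntryLaw (hν : ∫ x, ‖x‖ ^ 2 ∂ν = 1) :
    Integrable (fun x => ‖x‖) (sparseEntryLaw ν p) ∧ ∫ x, ‖x‖ ∂(sparseEntryLaw ν p) ≤ p := by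
  obtain ⟨h1, h2⟩ := integrable_norm_of_integral_sq hν
  have hi1 : Integrable (fun x : ℂ => ‖x‖) (ENNReal.ofReal p • ν) :=
    h1.smul_measure ENNReal.ofReal_ne_top
  have hi2 : Integrable (fun x : ℂ => ‖x‖) (ENNReal.ofReal (1 - p) • Measure.dirac (0 : ℂ)) :=
    (integrable_dirac (by simp)).smul_measure ENNReal.ofReal_ne_top
  rw [sparseEntryLaw_eq]
  refine ⟨hi1.add_measure hi2, ?_⟩
  rw [integral_add_measure hi1 hi2, integral_smul_measure, integral_smul_measure, integral_dirac,
    ENNReal.toReal_ofReal p.2.1]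
  simp only [norm_zero, smul_eq_mul, mul_zero, add_zero]
  nlinarith [p.2.1]

theorem le_prod_sparseEntryLaw_real {c : ℝ} (hc : 0 < c) (hp : (p : ℝ) ≤ 1 / 2) :
    p * ν.real {y | c ≤ ‖y‖} / 2 ≤
      ((sparseEntryLaw ν p).prod (sparseEntryLaw ν p)).real {z | c ≤ ‖z.1 - z.2‖} := by
  have hsub : {y : ℂ | c ≤ ‖y‖} ×ˢ {(0 : ℂ)} ⊆ {z : ℂ × ℂ | c ≤ ‖z.1 - z.2‖} := by
    rintro ⟨x, y⟩ ⟨hx, hy⟩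
    simp only [Set.mem_singleton_iff] at hy
    subst hy
    simpa using hx
  refine le_trans ?_ (measureReal_mono hsub)
  rw [measureReal_prod_prod, sparseEntryLaw_real_le_norm p hc]
  have h1 := le_sparseEntryLaw_real_zero (ν := ν) p
  have h2 : 0 ≤ (p : ℝ) * ν.real {y | c ≤ ‖y‖} := mul_nonneg p.2.1 measureReal_nonneg
  nlinarith

/-- A law with second moment `1` is not concentrated at `0`. -/
theorem exists_measureReal_le_norm_pos (hν : ∫ x, ‖x‖ ^ 2 ∂ν = 1) :
    ∃ c : ℝ, 0 < c ∧ c ≤ 1 ∧ 0 < ν.real {y | c ≤ ‖y‖} := by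
  by_contra! h
  have h1 : ∀ k : ℕ, ∀ᵐ y ∂ν, ‖y‖ < 1 / ((k : ℝ) + 1) := by
    intro k
    have h2 := h (1 / ((k : ℝ) + 1)) (by positivity) (by
      rw [div_le_one (by positivity)]
      linarith [Nat.cast_nonneg (α := ℝ) k])
    have h3 := (measureReal_eq_zero_iff).1 (le_antisymm h2 measureReal_nonneg)
    rw [ae_iff]
    simpa using h3
  have h2 : ∀ᵐ y ∂ν, ‖y‖ ^ 2 = 0 := by
    filter_upwards [ae_all_iff.2 h1] with y hy
    have h3 : ‖y‖ ≤ 0 := ge_of_tendsto' tendsto_one_div_add_atTop_nhds_zero_nat fun k => (hy k).le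
    simp [le_antisymm h3 (norm_nonneg y)]
  rw [integral_congr_ae h2] at hν
  simp at hν

end EntryLaw

section RowLaw

theorem measurableSet_sum_norm_le {ι : Type*} (S : Finset ι) (R : ℝ) :
    MeasurableSet {y : ι → ℂ | ∑ j ∈ S, ‖y j‖ ≤ R} :=
  measurableSet_le (by fun_prop) measurable_const

variable {ν : Measure ℂ} [IsProbabilityMeasure ν] (p : unitInterval)
  {ι : Type*} [Fintype ι] [DecidableEq ι]

/-- Restricted to a product event, the `ℓ¹` norm of the coordinates that the event does not involve
obeys Markov's inequality. -/
theorem measureReal_inter_sum_norm_gt_le (hν : ∫ x, ‖x‖ ^ 2 ∂ν = 1) (S : Finset ι)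
    {t : ι → Set ℂ} (ht : ∀ i, MeasurableSet (t i)) (htS : ∀ i ∉ S, t i = Set.univ) {R : ℝ}
    (hR : 0 < R) :
    (Measure.pi fun _ : ι => sparseEntryLaw ν p).real
        (Set.univ.pi t ∩ {y | R < ∑ j ∈ Sᶜ, ‖y j‖}) ≤
      (Measure.pi fun _ : ι => sparseEntryLaw ν p).real (Set.univ.pi t) *
        (Fintype.card ι * p / R) := by
  classical
  set P := Measure.pi fun _ : ι => sparseEntryLaw ν p with hP
  set μ := sparseEntryLaw ν p with hμ
  obtain ⟨hint, hE⟩ := integrable_norm_sparseEntryLaw p hν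
  have hpt : MeasurableSet (Set.univ.pi t) := MeasurableSet.univ_pi ht
  let f : ι → ι → ℂ → ℝ := fun l i x => (t i).indicator (fun x => if i = l then ‖x‖ else 1) x
  have hfi : ∀ l i, Integrable (f l i) μ := by
    intro l i
    refine Integrable.indicator ?_ (ht i)
    by_cases h : i = l
    · simpa [h] using hint
    · simp [h]
  have hprod : ∀ l y, ∏ i, f l i (y i) = (Set.univ.pi t).indicator (fun y => ‖y l‖) y := by
    intro l y
    by_cases hy : y ∈ Set.univ.pi t
    · rw [Set.indicator_of_mem hy]
      have : ∀ i, f l i (y i) = if i = l then ‖y i‖ else 1 := fun i =>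
        Set.indicator_of_mem (hy i trivial) _
      simp [this]
    · rw [Set.indicator_of_notMem hy]
      simp only [Set.mem_pi, Set.mem_univ, true_imp_iff, not_forall] at hy
      obtain ⟨i, hi⟩ := hy
      exact Finset.prod_eq_zero (Finset.mem_univ i) (Set.indicator_of_notMem hi _)
  have hval : ∀ l ∈ Sᶜ, ∫ y, ∏ i, f l i (y i) ∂P ≤ P.real (Set.univ.pi t) * p := by
    intro l hl
    have hl' := Finset.mem_compl.1 hl
    rw [hP, integral_fintype_prod_eq_prod, measureReal_def, Measure.pi_pi, ENNReal.toReal_prod]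
    rw [← Finset.mul_prod_erase _ _ (Finset.mem_univ l),
      ← Finset.mul_prod_erase Finset.univ (fun i => (μ (t i)).toReal) (Finset.mem_univ l)]
    have h1 : ∫ x, f l l x ∂μ ≤ p := by
      have : f l l = fun x => ‖x‖ := by
        ext x; simp [f, htS l hl']
      rw [this]; exact hE
    have h2 : (μ (t l)).toReal = 1 := by rw [htS l hl']; simp
    have h3 : ∏ i ∈ Finset.univ.erase l, ∫ x, f l i x ∂μ =
        ∏ i ∈ Finset.univ.erase l, (μ (t i)).toReal := by
      refine Finset.prod_congr rfl fun i hi => ?_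
      have hne := Finset.ne_of_mem_erase hi
      have : f l i = (t i).indicator 1 := by
        ext x
        simp only [f, hne, if_false]
        rfl
      rw [this, integral_indicator_one (ht i), measureReal_def]
    rw [h2, h3, one_mul, mul_comm]
    exact mul_le_mul_of_nonneg_left h1 (Finset.prod_nonneg fun i _ => ENNReal.toReal_nonneg)
  have hintf : ∀ l, Integrable (fun y : ι → ℂ => ∏ i, f l i (y i)) P := fun l =>
    Integrable.fintype_prod (hfi l)
  let F : (ι → ℂ) → ℝ := fun y => ∑ l ∈ Sᶜ, ∏ i, f l i (y i)
  have hF0 : ∀ y, 0 ≤ F y := fun y => Finset.sum_nonneg fun l _ => by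
    rw [hprod]; exact Set.indicator_nonneg (fun _ _ => norm_nonneg _) _
  have hFi : Integrable F P := integrable_finsetSum _ fun l _ => hintf l
  have hF : ∫ y, F y ∂P ≤ Fintype.card ι * (P.real (Set.univ.pi t) * p) := by
    rw [integral_finsetSum _ fun l _ => hintf l]
    calc _ ≤ ∑ l ∈ Sᶜ, P.real (Set.univ.pi t) * p := Finset.sum_le_sum hval
      _ = (Sᶜ.card : ℝ) * (P.real (Set.univ.pi t) * p) := by simp
      _ ≤ _ := by
        gcongr
        · exact mul_nonneg measureReal_nonneg p.2.1
        · exact Finset.card_le_univ _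
  have hmk := mul_meas_ge_le_integral_of_nonneg (Eventually.of_forall hF0) hFi R
  have hsub : Set.univ.pi t ∩ {y : ι → ℂ | R < ∑ j ∈ Sᶜ, ‖y j‖} ⊆ {y | R ≤ F y} := by
    rintro y ⟨hy, hy2⟩
    have : F y = ∑ j ∈ Sᶜ, ‖y j‖ := Finset.sum_congr rfl fun l _ => by
      rw [hprod, Set.indicator_of_mem hy]
    simp only [Set.mem_ofPred_eq] at hy2 ⊢
    rw [this]; exact hy2.le
  have hle : P.real (Set.univ.pi t ∩ {y | R < ∑ j ∈ Sᶜ, ‖y j‖}) ≤ P.real {y | R ≤ F y} :=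
    measureReal_mono hsub
  have h5 := (mul_le_mul_of_nonneg_left hle hR.le).trans (hmk.trans hF)
  rw [mul_comm, ← le_div_iff₀ hR] at h5
  refine h5.trans (le_of_eq ?_)
  ring

/-- A bound for the probability that a row is not isolated from `S`. -/
theorem measureReal_exists_ne_zero_or_le (hν : ∫ x, ‖x‖ ^ 2 ∂ν = 1) (S : Finset ι) {R : ℝ}
    (hR : 0 < R) :
    (Measure.pi fun _ : ι => sparseEntryLaw ν p).real
        {y | (∃ j ∈ S, y j ≠ 0) ∨ R < ∑ j ∈ Sᶜ, ‖y j‖} ≤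
      S.card * p + Fintype.card ι * p / R := by
  set P := Measure.pi fun _ : ι => sparseEntryLaw ν p with hP
  have h1 := measureReal_inter_sum_norm_gt_le p hν S (t := fun _ => Set.univ)
    (fun _ => MeasurableSet.univ) (fun _ _ => rfl) hR
  rw [Set.pi_univ, Set.univ_inter, probReal_univ, one_mul] at h1
  have h2 : P.real (⋃ j ∈ S, {y : ι → ℂ | y j ≠ 0}) ≤ S.card * p := by
    refine (measureReal_biUnion_finset_le _ _).trans ?_
    calc _ ≤ ∑ j ∈ S, (p : ℝ) := Finset.sum_le_sum fun j _ => by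
          have hm : MeasurableSet {y : ℂ | y ≠ 0} := (measurableSet_singleton (0 : ℂ)).compl
          have := (measurePreserving_eval (fun _ : ι => sparseEntryLaw ν p) j).measure_preimage
            hm.nullMeasurableSet
          have h3 : P.real {y : ι → ℂ | y j ≠ 0} = (sparseEntryLaw ν p).real {y | y ≠ 0} := by
            rw [measureReal_def, measureReal_def, ← this]; rfl
          rw [h3]; exact sparseEntryLaw_real_ne_zero_le p
      _ = _ := by simp
  have hsub : {y : ι → ℂ | (∃ j ∈ S, y j ≠ 0) ∨ R < ∑ j ∈ Sᶜ, ‖y j‖} ⊆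
      (⋃ j ∈ S, {y : ι → ℂ | y j ≠ 0}) ∪ {y | R < ∑ j ∈ Sᶜ, ‖y j‖} := by
    rintro y (⟨j, hj, h⟩ | h)
    · exact Or.inl (Set.mem_biUnion hj h)
    · exact Or.inr h
  exact (measureReal_mono hsub).trans ((measureReal_union_le _ _).trans (add_le_add h2 h1))

/-- A lower bound for the probability that exactly one coordinate in `S` is nonzero, that it is
large and lies in `S₁`, and that the row has bounded `ℓ¹` norm outside `S`. -/
theorem le_measureReal_unique_ne_zero (hν : ∫ x, ‖x‖ ^ 2 ∂ν = 1) {S S₁ : Finset ι} (hS : S₁ ⊆ S)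
    {c R : ℝ} (hc : 0 < c) (hR : 0 < R) (hRp : (Fintype.card ι : ℝ) * p / R ≤ 1 / 2) :
    (S₁.card : ℝ) * (p * ν.real {y | c ≤ ‖y‖} * (1 - p) ^ S.card / 2) ≤
      (Measure.pi fun _ : ι => sparseEntryLaw ν p).real
        {y | ∃ j ∈ S₁, c ≤ ‖y j‖ ∧ (∀ j' ∈ S, j' ≠ j → y j' = 0) ∧ ∑ j' ∈ Sᶜ, ‖y j'‖ ≤ R} := by
  classical
  set P := Measure.pi fun _ : ι => sparseEntryLaw ν p with hP
  have hp1 : (0 : ℝ) ≤ 1 - p := by linarith [p.2.2]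
  let t : ι → ι → Set ℂ := fun j i =>
    if i = j then {y | c ≤ ‖y‖} else if i ∈ S then {0} else Set.univ
  have ht : ∀ j i, MeasurableSet (t j i) := by
    intro j i
    simp only [t]
    split_ifs
    · exact measurableSet_le measurable_const measurable_norm
    · exact measurableSet_singleton _
    · exact MeasurableSet.univ
  let U : ι → Set (ι → ℂ) := fun j => Set.univ.pi (t j) ∩ {y | ∑ j' ∈ Sᶜ, ‖y j'‖ ≤ R}
  have hUm : ∀ j, MeasurableSet (U j) := fun j =>
    (MeasurableSet.univ_pi (ht j)).inter (measurableSet_sum_norm_le _ _)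
  have hUP : ∀ j ∈ S₁, p * ν.real {y | c ≤ ‖y‖} * (1 - p) ^ S.card / 2 ≤ P.real (U j) := by
    intro j hj
    have hjS := hS hj
    have h1 := measureReal_inter_sum_norm_gt_le p hν S (ht j) (by
      intro i hi
      have hne : i ≠ j := by rintro rfl; exact hi hjS
      simp [t, hi, hne]) hR
    have h2 : P.real (Set.univ.pi (t j)) = P.real (U j) +
        P.real (Set.univ.pi (t j) ∩ {y | R < ∑ j ∈ Sᶜ, ‖y j‖}) := by
      rw [← measureReal_inter_add_sdiff (s := Set.univ.pi (t j)) (measurableSet_sum_norm_le Sᶜ R)]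
      congr 2
      ext y
      simp
    have h3 : p * ν.real {y | c ≤ ‖y‖} * (1 - p) ^ S.card ≤ P.real (Set.univ.pi (t j)) := by
      rw [hP, measureReal_def (Measure.pi _), Measure.pi_pi, ENNReal.toReal_prod,
        ← Finset.mul_prod_erase _ _ (Finset.mem_univ j)]
      have h4 : (sparseEntryLaw ν p (t j j)).toReal = p * ν.real {y | c ≤ ‖y‖} := by
        rw [← sparseEntryLaw_real_le_norm p hc, measureReal_def]; simp [t]
      rw [h4]
      refine mul_le_mul_of_nonneg_left ?_ (mul_nonneg p.2.1 measureReal_nonneg)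
      calc (1 - (p : ℝ)) ^ S.card = ∏ i, if i ∈ S then 1 - (p : ℝ) else 1 := by
            rw [Finset.prod_ite_mem, Finset.univ_inter, Finset.prod_const]
        _ ≤ ∏ i ∈ Finset.univ.erase j, if i ∈ S then 1 - (p : ℝ) else 1 := by
            rw [← Finset.mul_prod_erase _ _ (Finset.mem_univ j), if_pos hjS]
            refine mul_le_of_le_one_left (Finset.prod_nonneg fun i _ => ?_) (by linarith [p.2.1])
            split_ifs <;> linarith
        _ ≤ _ := by
            refine Finset.prod_le_prod (fun i _ => ?_) fun i hi => ?_
            · split_ifs <;> linarith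
            · have hne := Finset.ne_of_mem_erase hi
              by_cases hiS : i ∈ S
              · simpa [t, hne, hiS, measureReal_def] using le_sparseEntryLaw_real_zero (ν := ν) p
              · simp [t, hne, hiS]
    have h5 : (0 : ℝ) ≤ P.real (Set.univ.pi (t j)) := measureReal_nonneg
    nlinarith
  have hdisj : Set.PairwiseDisjoint (S₁ : Set ι) U := by
    intro j hj j' hj' hne
    refine Set.disjoint_left.2 fun y hy hy' => ?_
    have h1 := hy.1 j trivial
    have h2 := hy'.1 j trivial
    have h1' : c ≤ ‖y j‖ := by simpa [t] using h1
    have h2' : y j = 0 := by simpa [t, hne, hS hj] using h2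
    rw [h2', norm_zero] at h1'
    linarith
  have hsub : (⋃ j ∈ S₁, U j) ⊆ {y | ∃ j ∈ S₁, c ≤ ‖y j‖ ∧ (∀ j' ∈ S, j' ≠ j → y j' = 0) ∧
      ∑ j' ∈ Sᶜ, ‖y j'‖ ≤ R} := by
    intro y hy
    obtain ⟨j, hj, hy⟩ := Set.mem_iUnion₂.1 hy
    refine ⟨j, hj, by simpa [t] using hy.1 j trivial, fun j' hj' hne => ?_, hy.2⟩
    simpa [t, hne, hj'] using hy.1 j' trivial
  refine le_trans ?_ (measureReal_mono hsub)
  rw [measureReal_biUnion_finset hdisj fun j _ => hUm j]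
  calc _ = ∑ j ∈ S₁, p * ν.real {y | c ≤ ‖y‖} * (1 - (p : ℝ)) ^ S.card / 2 := by simp
    _ ≤ _ := Finset.sum_le_sum hUP

end RowLaw

/-! ### Expansion of the sparse pattern -/

section Expansion

/-- The proportion of a column set of size `s` that peeling is required to remove. It is chosen so
that `peelRate n s * log (n / s) ≤ 1`, hence the choice of the remaining columns costs only a bounded
factor per column in a union bound. -/
noncomputable def peelRate (n s : ℝ) : ℝ := 1 / (2 + Real.log (n / s))

/-- Row `i` of `A` vanishes on the column set `S` and has `ℓ¹` norm at most `R` outside. After a shift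
by a multiple of the identity, its only nonzero entry on `S ∋ i` is the one on the diagonal. -/
def IsolatedRow {n : ℕ} (A : Fin n → Fin n → ℂ) (R : ℝ) (S : Finset (Fin n)) (i : Fin n) : Prop :=
  (∀ j ∈ S, A i j = 0) ∧ ∑ j ∈ Sᶜ, ‖A i j‖ ≤ R

/-- Row `i` of `A` has a single nonzero entry in `S`; that entry is large and lies in `S₁`. -/
def UniqueRow {n : ℕ} (A : Fin n → Fin n → ℂ) (c R : ℝ) (S S₁ : Finset (Fin n)) (i : Fin n) :
    Prop :=
  ∃ j ∈ S₁, c ≤ ‖A i j‖ ∧ (∀ j' ∈ S, j' ≠ j → A i j' = 0) ∧ ∑ j' ∈ Sᶜ, ‖A i j'‖ ≤ R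

/-- Every column set `S ⊇ E` with at most `L` elements can be peeled by a proportion `peelRate`: any
`S₁ ⊆ S` that omits a smaller proportion contains a column that is singled out by an isolated row or
by a unique row. The elements of `E` are not to be singled out by their own row, which need not
belong to the block in question; the unique rows are among the first half of the rows, which belong
to all blocks. -/
def Expanding {n : ℕ} (A : Fin n → Fin n → ℂ) (c d : ℝ) (L : ℕ) (E : Finset (Fin n)) : Prop :=
  ∀ S : Finset (Fin n), E ⊆ S → 1 ≤ S.card → S.card ≤ L → ∀ S₁ ⊆ S,
    (1 - peelRate n S.card) * S.card ≤ S₁.card →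
      (∃ i ∈ S₁ \ E, IsolatedRow A (n * d / S.card) S i) ∨
      ∃ i : Fin n, 2 * (i : ℕ) < n ∧ i ∉ S ∧ UniqueRow A c (n * d / S.card) S S₁ i

theorem choose_le_exp {n s : ℕ} (hs : 1 ≤ s) (hsn : s ≤ n) :
    (n.choose s : ℝ) ≤ Real.exp (s * (1 + Real.log (n / s))) := by
  have hs0 : (0 : ℝ) < s := by exact_mod_cast hs
  have hn0 : (0 : ℝ) < n := by exact_mod_cast (hs.trans hsn)
  have h1 : (n.choose s : ℝ) ≤ (n : ℝ) ^ s / s.factorial := Nat.choose_le_pow_div s n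
  have h2 := Real.pow_div_factorial_le_exp (s : ℝ) hs0.le s
  have h3 : Real.exp (s * (1 + Real.log (n / s))) = Real.exp s * ((n : ℝ) / s) ^ s := by
    rw [mul_add, mul_one, Real.exp_add, Real.exp_nat_mul, Real.exp_log (by positivity)]
  rw [h3]
  calc (n.choose s : ℝ) ≤ (n : ℝ) ^ s / s.factorial := h1
    _ = (s : ℝ) ^ s / s.factorial * ((n : ℝ) / s) ^ s := by
      rw [div_pow]; field_simp
    _ ≤ _ := by gcongr

/-- The number of column sets `S ⊇ E` of size `s`; an element of `E` saves a factor `n / s`, which makes up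
for the row that is not available for it. -/
theorem card_filter_subset_le {n s : ℕ} (hs : 1 ≤ s) (hsn : s ≤ n) (E : Finset (Fin n))
    (hE : E.card ≤ 1) :
    ((Finset.univ.filter fun S : Finset (Fin n) => E ⊆ S ∧ S.card = s).card : ℝ) ≤
      Real.exp (s * (1 + Real.log (n / s)) - E.card * Real.log (n / s)) := by
  have hs0 : (0 : ℝ) < s := by exact_mod_cast hs
  have hn0 : (0 : ℝ) < n := by exact_mod_cast (hs.trans hsn)
  have hmain := choose_le_exp hs hsn
  obtain rfl | ⟨e, rfl⟩ : E = ∅ ∨ ∃ e, E = {e} := by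
    rcases Nat.le_one_iff_eq_zero_or_eq_one.1 hE with h | h
    · exact Or.inl (Finset.card_eq_zero.1 h)
    · exact Or.inr (Finset.card_eq_one.1 h)
  · simp only [Finset.empty_subset, true_and, Finset.card_empty, Nat.cast_zero, zero_mul, sub_zero]
    have : (Finset.univ.filter fun S : Finset (Fin n) => S.card = s).card = n.choose s := by
      rw [← Finset.powerset_univ, ← Finset.powersetCard_eq_filter, Finset.card_powersetCard]
      simp
    rw [this]; exact hmain
  · have hcard : (Finset.univ.filter fun S : Finset (Fin n) => {e} ⊆ S ∧ S.card = s).card ≤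
        (n - 1).choose (s - 1) := by
      have h1 : (Finset.powersetCard (s - 1) (Finset.univ.erase e)).card =
          (n - 1).choose (s - 1) := by
        rw [Finset.card_powersetCard, Finset.card_erase_of_mem (Finset.mem_univ e)]
        simp
      rw [← h1]
      refine Finset.card_le_card_of_injOn (fun S => S.erase e) ?_ ?_
      · intro S hS
        simp only [Finset.singleton_subset_iff, Finset.coe_filter, Finset.mem_univ, true_and,
          Set.mem_ofPred_eq] at hS
        refine Finset.mem_coe.2 (Finset.mem_powersetCard.2 ⟨Finset.erase_subset_erase _ (Finset.subset_univ _), by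
          rw [Finset.card_erase_of_mem hS.1, hS.2]⟩)
      · intro S hS T hT h
        simp only [Finset.singleton_subset_iff, Finset.coe_filter, Finset.mem_univ, true_and,
          Set.mem_ofPred_eq] at hS hT
        rw [← Finset.insert_erase hS.1, ← Finset.insert_erase hT.1]
        exact congrArg (insert e) h
    have hid : n * (n - 1).choose (s - 1) = n.choose s * s := by
      obtain ⟨m, rfl⟩ : ∃ m, n = m + 1 := ⟨n - 1, by omega⟩
      obtain ⟨t, rfl⟩ : ∃ t, s = t + 1 := ⟨s - 1, by omega⟩
      simpa using Nat.add_one_mul_choose_eq m t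
    have hid' : (n : ℝ) * ((n - 1).choose (s - 1) : ℝ) = n.choose s * s := by exact_mod_cast hid
    have h2 : ((n - 1).choose (s - 1) : ℝ) = n.choose s * (s / n) := by
      field_simp; linarith
    have h3 : Real.exp (s * (1 + Real.log (n / s)) - (1 : ℕ) * Real.log (n / s)) =
        Real.exp (s * (1 + Real.log (n / s))) * (s / n) := by
      rw [Nat.cast_one, one_mul, Real.exp_sub, Real.exp_log (by positivity)]
      field_simp
    rw [Finset.card_singleton, h3]
    calc _ ≤ ((n - 1).choose (s - 1) : ℝ) := by exact_mod_cast hcard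
      _ = _ := h2
      _ ≤ _ := by gcongr

variable {ν : Measure ℂ} [IsProbabilityMeasure ν] (p : unitInterval)

instance (n : ℕ) : IsProbabilityMeasure (sparseArrayLaw n ν p) := by
  unfold sparseArrayLaw; infer_instance

/-- The probability that a fixed column set `S` fails to be peeled inside `S₁`. -/
theorem measureReal_not_peel_le {n : ℕ} {c R a u : ℝ}
    (S S₁ E : Finset (Fin n))
    (ha : (Measure.pi fun _ : Fin n => sparseEntryLaw ν p).real
      {y | (∃ j ∈ S, y j ≠ 0) ∨ R < ∑ j ∈ Sᶜ, ‖y j‖} ≤ a)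
    (hu : u ≤ (Measure.pi fun _ : Fin n => sparseEntryLaw ν p).real
      {y | ∃ j ∈ S₁, c ≤ ‖y j‖ ∧ (∀ j' ∈ S, j' ≠ j → y j' = 0) ∧ ∑ j' ∈ Sᶜ, ‖y j'‖ ≤ R})
    (hu0 : 0 ≤ u) (h4 : (n : ℝ) / 4 ≤ (n : ℝ) / 2 - S.card) (hS₁ : S₁ ⊆ S) :
    (sparseArrayLaw n ν p).real {A | (∀ i ∈ S₁ \ E, ¬ IsolatedRow A R S i) ∧
        ∀ i : Fin n, 2 * (i : ℕ) < n → i ∉ S → ¬ UniqueRow A c R S S₁ i} ≤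
      a ^ (S₁ \ E).card * Real.exp (-(u * (n / 4))) := by
  classical
  set P := Measure.pi fun _ : Fin n => sparseEntryLaw ν p with hP
  set X : Set (Fin n → ℂ) := {y | (∃ j ∈ S, y j ≠ 0) ∨ R < ∑ j ∈ Sᶜ, ‖y j‖} with hX
  set V : Set (Fin n → ℂ) := {y | ∃ j ∈ S₁, c ≤ ‖y j‖ ∧ (∀ j' ∈ S, j' ≠ j → y j' = 0) ∧
    ∑ j' ∈ Sᶜ, ‖y j'‖ ≤ R} with hV
  have hVm : MeasurableSet V := by
    have : V = ⋃ j ∈ S₁, ({y | c ≤ ‖y j‖} ∩ ((⋂ j' ∈ S, {y | j' ≠ j → y j' = 0}) ∩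
        {y | ∑ j' ∈ Sᶜ, ‖y j'‖ ≤ R})) := by
      ext y
      simp only [hV, Set.mem_ofPred_eq, Set.mem_iUnion, Set.mem_inter_iff, Set.mem_iInter,
        exists_prop]
    rw [this]
    refine Finset.measurableSet_biUnion _ fun j _ => ?_
    refine (measurableSet_le measurable_const (by fun_prop)).inter
      (MeasurableSet.inter (Finset.measurableSet_biInter _ fun j' _ => ?_)
        (measurableSet_sum_norm_le _ _))
    by_cases h : j' = j
    · simp [h]
    · simpa [h] using measurableSet_eq_fun (measurable_pi_apply j') measurable_const
  let t : Fin n → Set (Fin n → ℂ) := fun i =>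
    if i ∈ S₁ \ E then X else if 2 * (i : ℕ) < n ∧ i ∉ S then Vᶜ else Set.univ
  have hsub : {A : Fin n → Fin n → ℂ | (∀ i ∈ S₁ \ E, ¬ IsolatedRow A R S i) ∧
      ∀ i : Fin n, 2 * (i : ℕ) < n → i ∉ S → ¬ UniqueRow A c R S S₁ i} ⊆ Set.univ.pi t := by
    rintro A ⟨h1, h2⟩ i -
    simp only [t]
    split_ifs with hi1 hi2
    · have := h1 i hi1
      simp only [IsolatedRow, not_and_or, not_forall, not_le, exists_prop] at this
      exact this
    · exact h2 i hi2.1 hi2.2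
    · trivial
  refine (measureReal_mono hsub).trans ?_
  have hpi : (sparseArrayLaw n ν p).real (Set.univ.pi t) = ∏ i, P.real (t i) := by
    rw [sparseArrayLaw, measureReal_def, Measure.pi_pi, ENNReal.toReal_prod]
    rfl
  rw [hpi]
  set B : Finset (Fin n) := Finset.univ.filter fun i => 2 * (i : ℕ) < n ∧ i ∉ S with hB
  have hdisj : Disjoint (S₁ \ E) B := by
    refine Finset.disjoint_left.2 fun i hi hiB => ?_
    exact (Finset.mem_filter.1 hiB).2.2 (hS₁ (Finset.mem_sdiff.1 hi).1)
  have ha0 : 0 ≤ a := measureReal_nonneg.trans ha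
  have hu1 : u ≤ 1 := hu.trans measureReal_le_one
  have hVc : P.real Vᶜ ≤ 1 - u := by
    rw [probReal_compl_eq_one_sub hVm]; linarith
  have hBcard : (n : ℝ) / 4 ≤ B.card := by
    have h5 : (Finset.univ.filter fun i : Fin n => 2 * (i : ℕ) < n).card ≤ B.card + S.card := by
      rw [← Finset.card_sdiff_add_card_inter (Finset.univ.filter fun i : Fin n => 2 * (i : ℕ) < n) S]
      refine add_le_add (Finset.card_le_card fun i hi => ?_)
        (Finset.card_le_card Finset.inter_subset_right)
      simpa [hB] using hi
    have h6 : n ≤ 2 * (Finset.univ.filter fun i : Fin n => 2 * (i : ℕ) < n).card := by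
      have : (Finset.univ.filter fun i : Fin n => 2 * (i : ℕ) < n) =
          Finset.univ.filter fun i : Fin n => (i : ℕ) < (n + 1) / 2 := by
        ext i
        simp only [Finset.mem_filter, Finset.mem_univ, true_and]
        omega
      rw [this, Fin.card_filter_val_lt]
      omega
    have h5' : ((Finset.univ.filter fun i : Fin n => 2 * (i : ℕ) < n).card : ℝ) ≤
        B.card + S.card := by exact_mod_cast h5
    have h6' : (n : ℝ) ≤ 2 * ((Finset.univ.filter fun i : Fin n => 2 * (i : ℕ) < n).card : ℝ) := by
      exact_mod_cast h6
    linarith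
  calc ∏ i, P.real (t i)
      ≤ ∏ i, (if i ∈ S₁ \ E then a else 1) * (if i ∈ B then 1 - u else 1) := by
        refine Finset.prod_le_prod (fun i _ => measureReal_nonneg) fun i _ => ?_
        by_cases hi : i ∈ S₁ \ E
        · have hiB : i ∉ B := Finset.disjoint_left.1 hdisj hi
          simp only [t, hi, hiB, if_true, if_false, mul_one]
          exact ha
        · by_cases hiB : i ∈ B
          · have := (Finset.mem_filter.1 hiB).2
            simp only [t, hi, hiB, this, if_true, if_false, one_mul]
            simpa using hVc
          · have : ¬ (2 * (i : ℕ) < n ∧ i ∉ S) := fun h =>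
              hiB (Finset.mem_filter.2 ⟨Finset.mem_univ _, h⟩)
            simp only [t, hi, hiB, this, if_false, one_mul]
            exact measureReal_le_one
    _ = a ^ (S₁ \ E).card * (1 - u) ^ B.card := by
        rw [Finset.prod_mul_distrib, Finset.prod_ite_mem, Finset.prod_ite_mem, Finset.univ_inter,
          Finset.univ_inter, Finset.prod_const, Finset.prod_const]
    _ ≤ a ^ (S₁ \ E).card * Real.exp (-(u * (n / 4))) := by
        gcongr
        calc (1 - u) ^ B.card ≤ Real.exp (-u) ^ B.card := by
              gcongr
              linarith [Real.add_one_le_exp (-u)]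
          _ = Real.exp (-(u * B.card)) := by rw [← Real.exp_nat_mul]; ring_nf
          _ ≤ _ := by gcongr

end Expansion

/-! ### The probability of expansion -/

section ExpansionBound

variable {ν : Measure ℂ} [IsProbabilityMeasure ν] (p : unitInterval)

theorem peelRate_props {n s : ℝ} (hs : 0 < s) (hsn : s ≤ n) :
    0 < peelRate n s ∧ peelRate n s ≤ 1 / 2 ∧ peelRate n s * Real.log (n / s) ≤ 1 := by
  have hl : 0 ≤ Real.log (n / s) := Real.log_nonneg ((one_le_div hs).2 hsn)
  refine ⟨by unfold peelRate; positivity, ?_, ?_⟩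
  · unfold peelRate
    exact one_div_le_one_div_of_le (by norm_num) (by linarith)
  · unfold peelRate
    rw [one_div, inv_mul_le_iff₀ (by linarith)]
    linarith

theorem exp_neg_two_mul_le {x : ℝ} (h0 : 0 ≤ x) (h : x ≤ 1 / 2) : Real.exp (-(2 * x)) ≤ 1 - x := by
  have h1 : Real.exp (-(2 * x)) = (Real.exp (2 * x))⁻¹ := Real.exp_neg _
  rw [h1, inv_le_comm₀ (Real.exp_pos _) (by linarith)]
  have h2 := Real.add_one_le_exp (2 * x)
  refine le_trans ?_ h2
  rw [inv_le_iff_one_le_mul₀ (by linarith)]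
  nlinarith

/-- The two ways of peeling a column set of size `s` fail together with probability about
`(2 s d / n) ^ s * exp (-s c₁ √d / 16)`. -/
theorem measureReal_not_peel_le_exp (hν : ∫ x, ‖x‖ ^ 2 ∂ν = 1) {n L : ℕ} {c d : ℝ} (hc : 0 < c)
    (hp : (p : ℝ) ≤ 1 / 2) (hd : d = p * n) (hd1 : 1 ≤ d) (hLn : 4 * L ≤ n)
    (hL : 4 * (p : ℝ) * L ≤ Real.log d) {S S₁ E : Finset (Fin n)} (hS : 1 ≤ S.card) (hSL : S.card ≤ L)
    (hS₁ : S₁ ⊆ S) (hθ : (1 - peelRate n S.card) * S.card ≤ S₁.card) :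
    (sparseArrayLaw n ν p).real {A | (∀ i ∈ S₁ \ E, ¬ IsolatedRow A (n * d / S.card) S i) ∧
        ∀ i : Fin n, 2 * (i : ℕ) < n → i ∉ S → ¬ UniqueRow A c (n * d / S.card) S S₁ i} ≤
      Real.exp (S.card * (Real.log (2 * d) + 1 - ν.real {y | c ≤ ‖y‖} * √d / 16) -
        (S.card - E.card) * Real.log (n / S.card)) := by
  set s : ℝ := (S.card : ℝ) with hs
  set c₁ := ν.real {y | c ≤ ‖y‖} with hc₁
  have hc₁0 : 0 ≤ c₁ := measureReal_nonneg
  have hs1 : 1 ≤ s := by rw [hs]; exact_mod_cast hS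
  have hs0 : 0 < s := by linarith
  have hsL : s ≤ L := by rw [hs]; exact_mod_cast hSL
  have hLn' : 4 * (L : ℝ) ≤ n := by exact_mod_cast hLn
  have hn0 : (0 : ℝ) < n := by linarith
  have hsn : s ≤ n := by linarith
  have hd0 : 0 < d := by linarith
  have hp0 : 0 ≤ (p : ℝ) := p.2.1
  have hR : 0 < n * d / s := by positivity
  have hRp : (Fintype.card (Fin n) : ℝ) * p / (n * d / s) = s / n := by
    rw [Fintype.card_fin, mul_comm (n : ℝ) (p : ℝ), ← hd]
    field_simp
  obtain ⟨hθ0, hθ2, hθl⟩ := peelRate_props hs0 hsn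
  set θ := peelRate n s with hθdef
  set lam := Real.log (n / s) with hlam
  have hlam0 : 0 ≤ lam := Real.log_nonneg ((one_le_div hs0).2 hsn)
  have ha := measureReal_exists_ne_zero_or_le (ν := ν) p hν S hR
  rw [hRp] at ha
  have ha' : S.card * (p : ℝ) + s / n ≤ Real.exp (Real.log (2 * d) - lam) := by
    rw [Real.exp_sub, Real.exp_log (by positivity), hlam, Real.exp_log (by positivity)]
    have : S.card * (p : ℝ) = s * d / n := by
      rw [hd, eq_div_iff hn0.ne', hs]; ring
    rw [this, ← add_div, div_le_div_iff₀ hn0 (by positivity)]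
    have h1 : (s * d + s) * (n / s) = (d + 1) * n := by field_simp
    rw [h1]
    have : 0 ≤ (d - 1) * n := mul_nonneg (by linarith) hn0.le
    linarith
  have hu := le_measureReal_unique_ne_zero (ν := ν) p hν hS₁ hc hR (by
    rw [hRp, div_le_iff₀ hn0]; linarith)
  have hu0 : 0 ≤ (S₁.card : ℝ) * (p * c₁ * (1 - p) ^ S.card / 2) := by
    have : (0 : ℝ) ≤ 1 - p := by linarith
    positivity
  have hmain := measureReal_not_peel_le p S S₁ E (ha.trans ha') hu hu0 (by linarith) hS₁
  refine hmain.trans ?_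
  rw [← Real.exp_nat_mul, ← Real.exp_add, Real.exp_le_exp]
  set k : ℝ := ((S₁ \ E).card : ℝ) with hk
  have hk1 : k ≤ s := by
    rw [hk, hs]
    exact_mod_cast (Finset.card_le_card (Finset.sdiff_subset.trans hS₁))
  have hk2 : (1 - θ) * s - E.card ≤ k := by
    have : (S₁.card : ℝ) ≤ k + E.card := by
      have := Finset.le_card_sdiff E S₁
      have h3 : S₁.card ≤ (S₁ \ E).card + E.card := by omega
      rw [hk]
      exact_mod_cast h3
    linarith
  have hlog2d : 0 ≤ Real.log (2 * d) := Real.log_nonneg (by linarith)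
  have h1 : k * (Real.log (2 * d) - lam) ≤ s * (Real.log (2 * d) + 1) - (s - E.card) * lam := by
    have h2 : k * Real.log (2 * d) ≤ s * Real.log (2 * d) := by gcongr
    have h3 : ((1 - θ) * s - E.card) * lam ≤ k * lam := by gcongr
    have h4 : s * (θ * lam) ≤ s * 1 := by gcongr
    linarith
  have h5 : s * (c₁ * √d / 16) ≤ (S₁.card : ℝ) * (p * c₁ * (1 - p) ^ S.card / 2) * (n / 4) := by
    have h6 : (√d)⁻¹ ≤ (1 - (p : ℝ)) ^ S.card := by
      calc (√d)⁻¹ = Real.exp (-(Real.log d / 2)) := by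
            rw [Real.exp_neg, Real.exp_half, Real.exp_log hd0]
        _ ≤ Real.exp (-(2 * p)) ^ S.card := by
            rw [← Real.exp_nat_mul, Real.exp_le_exp]
            have : (p : ℝ) * s ≤ p * L := by gcongr
            linarith
        _ ≤ _ := by
            gcongr
            exact exp_neg_two_mul_le hp0 hp
    have h7 : s / 2 ≤ S₁.card := by
      refine le_trans ?_ hθ
      have : 0 ≤ (1 / 2 - θ) * s := mul_nonneg (by linarith) hs0.le
      linarith
    have h8 : √d * √d = d := Real.mul_self_sqrt hd0.le
    have h9 : 0 < √d := Real.sqrt_pos.2 hd0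
    have h10 : (p : ℝ) * n * (√d)⁻¹ = √d := by
      rw [← hd, mul_inv_eq_iff_eq_mul₀ h9.ne', h8]
    have h11 : s * (c₁ * √d / 16) = s / 2 * ((p : ℝ) * c₁ * (√d)⁻¹ / 2) * (n / 4) := by
      calc s * (c₁ * √d / 16) = s * (c₁ * ((p : ℝ) * n * (√d)⁻¹) / 16) := by rw [h10]
        _ = _ := by ring
    rw [h11]
    have h12 : (p : ℝ) * c₁ * (√d)⁻¹ ≤ (p : ℝ) * c₁ * (1 - p) ^ S.card :=
      mul_le_mul_of_nonneg_left h6 (by positivity)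
    have h13 : 0 ≤ (p : ℝ) * c₁ * (√d)⁻¹ := by positivity
    exact mul_le_mul_of_nonneg_right (mul_le_mul h7 (by linarith) (by linarith) (by positivity))
      (by positivity)
  linarith

/-- The union bound over column sets. The number of sets of size `s` is at most `(e n / s) ^ s`, which
cancels the factor `(s / n) ^ s` in the probability of failure and leaves a geometric series. -/
theorem measureReal_not_expanding_le (hν : ∫ x, ‖x‖ ^ 2 ∂ν = 1) {n L : ℕ} {c d : ℝ} (hc : 0 < c)
    (hp : (p : ℝ) ≤ 1 / 2) (hd : d = p * n) (hd1 : 1 ≤ d) (hLn : 4 * L ≤ n)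
    (hL : 4 * (p : ℝ) * L ≤ Real.log d) {E : Finset (Fin n)} (hE : E.card ≤ 1) {x : ℝ}
    (hx : x = 4 * Real.exp 2 * d * Real.exp (-(ν.real {y | c ≤ ‖y‖} * √d / 16)))
    (hx2 : x ≤ 1 / 2) :
    (sparseArrayLaw n ν p).real {A | ¬ Expanding A c d L E} ≤ 2 * x := by
  classical
  have hd0 : 0 < d := by linarith
  let 𝒮 : Finset (Finset (Fin n)) :=
    Finset.univ.filter fun S => E ⊆ S ∧ 1 ≤ S.card ∧ S.card ≤ L
  let Bad : Finset (Fin n) → Finset (Fin n) → Set (Fin n → Fin n → ℂ) := fun S S₁ =>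
    {A | (1 - peelRate n S.card) * S.card ≤ S₁.card ∧
      (∀ i ∈ S₁ \ E, ¬ IsolatedRow A (n * d / S.card) S i) ∧
      ∀ i : Fin n, 2 * (i : ℕ) < n → i ∉ S → ¬ UniqueRow A c (n * d / S.card) S S₁ i}
  have hsub : {A : Fin n → Fin n → ℂ | ¬ Expanding A c d L E} ⊆
      ⋃ S ∈ 𝒮, ⋃ S₁ ∈ S.powerset, Bad S S₁ := by
    intro A hA
    simp only [Expanding, Set.mem_ofPred_eq] at hA
    push Not at hA
    obtain ⟨S, hES, h1, h2, S₁, hS₁, hθ, h3, h4⟩ := hA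
    exact Set.mem_biUnion (show S ∈ 𝒮 from Finset.mem_filter.2 ⟨Finset.mem_univ _, hES, h1, h2⟩)
      (Set.mem_biUnion (Finset.mem_powerset.2 hS₁) ⟨hθ, h3, h4⟩)
  let b : ℕ → ℝ := fun s => Real.exp (s * (Real.log (2 * d) + 1 - ν.real {y | c ≤ ‖y‖} * √d / 16) -
        (s - E.card) * Real.log (n / s))
  have hbad : ∀ S ∈ 𝒮, ∀ S₁ ∈ S.powerset, (sparseArrayLaw n ν p).real (Bad S S₁) ≤ b S.card := by
    intro S hS S₁ hS₁
    obtain ⟨-, -, h1, h2⟩ := Finset.mem_filter.1 hS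
    by_cases hθ : (1 - peelRate n S.card) * S.card ≤ S₁.card
    · refine le_trans (measureReal_mono ?_) (measureReal_not_peel_le_exp p hν hc hp hd hd1 hLn hL h1
        h2 (Finset.mem_powerset.1 hS₁) hθ (E := E))
      exact fun A hA => hA.2
    · have : Bad S S₁ = ∅ := by
        ext A; simp [Bad, hθ]
      rw [this, measureReal_empty]
      exact (Real.exp_pos _).le
  have hx0 : 0 < x := by rw [hx]; positivity
  have hsum : (sparseArrayLaw n ν p).real {A | ¬ Expanding A c d L E} ≤ ∑ S ∈ 𝒮, 2 ^ S.card * b S.card := by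
    refine (measureReal_mono hsub (measure_ne_top _ _)).trans
      ((measureReal_biUnion_finset_le _ _).trans ?_)
    refine Finset.sum_le_sum fun S hS => (measureReal_biUnion_finset_le _ _).trans ?_
    calc _ ≤ ∑ S₁ ∈ S.powerset, b S.card := Finset.sum_le_sum (hbad S hS)
      _ = _ := by simp [Finset.card_powerset]
  have hfib : ∑ S ∈ 𝒮, 2 ^ S.card * b S.card ≤ ∑ s ∈ Finset.Icc 1 L, x ^ s := by
    rw [← Finset.sum_fiberwise_of_maps_to (g := Finset.card) (t := Finset.Icc 1 L)]
    · refine Finset.sum_le_sum fun s hs => ?_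
      obtain ⟨hs1, hs2⟩ := Finset.mem_Icc.1 hs
      have hcard := card_filter_subset_le (n := n) hs1 (by omega) E hE
      calc ∑ S ∈ 𝒮 with S.card = s, 2 ^ S.card * b S.card
          = ((𝒮.filter fun S => S.card = s).card : ℝ) * (2 ^ s * b s) := by
            rw [← nsmul_eq_mul, ← Finset.sum_const]
            exact Finset.sum_congr rfl fun S hS => by rw [(Finset.mem_filter.1 hS).2]
        _ ≤ Real.exp (s * (1 + Real.log (n / s)) - E.card * Real.log (n / s)) * (2 ^ s * b s) := by
            gcongr
            refine le_trans ?_ hcard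
            exact_mod_cast Finset.card_le_card fun S hS => by
              simp only [𝒮, Finset.mem_filter, Finset.mem_univ, true_and] at hS ⊢
              exact ⟨hS.1.1, hS.2⟩
        _ = x ^ s := by
            have h2 : (2 : ℝ) ^ s = Real.exp (s * Real.log 2) := by
              rw [Real.exp_nat_mul, Real.exp_log (by norm_num)]
            have h3 : x = Real.exp (2 + Real.log 2 + Real.log (2 * d) -
                ν.real {y | c ≤ ‖y‖} * √d / 16) := by
              rw [hx, sub_eq_add_neg, Real.exp_add, Real.exp_add, Real.exp_add,
                Real.exp_log (by norm_num), Real.exp_log (by positivity)]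
              ring
            rw [h2, h3, ← Real.exp_nat_mul, ← Real.exp_add, ← Real.exp_add]
            congr 1
            ring
    · intro S hS
      obtain ⟨-, -, h1, h2⟩ := Finset.mem_filter.1 hS
      exact Finset.mem_Icc.2 ⟨h1, h2⟩
  have hgeom : ∑ s ∈ Finset.Icc 1 L, x ^ s ≤ 2 * x := by
    have h1 : ∑ s ∈ Finset.Icc 1 L, x ^ s = x * ∑ s ∈ Finset.range L, x ^ s := by
      have hIcc : Finset.Icc 1 L = Finset.Ico (0 + 1) (L + 1) := by
        ext j; simp only [Finset.mem_Icc, Finset.mem_Ico]; omega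
      rw [hIcc, ← Finset.sum_Ico_add' (fun s => x ^ s) 0 L 1, Finset.mul_sum,
        Finset.range_eq_Ico]
      exact Finset.sum_congr rfl fun s _ => pow_succ' x s
    have h2 : ∑ s ∈ Finset.range L, x ^ s ≤ 2 := by
      refine (Summable.sum_le_tsum _ (fun s _ => by positivity)
        (summable_geometric_of_lt_one hx0.le (by linarith))).trans ?_
      rw [tsum_geometric_of_lt_one hx0.le (by linarith), inv_le_comm₀ (by linarith) (by norm_num)]
      linarith
    rw [h1]; nlinarith
  exact hsum.trans (hfib.trans hgeom)

end ExpansionBound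

/-! ### Anticoncentration by a second moment -/

section SecondMoment

variable {H : Type*} [NormedAddCommGroup H] {ι : Type*} [DecidableEq ι]

open InnerProductSpace

/-- The signed sum `v + ∑_{j ∈ J} ± w j` with sign `+` for the indices in `T`. -/
noncomputable def signedSum (v : H) (w : ι → H) (J T : Finset ι) : H :=
  v + ∑ j ∈ J, if j ∈ T then w j else -w j

theorem signedSum_insert_of_subset (v : H) (w : ι → H) {J T : Finset ι} {a : ι} (ha : a ∉ J)
    (hT : T ⊆ J) : signedSum v w (insert a J) T = signedSum v w J T - w a := by
  have : a ∉ T := fun h => ha (hT h)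
  rw [signedSum, signedSum, Finset.sum_insert ha, if_neg this]
  abel

theorem signedSum_insert_insert (v : H) (w : ι → H) {J T : Finset ι} {a : ι} (ha : a ∉ J) :
    signedSum v w (insert a J) (insert a T) = signedSum v w J T + w a := by
  rw [signedSum, signedSum, Finset.sum_insert ha, if_pos (Finset.mem_insert_self _ _)]
  have : ∑ j ∈ J, (if j ∈ insert a T then w j else -w j) = ∑ j ∈ J, if j ∈ T then w j else -w j := by
    refine Finset.sum_congr rfl fun j hj => ?_
    have : j ≠ a := fun h => ha (h ▸ hj)
    simp [this]
  rw [this]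
  abel

variable [InnerProductSpace ℂ H]

theorem sum_powerset_re_inner_signedSum_sq (v : H) (w : ι → H) (J : Finset ι) (x : H) :
    ∑ T ∈ J.powerset, (⟪signedSum v w J T, x⟫_ℂ).re ^ 2 =
      2 ^ J.card * ((⟪v, x⟫_ℂ).re ^ 2 + ∑ j ∈ J, (⟪w j, x⟫_ℂ).re ^ 2) := by
  induction J using Finset.induction_on with
  | empty => simp [signedSum]
  | insert a J ha ih =>
    rw [Finset.sum_powerset_insert ha, Finset.card_insert_of_notMem ha, Finset.sum_insert ha,
      ← Finset.sum_add_distrib]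
    have h : ∀ T ∈ J.powerset, (⟪signedSum v w (insert a J) T, x⟫_ℂ).re ^ 2 +
        (⟪signedSum v w (insert a J) (insert a T), x⟫_ℂ).re ^ 2 =
        2 * (⟪signedSum v w J T, x⟫_ℂ).re ^ 2 + 2 * (⟪w a, x⟫_ℂ).re ^ 2 := by
      intro T hT
      rw [signedSum_insert_of_subset v w ha (Finset.mem_powerset.1 hT),
        signedSum_insert_insert v w ha, inner_sub_left, inner_add_left, Complex.sub_re,
        Complex.add_re]
      ring
    rw [Finset.sum_congr rfl h, Finset.sum_add_distrib, ← Finset.mul_sum, ih, Finset.sum_const,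
      Finset.card_powerset, nsmul_eq_mul]
    push_cast
    ring

/-- The variance of the squared length of a randomly signed sum. -/
theorem sum_powerset_norm_sq_signedSum_sub_sq (v : H) (w : ι → H) (J : Finset ι) :
    ∑ T ∈ J.powerset, (‖signedSum v w J T‖ ^ 2 - (‖v‖ ^ 2 + ∑ j ∈ J, ‖w j‖ ^ 2)) ^ 2 =
      2 ^ J.card * (4 * ∑ j ∈ J, (⟪v, w j⟫_ℂ).re ^ 2 +
        2 * ∑ i ∈ J, ∑ j ∈ J, if i = j then 0 else (⟪w i, w j⟫_ℂ).re ^ 2) := by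
  induction J using Finset.induction_on with
  | empty => simp [signedSum]
  | insert a J ha ih =>
    rw [Finset.sum_powerset_insert ha, Finset.card_insert_of_notMem ha, Finset.sum_insert ha,
      ← Finset.sum_add_distrib, Finset.sum_insert ha, Finset.sum_insert ha]
    have h : ∀ T ∈ J.powerset, (‖signedSum v w (insert a J) T‖ ^ 2 -
          (‖v‖ ^ 2 + (‖w a‖ ^ 2 + ∑ j ∈ J, ‖w j‖ ^ 2))) ^ 2 +
        (‖signedSum v w (insert a J) (insert a T)‖ ^ 2 -
          (‖v‖ ^ 2 + (‖w a‖ ^ 2 + ∑ j ∈ J, ‖w j‖ ^ 2))) ^ 2 =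
        2 * (‖signedSum v w J T‖ ^ 2 - (‖v‖ ^ 2 + ∑ j ∈ J, ‖w j‖ ^ 2)) ^ 2 +
          8 * (⟪signedSum v w J T, w a⟫_ℂ).re ^ 2 := by
      intro T hT
      rw [signedSum_insert_of_subset v w ha (Finset.mem_powerset.1 hT),
        signedSum_insert_insert v w ha, norm_sub_sq (𝕜 := ℂ), norm_add_sq (𝕜 := ℂ)]
      simp only [RCLike.re_to_complex]
      ring
    rw [Finset.sum_congr rfl h, Finset.sum_add_distrib, ← Finset.mul_sum, ih, ← Finset.mul_sum,
      sum_powerset_re_inner_signedSum_sq, Finset.sum_insert ha]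
    have h1 : ∀ i ∈ J, (∑ j ∈ insert a J, if i = j then (0 : ℝ) else (⟪w i, w j⟫_ℂ).re ^ 2) =
        (⟪w i, w a⟫_ℂ).re ^ 2 + ∑ j ∈ J, if i = j then (0 : ℝ) else (⟪w i, w j⟫_ℂ).re ^ 2 := by
      intro i hi
      have : i ≠ a := fun h => ha (h ▸ hi)
      rw [Finset.sum_insert ha, if_neg this]
    have h2 : (∑ j ∈ J, if a = j then (0 : ℝ) else (⟪w a, w j⟫_ℂ).re ^ 2) =
        ∑ j ∈ J, (⟪w j, w a⟫_ℂ).re ^ 2 := by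
      refine Finset.sum_congr rfl fun j hj => ?_
      have : a ≠ j := fun h => ha (h ▸ hj)
      rw [if_neg this, ← inner_conj_symm, Complex.conj_re]
    rw [Finset.sum_congr rfl h1, Finset.sum_add_distrib, h2, if_pos rfl]
    ring

/-- Chebyshev's inequality for randomly signed sums `v + ∑ ± a j • x j` in a Hilbert space, where
the `x j` satisfy Bessel's inequality. -/
theorem card_filter_norm_signedSum_le {x : ι → H} {α : ι → ℂ} {v : H} {J : Finset ι}
    (hB : ∑ j ∈ J, ‖⟪v, x j⟫_ℂ‖ ^ 2 ≤ ‖v‖ ^ 2) {a M Q ρ : ℝ} (ha : ∀ j ∈ J, ‖α j‖ ≤ a)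
    (hM0 : 0 < M) (hM : M ≤ ∑ j ∈ J, ‖α j • x j‖ ^ 2)
    (hQ : (∑ i ∈ J, ∑ j ∈ J, if i = j then 0 else ‖⟪x i, x j⟫_ℂ‖ ^ 2) ≤ Q)
    (hρ : 2 * ρ ^ 2 ≤ M) :
    (((J.powerset.filter fun T => ‖signedSum v (fun j => α j • x j) J T‖ ≤ ρ).card : ℕ) : ℝ) ≤
      2 ^ J.card * (16 * (a ^ 2 / M) + 8 * (a ^ 4 * Q / M ^ 2)) := by
  set w : ι → H := fun j => α j • x j with hw
  set V := ‖v‖ ^ 2 with hV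
  set S := ∑ j ∈ J, ‖w j‖ ^ 2 with hS
  have hV0 : 0 ≤ V := by positivity
  have hre : ∀ z : ℂ, z.re ^ 2 ≤ ‖z‖ ^ 2 := fun z => by
    rw [← sq_abs]
    exact pow_le_pow_left₀ (abs_nonneg _) (Complex.abs_re_le_norm z) 2
  have hvar := sum_powerset_norm_sq_signedSum_sub_sq v w J
  have hL : ∑ j ∈ J, (⟪v, w j⟫_ℂ).re ^ 2 ≤ a ^ 2 * V := by
    calc _ ≤ ∑ j ∈ J, a ^ 2 * ‖⟪v, x j⟫_ℂ‖ ^ 2 := by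
          refine Finset.sum_le_sum fun j hj => (hre _).trans ?_
          rw [hw, inner_smul_right, norm_mul, mul_pow]
          gcongr
          exact ha j hj
      _ ≤ _ := by
          rw [← Finset.mul_sum]
          gcongr
  have hQ' : (∑ i ∈ J, ∑ j ∈ J, if i = j then 0 else (⟪w i, w j⟫_ℂ).re ^ 2) ≤ a ^ 4 * Q := by
    calc _ ≤ ∑ i ∈ J, ∑ j ∈ J, a ^ 4 * (if i = j then 0 else ‖⟪x i, x j⟫_ℂ‖ ^ 2) := by
          refine Finset.sum_le_sum fun i hi => Finset.sum_le_sum fun j hj => ?_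
          split_ifs
          · simp
          · refine (hre _).trans ?_
            rw [hw, inner_smul_left, inner_smul_right, norm_mul, norm_mul, mul_pow, mul_pow,
              ← mul_assoc, RCLike.norm_conj, show a ^ 4 = a ^ 2 * a ^ 2 by ring]
            gcongr
            · exact ha i hi
            · exact ha j hj
      _ ≤ _ := by
          simp_rw [← Finset.mul_sum]
          gcongr
  have hlow : ∀ T ∈ J.powerset.filter fun T => ‖signedSum v w J T‖ ≤ ρ,
      ((V + S) / 2) ^ 2 ≤ (‖signedSum v w J T‖ ^ 2 - (V + S)) ^ 2 := by
    intro T hT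
    have h1 : ‖signedSum v w J T‖ ^ 2 ≤ ρ ^ 2 :=
      pow_le_pow_left₀ (norm_nonneg _) (Finset.mem_filter.1 hT).2 2
    rw [← neg_sub (V + S), neg_sq]
    refine pow_le_pow_left₀ (by linarith) ?_ 2
    linarith
  have hcard : ((J.powerset.filter fun T => ‖signedSum v w J T‖ ≤ ρ).card : ℝ) *
      ((V + S) / 2) ^ 2 ≤ 2 ^ J.card * (4 * (a ^ 2 * V) + 2 * (a ^ 4 * Q)) := by
    calc _ = ∑ T ∈ J.powerset.filter fun T => ‖signedSum v w J T‖ ≤ ρ, ((V + S) / 2) ^ 2 := by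
          rw [Finset.sum_const, nsmul_eq_mul]
      _ ≤ ∑ T ∈ J.powerset.filter fun T => ‖signedSum v w J T‖ ≤ ρ,
          (‖signedSum v w J T‖ ^ 2 - (V + S)) ^ 2 := Finset.sum_le_sum hlow
      _ ≤ ∑ T ∈ J.powerset, (‖signedSum v w J T‖ ^ 2 - (V + S)) ^ 2 :=
          Finset.sum_le_sum_of_subset_of_nonneg (Finset.filter_subset _ _) fun _ _ _ => sq_nonneg _
      _ ≤ _ := by
          rw [hvar]
          gcongr
  have hVS : 0 < V + S := by linarith
  have hQ0 : 0 ≤ a ^ 4 * Q := by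
    refine mul_nonneg (by positivity) (le_trans ?_ hQ)
    exact Finset.sum_nonneg fun i _ => Finset.sum_nonneg fun j _ => by split_ifs <;> positivity
  rw [← le_div_iff₀ (by positivity)] at hcard
  refine hcard.trans ?_
  rw [mul_div_assoc]
  gcongr
  have e1 : (4 * (a ^ 2 * V) + 2 * (a ^ 4 * Q)) / ((V + S) / 2) ^ 2 =
      16 * (a ^ 2 * (V / (V + S) ^ 2)) + 8 * (a ^ 4 * Q / (V + S) ^ 2) := by
    field_simp
    ring
  rw [e1]
  have h3 : V / (V + S) ^ 2 ≤ 1 / M := by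
    rw [div_le_div_iff₀ (by positivity) hM0]
    nlinarith
  have h4 : M ^ 2 ≤ (V + S) ^ 2 := pow_le_pow_left₀ hM0.le (by linarith) 2
  have h5 : a ^ 2 * (V / (V + S) ^ 2) ≤ a ^ 2 / M := by
    rw [div_eq_mul_one_div (a ^ 2)]
    gcongr
  have h6 : a ^ 4 * Q / (V + S) ^ 2 ≤ a ^ 4 * Q / M ^ 2 := by gcongr
  linarith

/-- A bound for the selections inside `J`, uniform in the selection outside `J`, holds for all selections. -/
theorem card_filter_le_of_forall_inter {ι : Type*} [Fintype ι] [DecidableEq ι] (J : Finset ι)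
    (p : Finset ι → Prop) [DecidablePred p] {b : ℝ}
    (h : ∀ T₁, ((J.powerset.filter fun T => p (T₁ \ J ∪ T)).card : ℝ) ≤ 2 ^ J.card * b) :
    ((Finset.univ.filter p).card : ℝ) ≤ 2 ^ Fintype.card ι * b := by
  have h1 := Finset.card_eq_sum_card_fiberwise (s := Finset.univ.filter p) (f := fun T => T \ J)
    (t := Jᶜ.powerset) (fun T _ => Finset.mem_coe.2 (Finset.mem_powerset.2 fun i hi => by
      simpa using (Finset.mem_sdiff.1 hi).2))
  rw [h1]
  push_cast
  have h2 : ∀ T₁ ∈ Jᶜ.powerset,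
      ((((Finset.univ.filter p).filter fun T => T \ J = T₁).card : ℕ) : ℝ) ≤ 2 ^ J.card * b := by
    intro T₁ hT₁
    refine le_trans ?_ (h T₁)
    rw [Nat.cast_le]
    refine Finset.card_le_card_of_injOn (fun T => T ∩ J) (fun T hT => ?_) fun T hT T' hT' heq => ?_
    · obtain ⟨h3, h4⟩ := Finset.mem_filter.1 (Finset.mem_coe.1 hT)
      refine Finset.mem_coe.2 (Finset.mem_filter.2
        ⟨Finset.mem_powerset.2 Finset.inter_subset_right, ?_⟩)
      have h5 : T₁ \ J = T₁ := by rw [← h4, sdiff_idem]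
      rw [h5, ← h4, Finset.sdiff_union_inter]
      exact (Finset.mem_filter.1 h3).2
    · rw [← Finset.sdiff_union_inter T J, ← Finset.sdiff_union_inter T' J,
        (Finset.mem_filter.1 (Finset.mem_coe.1 hT)).2,
        (Finset.mem_filter.1 (Finset.mem_coe.1 hT')).2]
      exact congrArg (T₁ ∪ ·) heq
  refine (Finset.sum_le_sum h2).trans (le_of_eq ?_)
  rw [Finset.sum_const, Finset.card_powerset, Finset.card_compl, nsmul_eq_mul, ← mul_assoc]
  push_cast
  rw [← pow_add, Nat.sub_add_cancel (Finset.card_le_univ J)]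

/-- Distinct coordinates fall in a set independently. -/
theorem measureReal_pi_pair {ι X : Type*} [Fintype ι] [DecidableEq ι] [MeasurableSpace X]
    (P : Measure X) [IsProbabilityMeasure P] (s : Set X) {i j : ι} (hij : i ≠ j) :
    (Measure.pi fun _ : ι => P).real {z | z i ∈ s ∧ z j ∈ s} = P.real s ^ 2 := by
  have h1 : {z : ι → X | z i ∈ s ∧ z j ∈ s} =
      Set.univ.pi fun k => if k ∈ ({i, j} : Finset ι) then s else Set.univ := by
    ext z
    simp only [Set.mem_ofPred_eq, Set.mem_univ_pi]
    constructor
    · rintro ⟨h1, h2⟩ k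
      split_ifs with hk
      · rcases Finset.mem_insert.1 hk with rfl | hk
        · exact h1
        · rw [Finset.mem_singleton.1 hk]; exact h2
      · trivial
    · intro h
      exact ⟨by simpa using h i, by simpa using h j⟩
  rw [h1, measureReal_def, Measure.pi_pi, ENNReal.toReal_prod]
  have h2 : ∀ k, (P (if k ∈ ({i, j} : Finset ι) then s else Set.univ)).toReal =
      if k ∈ ({i, j} : Finset ι) then P.real s else 1 := by
    intro k
    split_ifs <;> simp [measureReal_def]
  simp_rw [h2]
  rw [Finset.prod_ite_mem, Finset.univ_inter, Finset.prod_const, Finset.card_pair hij]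

/-- Anticoncentration of a sum of independent vectors `τ (y j) • x j` at a scale comparable to its
standard deviation, when the `x j` satisfy Bessel's inequality. -/
theorem measureReal_ball_sum_le_of_bessel [Fintype ι] (μ : Measure ℂ) [IsProbabilityMeasure μ]
    {τ : ℂ → ℂ} {κ : ℝ} (hκ : 0 < κ) (hτ : ∀ y y', ‖τ y - τ y'‖ = κ * ‖y - y'‖) {x : ι → H}
    (hB : ∀ v, ∑ j, ‖⟪v, x j⟫_ℂ‖ ^ 2 ≤ ‖v‖ ^ 2) {G : Finset ι} {W c t b β ρ D : ℝ} (hW : 0 < W)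
    (hG : ∀ j ∈ G, W ≤ ‖x j‖) (hD : ∑ j, ‖x j‖ ^ 2 ≤ D) (hc : 0 < c)
    (hβ : β ≤ (μ.prod μ).real {z | c ≤ ‖z.1 - z.2‖ ∧ ‖z.1 - z.2‖ ≤ t})
    (hb : (μ.prod μ).real {z | c ≤ ‖z.1 - z.2‖ ∧ ‖z.1 - z.2‖ ≤ t} ≤ b) {N : ℕ} (hN : 1 ≤ N)
    (hρ : 2 * ρ ^ 2 ≤ N * (κ * c * W / 2) ^ 2) (v : H) {E : Set (ι → ℂ)} (hE : MeasurableSet E)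
    (hEv : ∀ y ∈ E, ‖∑ j, τ (y j) • x j - v‖ ≤ ρ) :
    (Measure.pi fun _ : ι => μ).real E ≤ Real.exp (N - (1 - Real.exp (-1)) * β * G.card) +
      (16 * ((t / c) ^ 2 / (N * W ^ 2)) + 8 * ((t / c) ^ 4 * (b ^ 2 * D) / (N * W ^ 2) ^ 2)) := by
  classical
  let P : Measure (ι → ℂ × ℂ) := Measure.pi fun _ => μ.prod μ
  let s : Set (ℂ × ℂ) := {z | c ≤ ‖z.1 - z.2‖ ∧ ‖z.1 - z.2‖ ≤ t}
  have hs : MeasurableSet s := by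
    have hm : Measurable fun z : ℂ × ℂ => ‖z.1 - z.2‖ := by fun_prop
    exact hm measurableSet_Icc
  let A : Set (ι → ℂ × ℂ) := {z | (G.filter fun j => z j ∈ s).card < N}
  have hA : MeasurableSet A := measurableSet_card_filter_lt hs G N
  have hind : ∀ {S : Set (ι → ℂ × ℂ)}, MeasurableSet S →
      Integrable (S.indicator (1 : (ι → ℂ × ℂ) → ℝ)) P := fun hS =>
    (integrable_const (1 : ℝ)).indicator hS
  set a : ℝ := κ * t / 2 with ha
  set M : ℝ := N * (κ * c * W / 2) ^ 2 with hM
  have hN0 : (0 : ℝ) < N := by exact_mod_cast hN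
  have hM0 : 0 < M := by positivity
  let S : ι → ι → Set (ι → ℂ × ℂ) := fun i j => {z | z i ∈ s ∧ z j ∈ s}
  have hS : ∀ i j, MeasurableSet (S i j) := fun i j =>
    (hs.preimage (measurable_pi_apply i)).inter (hs.preimage (measurable_pi_apply j))
  let Q : (ι → ℂ × ℂ) → ℝ := fun z => ∑ i, ∑ j,
    (if i = j then 0 else ‖⟪x i, x j⟫_ℂ‖ ^ 2) * (S i j).indicator 1 z
  have hQi : Integrable Q P := integrable_finsetSum _ fun i _ => integrable_finsetSum _ fun j _ =>
    (hind (hS i j)).const_mul _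
  have hQint : ∫ z, Q z ∂P ≤ b ^ 2 * D := by
    rw [integral_finsetSum _ fun i _ => integrable_finsetSum _ fun j _ =>
      (hind (hS i j)).const_mul _]
    calc _ ≤ ∑ i, b ^ 2 * ‖x i‖ ^ 2 := by
          refine Finset.sum_le_sum fun i _ => ?_
          rw [integral_finsetSum _ fun j _ => (hind (hS i j)).const_mul _]
          refine le_trans ?_ (mul_le_mul_of_nonneg_left (hB (x i)) (sq_nonneg b))
          rw [Finset.mul_sum]
          refine Finset.sum_le_sum fun j _ => ?_
          rw [integral_const_mul, integral_indicator_one (hS i j)]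
          by_cases hij : i = j
          · rw [if_pos hij, zero_mul]; positivity
          · rw [if_neg hij, mul_comm]
            gcongr
            rw [measureReal_pi_pair _ s hij]
            exact pow_le_pow_left₀ measureReal_nonneg hb 2
      _ ≤ _ := by
          rw [← Finset.mul_sum]
          gcongr
  refine (measureReal_le_integral_of_card_selection_le μ hE
    (F := fun z => A.indicator 1 z + (16 * (a ^ 2 / M) + 8 * a ^ 4 / M ^ 2 * Q z))
    ((hind hA).add ((integrable_const _).add (hQi.const_mul _))) ?_).trans ?_
  · intro z
    have hQ0 : 0 ≤ Q z := Finset.sum_nonneg fun i _ => Finset.sum_nonneg fun j _ =>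
      mul_nonneg (by split_ifs <;> positivity) (Set.indicator_nonneg (fun _ _ => zero_le_one) _)
    by_cases hz : z ∈ A
    · have h1 : ((Finset.univ.filter fun T : Finset ι =>
          (fun i => if i ∈ T then (z i).2 else (z i).1) ∈ E).card : ℝ) ≤
          2 ^ Fintype.card ι := by
        have := Finset.card_le_univ (Finset.univ.filter fun T : Finset ι =>
          (fun i => if i ∈ T then (z i).2 else (z i).1) ∈ E)
        rw [Fintype.card_finset] at this
        exact_mod_cast this
      refine h1.trans (le_mul_of_one_le_right (by positivity) ?_)
      rw [Set.indicator_of_mem hz]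
      simp only [Pi.one_apply]
      have : 0 ≤ 16 * (a ^ 2 / M) + 8 * a ^ 4 / M ^ 2 * Q z := by positivity
      linarith
    · rw [Set.indicator_of_notMem hz, zero_add]
      set J := G.filter fun j => z j ∈ s with hJ
      have hJN : N ≤ J.card := by simpa [A] using hz
      refine card_filter_le_of_forall_inter J _ fun T₁ => ?_
      let α : ι → ℂ := fun j => (τ (z j).2 - τ (z j).1) / 2
      let v' : H := ∑ j, (if j ∈ J then ((τ (z j).2 + τ (z j).1) / 2) • x j else
        τ (if j ∈ T₁ then (z j).2 else (z j).1) • x j) - v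
      have hα : ∀ j, ‖α j‖ = κ * ‖(z j).1 - (z j).2‖ / 2 := by
        intro j
        simp only [α]
        rw [norm_div, hτ, norm_sub_rev]
        simp
      have hterm : ∀ i j, 0 ≤ (if i = j then 0 else ‖⟪x i, x j⟫_ℂ‖ ^ 2) *
          (S i j).indicator (1 : (ι → ℂ × ℂ) → ℝ) z := fun i j =>
        mul_nonneg (by split_ifs <;> positivity)
          (Set.indicator_nonneg (fun _ _ => zero_le_one) _)
      have hQJ : (∑ i ∈ J, ∑ j ∈ J, if i = j then 0 else ‖⟪x i, x j⟫_ℂ‖ ^ 2) ≤ Q z := by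
        calc _ = ∑ i ∈ J, ∑ j ∈ J, (if i = j then 0 else ‖⟪x i, x j⟫_ℂ‖ ^ 2) *
              (S i j).indicator (1 : (ι → ℂ × ℂ) → ℝ) z := by
              refine Finset.sum_congr rfl fun i hi => Finset.sum_congr rfl fun j hj => ?_
              have : z ∈ S i j := ⟨(Finset.mem_filter.1 hi).2, (Finset.mem_filter.1 hj).2⟩
              rw [Set.indicator_of_mem this, Pi.one_apply, mul_one]
          _ ≤ ∑ i ∈ J, ∑ j, (if i = j then 0 else ‖⟪x i, x j⟫_ℂ‖ ^ 2) *
              (S i j).indicator (1 : (ι → ℂ × ℂ) → ℝ) z :=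
              Finset.sum_le_sum fun i _ => Finset.sum_le_univ_sum_of_nonneg fun j => hterm i j
          _ ≤ _ := Finset.sum_le_univ_sum_of_nonneg fun i =>
              Finset.sum_nonneg fun j _ => hterm i j
      have hmain := card_filter_norm_signedSum_le (x := x) (α := α) (v := v') (J := J) (a := a)
        (M := M) (Q := Q z) (ρ := ρ)
        ((Finset.sum_le_univ_sum_of_nonneg fun j => sq_nonneg _).trans (hB v')) (by
          intro j hj
          rw [hα, ha]
          have := (Finset.mem_filter.1 hj).2.2
          gcongr) hM0 (by
          have h1 : ∀ j ∈ J, (κ * c * W / 2) ^ 2 ≤ ‖α j • x j‖ ^ 2 := by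
            intro j hj
            refine pow_le_pow_left₀ (by positivity) ?_ 2
            rw [norm_smul, hα]
            have h2 := (Finset.mem_filter.1 hj).2.1
            have h3 := hG j (Finset.mem_filter.1 hj).1
            calc κ * c * W / 2 = κ * c / 2 * W := by ring
              _ ≤ _ := by gcongr
          refine le_trans ?_ (Finset.sum_le_sum h1)
          rw [Finset.sum_const, nsmul_eq_mul, hM]
          gcongr) hQJ hρ
      refine le_trans ?_ (hmain.trans (le_of_eq (by ring)))
      rw [Nat.cast_le]
      refine Finset.card_le_card fun T hT => ?_
      simp only [Finset.mem_filter] at hT ⊢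
      refine ⟨hT.1, ?_⟩
      have hTJ := Finset.mem_powerset.1 hT.1
      have h5 : signedSum v' (fun j => α j • x j) J T =
          ∑ j, τ (if j ∈ T₁ \ J ∪ T then (z j).2 else (z j).1) • x j - v := by
        rw [signedSum, ← Finset.univ_inter J, ← Finset.sum_ite_mem, sub_add_eq_add_sub,
          ← Finset.sum_add_distrib]
        congr 1
        refine Finset.sum_congr rfl fun j _ => ?_
        rw [Finset.univ_inter]
        by_cases hj : j ∈ J
        · by_cases hjT : j ∈ T
          · simp only [hj, hjT, if_true, α, Finset.mem_union, or_true]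
            rw [← add_smul]
            congr 1
            ring
          · simp only [hj, hjT, if_true, if_false, α, Finset.mem_union, Finset.mem_sdiff,
              not_true, and_false, or_false]
            rw [← neg_smul, ← add_smul]
            congr 1
            ring
        · have hjT : j ∉ T := fun h => hj (hTJ h)
          simp [hj, hjT]
      rw [h5]
      exact hEv _ hT.2
  · have h8 : Integrable (fun z => 16 * (a ^ 2 / M) + 8 * a ^ 4 / M ^ 2 * Q z) P :=
      (integrable_const _).add (hQi.const_mul _)
    have h9 : ∫ z, 16 * (a ^ 2 / M) + 8 * a ^ 4 / M ^ 2 * Q z ∂P =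
        16 * (a ^ 2 / M) + 8 * a ^ 4 / M ^ 2 * ∫ z, Q z ∂P := by
      rw [integral_add (integrable_const _) (hQi.const_mul _)]
      congr 1
      · simp
      · exact integral_const_mul _ _
    rw [integral_add (hind hA) h8, integral_indicator_one hA, h9]
    have h10 := measureReal_card_filter_lt_le (μ.prod μ) hs hβ G N
    refine add_le_add h10 (add_le_add (le_of_eq ?_) ?_)
    · rw [ha, hM]
      field_simp
    · calc 8 * a ^ 4 / M ^ 2 * ∫ z, Q z ∂P ≤ 8 * a ^ 4 / M ^ 2 * (b ^ 2 * D) := by gcongr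
        _ = _ := by
          rw [ha, hM]
          field_simp

end SecondMoment

/-! ### Approximate kernels of the blocks -/

section BlockKernel

open Module InnerProductSpace

variable {κ : Type*} [Fintype κ]

/-- A coordinate hyperplane cuts the dimension of a subspace by at most one. -/
theorem exists_submodule_coord_eq_zero (H : Submodule ℂ (EuclideanSpace ℂ κ)) (e : κ) :
    ∃ H' ≤ H, (∀ u ∈ H', u e = 0) ∧ finrank ℂ H ≤ finrank ℂ H' + 1 := by
  let f : EuclideanSpace ℂ κ →ₗ[ℂ] ℂ := (EuclideanSpace.proj e : EuclideanSpace ℂ κ →L[ℂ] ℂ)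
  refine ⟨H ⊓ LinearMap.ker f, inf_le_left, fun u hu => (Submodule.mem_inf.1 hu).2, ?_⟩
  have h1 := Submodule.finrank_sup_add_finrank_inf_eq H (LinearMap.ker f)
  have h2 := LinearMap.finrank_range_add_finrank_ker f
  have h3 : finrank ℂ (LinearMap.range f) ≤ 1 := by
    simpa using Submodule.finrank_le (LinearMap.range f)
  have h4 := Submodule.finrank_le (H ⊔ LinearMap.ker f)
  omega

variable [DecidableEq κ]

theorem norm_coordProj_le_of_le {H' H : Submodule ℂ (EuclideanSpace ℂ κ)} (h : H' ≤ H) (j : κ) :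
    ‖coordProj H' j‖ ≤ ‖coordProj H j‖ := by
  have h1 : coordProj H' j = H'.starProjection (coordProj H j) := by
    rw [coordProj, coordProj, ← ContinuousLinearMap.comp_apply,
      Submodule.starProjection_comp_starProjection_of_le h]
  rw [h1]
  exact H'.norm_starProjection_apply_le _

theorem inner_coordProj (H : Submodule ℂ (EuclideanSpace ℂ κ)) (v : EuclideanSpace ℂ κ) (j : κ) :
    ⟪v, coordProj H j⟫_ℂ = star (H.starProjection v j) := by
  rw [coordProj, ← Submodule.inner_starProjection_left_eq_right,
    EuclideanSpace.inner_single_right]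
  simp

theorem sum_norm_sq_inner_coordProj_le (H : Submodule ℂ (EuclideanSpace ℂ κ))
    (v : EuclideanSpace ℂ κ) : ∑ j, ‖⟪v, coordProj H j⟫_ℂ‖ ^ 2 ≤ ‖v‖ ^ 2 := by
  simp_rw [inner_coordProj, norm_star]
  rw [← EuclideanSpace.norm_sq_eq]
  exact pow_le_pow_left₀ (norm_nonneg _) (H.norm_starProjection_apply_le v) 2

theorem coordProj_eq_zero {H : Submodule ℂ (EuclideanSpace ℂ κ)} {e : κ} (h : ∀ u ∈ H, u e = 0) :
    coordProj H e = 0 := by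
  have h1 : ⟪coordProj H e, coordProj H e⟫_ℂ = 0 := by
    rw [inner_coordProj, h _ (Submodule.starProjection_apply_mem _ _), star_zero]
  exact inner_self_eq_zero.1 h1

theorem shiftedMatrix_apply {n : ℕ} (A : Fin n → Fin n → ℂ) (d : ℝ) (z : ℂ) (i j : Fin n) :
    shiftedMatrix A d z i j = (((√d)⁻¹ : ℝ) : ℂ) * A i j - if i = j then z else 0 := by
  simp [shiftedMatrix, Matrix.sub_apply, Matrix.smul_apply, Matrix.one_apply]

theorem norm_shiftedMatrix_apply_le {n : ℕ} (A : Fin n → Fin n → ℂ) {d : ℝ} (hd : 1 ≤ d) (z : ℂ)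
    (i j : Fin n) : ‖shiftedMatrix A d z i j‖ ≤ ‖A i j‖ + if i = j then ‖z‖ else 0 := by
  rw [shiftedMatrix_apply]
  refine (norm_sub_le _ _).trans (add_le_add ?_ ?_)
  · rw [norm_mul, Complex.norm_real, norm_inv, Real.norm_of_nonneg (Real.sqrt_nonneg _)]
    refine mul_le_of_le_one_left (norm_nonneg _) (inv_le_one_of_one_le₀ ?_)
    rwa [Real.one_le_sqrt]
  · split_ifs <;> simp

/-- Expansion of the sparse pattern makes column sets of the blocks peelable: the diagonal entry
`-z` serves as the isolated entry of a row that vanishes on the column set. -/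
theorem exists_peelable_of_expanding {n a b L : ℕ} {A : Fin n → Fin n → ℂ} {c d c' Q : ℝ} {z : ℂ}
    (hn : n ≤ 2 * a) (hab : b ≤ a + 1) (hd : 1 ≤ d) (hz : c' ≤ ‖z‖)
    (hc : c' ≤ (√d)⁻¹ * c) {S S₁ : Finset {j : Fin n // (j : ℕ) < b}} (hS : 1 ≤ S.card)
    (hSL : S.card ≤ L) (hQ : n * d / S.card + ‖z‖ ≤ Q) (h0 : Expanding A c d L ∅)
    (he : (∀ j ∈ S, (j : ℕ) < a) ∨ ∃ e : Fin n, (e : ℕ) = a ∧ Expanding A c d L {e})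
    (hS₁ : S₁ ⊆ S) (hθ : (1 - peelRate n S.card) * S.card ≤ S₁.card) :
    ∃ j ∈ S₁, Peelable (leadingBlock (shiftedMatrix A d z) a b) c' Q S j := by
  classical
  let S' := S.map (Function.Embedding.subtype _)
  let S₁' := S₁.map (Function.Embedding.subtype _)
  have hS'c : S'.card = S.card := Finset.card_map _
  have hmem : ∀ {j : {j : Fin n // (j : ℕ) < b}}, (j : Fin n) ∈ S' ↔ j ∈ S := fun {j} => by
    simpa [S'] using fun _ => j.2
  have hsum : ∀ (i : {i : Fin n // (i : ℕ) < a}), ∑ j ∈ S'ᶜ, ‖A i j‖ ≤ n * d / S.card →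
      ∑ j ∈ Sᶜ, ‖leadingBlock (shiftedMatrix A d z) a b i j‖ ≤ Q := by
    intro i hi
    refine le_trans ?_ hQ
    calc _ ≤ ∑ j ∈ Sᶜ, (‖A i j‖ + if (i : Fin n) = j then ‖z‖ else 0) :=
          Finset.sum_le_sum fun j _ => norm_shiftedMatrix_apply_le A hd z i j
      _ = ∑ j ∈ Sᶜ.map (Function.Embedding.subtype _),
          (‖A i j‖ + if (i : Fin n) = j then ‖z‖ else 0) := by
          rw [Finset.sum_map]; rfl
      _ ≤ ∑ j ∈ S'ᶜ, (‖A i j‖ + if (i : Fin n) = j then ‖z‖ else 0) := by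
          refine Finset.sum_le_sum_of_subset_of_nonneg (fun j hj => ?_) fun j _ _ => by
            split_ifs <;> positivity
          obtain ⟨j', hj', rfl⟩ := Finset.mem_map.1 hj
          exact Finset.mem_compl.2 fun h => (Finset.mem_compl.1 hj') (hmem.1 h)
      _ ≤ _ := by
          rw [Finset.sum_add_distrib]
          refine add_le_add hi ?_
          rw [Finset.sum_ite_eq]
          split_ifs
          · exact le_rfl
          · exact norm_nonneg _
  have key : ∀ E : Finset (Fin n), E ⊆ S' → (∀ i ∈ S₁' \ E, (i : ℕ) < a) → Expanding A c d L E →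
      ∃ j ∈ S₁, Peelable (leadingBlock (shiftedMatrix A d z) a b) c' Q S j := by
    intro E hES hE hexp
    have hS₁' : S₁' ⊆ S' := Finset.map_subset_map.2 hS₁
    rcases hexp S' hES (by rw [hS'c]; exact hS) (by rw [hS'c]; exact hSL) S₁' hS₁' (by
      rw [hS'c, Finset.card_map]; exact hθ) with ⟨i, hi, hrow⟩ | ⟨i, hi, hiS, hrow⟩
    · have hia := hE i hi
      obtain ⟨j, hj, rfl⟩ := Finset.mem_map.1 (Finset.mem_sdiff.1 hi).1
      rw [hS'c] at hrow
      refine ⟨j, hj, ⟨j, hia⟩, ?_, fun j' hj' hne => ?_, hsum ⟨j, hia⟩ hrow.2⟩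
      · change c' ≤ ‖shiftedMatrix A d z j j‖
        have h1 : A j j = 0 := hrow.1 _ (hmem.2 (hS₁ hj))
        rw [shiftedMatrix_apply, h1]
        simpa using hz
      · change shiftedMatrix A d z j j' = 0
        have h1 : A j j' = 0 := hrow.1 _ (hmem.2 hj')
        have h2 : (j : Fin n) ≠ j' := fun h => hne (Subtype.ext h.symm)
        rw [shiftedMatrix_apply, h1, if_neg h2]
        simp
    · obtain ⟨j₀, hj₀, hcj, hzero, hs⟩ := hrow
      obtain ⟨j, hj, rfl⟩ := Finset.mem_map.1 hj₀
      rw [hS'c] at hs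
      have hia : (i : ℕ) < a := by omega
      refine ⟨j, hj, ⟨i, hia⟩, ?_, fun j' hj' hne => ?_, hsum ⟨i, hia⟩ hs⟩
      · change c' ≤ ‖shiftedMatrix A d z i j‖
        have h2 : i ≠ (j : Fin n) := fun h => hiS (h ▸ hmem.2 (hS₁ hj))
        rw [shiftedMatrix_apply, if_neg h2, sub_zero, norm_mul, Complex.norm_real, norm_inv,
          Real.norm_of_nonneg (Real.sqrt_nonneg _)]
        refine hc.trans ?_
        gcongr
        exact hcj
      · change shiftedMatrix A d z i j' = 0
        have h1 : A i j' = 0 := hzero _ (hmem.2 hj') fun h => hne (Subtype.ext h)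
        have h2 : i ≠ (j' : Fin n) := fun h => hiS (h ▸ hmem.2 hj')
        rw [shiftedMatrix_apply, h1, if_neg h2]
        simp
  have hlt : ∀ {T : Finset {j : Fin n // (j : ℕ) < b}} {i : Fin n},
      i ∈ T.map (Function.Embedding.subtype _) → (i : ℕ) < b := fun {T i} hi => by
    obtain ⟨j, -, rfl⟩ := Finset.mem_map.1 hi
    exact j.2
  by_cases hS' : ∀ j ∈ S, (j : ℕ) < a
  · refine key ∅ (Finset.empty_subset _) (fun i hi => ?_) h0
    obtain ⟨j, hj, rfl⟩ := Finset.mem_map.1 (Finset.mem_sdiff.1 hi).1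
    exact hS' j (hS₁ hj)
  · obtain ⟨e, hea, hE⟩ := he.resolve_left hS'
    push Not at hS'
    obtain ⟨j, hj, hja⟩ := hS'
    have hje : (j : Fin n) = e := Fin.ext (by have := j.2; omega)
    refine key {e} ?_ (fun i hi => ?_) hE
    · rw [Finset.singleton_subset_iff, ← hje]
      exact hmem.2 hj
    · have h1 := hlt (Finset.mem_sdiff.1 hi).1
      have h2 : i ≠ e := fun h => (Finset.mem_sdiff.1 hi).2 (by simp [h])
      have h3 : (i : ℕ) ≠ e := fun h => h2 (Fin.ext h)
      omega

theorem peelRate_le_peelRate {n s s' : ℝ} (hn : 0 < n) (hs : 0 < s) (hss : s ≤ s')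
    (hs' : s' ≤ n) : peelRate n s ≤ peelRate n s' := by
  unfold peelRate
  have h1 : Real.log (n / s') ≤ Real.log (n / s) :=
    Real.log_le_log (div_pos hn (hs.trans_le hss)) (by gcongr)
  have h2 : 0 ≤ Real.log (n / s') := Real.log_nonneg ((one_le_div (hs.trans_le hss)).2 hs')
  exact one_div_le_one_div_of_le (by linarith) (by linarith)

/-- On the expansion event, an approximate kernel of a block has many large coordinate
projections. The coordinate of the last column is treated apart, as it has no row of its own when
`b = a + 1`. -/
theorem lt_card_filter_coordProj {n a b L : ℕ} {A : Fin n → Fin n → ℂ} {c d c' τ W q : ℝ} {z : ℂ}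
    (hn0 : 0 < n) (hn : n ≤ 2 * a) (hab : b ≤ a + 1) (hbn : b ≤ n) (hd : 1 ≤ d) (hc'0 : 0 < c')
    (hz : c' ≤ ‖z‖) (hc : c' ≤ (√d)⁻¹ * c) {H : Submodule ℂ (EuclideanSpace ℂ {j : Fin n // (j : ℕ) < b})}
    (hH : 1 ≤ finrank ℂ H) (hτ0 : 0 ≤ τ) (hτW : τ ≤ W)
    (hτ : ∀ u ∈ H, ‖Matrix.toEuclideanLin (leadingBlock (shiftedMatrix A d z) a b) u‖ ≤ τ * ‖u‖)
    (hq1 : 1 ≤ q) (hq : 1 + (4 * (n * d / finrank ℂ H) + ‖z‖) ≤ q * c') (h0 : Expanding A c d L ∅)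
    (he : b ≤ a ∨ 2 ≤ finrank ℂ H ∨ ∃ e : Fin n, (e : ℕ) = a ∧ Expanding A c d L {e}) {D : ℕ}
    (hD : (1 - peelRate n (finrank ℂ H / 4)) ^ D * L < (finrank ℂ H : ℝ) / 4)
    (hDW : n * (W * q ^ D) ^ 2 ≤ (finrank ℂ H : ℝ) / 4) :
    L < (Finset.univ.filter fun j => W < ‖coordProj H j‖).card := by
  -- otherwise the large projections are confined to `L` columns, and peeling these makes all
  -- projections too small for the dimension of `H`
  by_contra! hcard
  set h : ℝ := (finrank ℂ H : ℝ) with hh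
  have hh1 : 1 ≤ h := by rw [hh]; exact_mod_cast hH
  have hn0' : (0 : ℝ) < n := by exact_mod_cast hn0
  have hcardκ : Fintype.card {j : Fin n // (j : ℕ) < b} ≤ n := by
    simpa using Fintype.card_subtype_le fun j : Fin n => (j : ℕ) < b
  have hhn : h ≤ n := by
    have := (Submodule.finrank_le H).trans (by simpa using hcardκ)
    rw [hh]; exact_mod_cast this
  have hθ0 := peelRate_props (n := n) (s := h / 4) (by positivity) (by linarith)
  -- it is enough to work with a subspace of at least half the dimension
  obtain ⟨H', hH'le, hdim, hlast⟩ : ∃ H' ≤ H, h / 2 ≤ finrank ℂ H' ∧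
      ((∀ j : {j : Fin n // (j : ℕ) < b}, a ≤ (j : ℕ) → coordProj H' j = 0) ∨
        ∃ e : Fin n, (e : ℕ) = a ∧ Expanding A c d L {e}) := by
    by_cases hba : b ≤ a
    · exact ⟨H, le_rfl, by linarith, Or.inl fun j hj => absurd j.2 (by omega)⟩
    rcases he.resolve_left hba with h2 | hE
    · have hba' : b = a + 1 := by omega
      obtain ⟨H', h1, h2', h3⟩ := exists_submodule_coord_eq_zero H
        (⟨⟨a, by omega⟩, by simp; omega⟩ : {j : Fin n // (j : ℕ) < b})
      refine ⟨H', h1, ?_, Or.inl fun j hj => ?_⟩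
      · have h3' : h ≤ finrank ℂ H' + 1 := by rw [hh]; exact_mod_cast h3
        have h2'' : (2 : ℝ) ≤ h := by rw [hh]; exact_mod_cast h2
        linarith
      · have : j = ⟨⟨a, by omega⟩, by simp; omega⟩ := by
          have := j.2
          exact Subtype.ext (Fin.ext (by simp; omega))
        rw [this]
        exact coordProj_eq_zero h2'
    · exact ⟨H, le_rfl, by linarith, Or.inr hE⟩
  set S₀ : Finset {j : Fin n // (j : ℕ) < b} := Finset.univ.filter fun j => W < ‖coordProj H' j‖
    with hS₀
  have hS₀L : S₀.card ≤ L := (Finset.card_le_card fun j hj => by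
    simp only [hS₀, Finset.mem_filter, Finset.mem_univ, true_and] at hj ⊢
    exact hj.trans_le (norm_coordProj_le_of_le hH'le j)).trans hcard
  have hW0 : 0 ≤ W := hτ0.trans hτW
  have hmain := finrank_half_lt_of_peelable (B := leadingBlock (shiftedMatrix A d z) a b) (H := H')
    (c := c') (Q := 4 * (n * d / h) + ‖z‖) (θ := peelRate n (h / 4)) (S₀ := S₀) (D := D)
    hτ0 hτW (fun u hu => hτ u (hH'le hu))
    (fun j hj => not_lt.1 fun h => hj (Finset.mem_filter.2 ⟨Finset.mem_univ _, h⟩)) hc'0 hq1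
    hq (by linarith [hθ0.2.1]) (by
      intro S hS hSk S₁ hS₁ hcard₁
      have hs4 : h / 4 ≤ S.card := by linarith
      have hs1 : 1 ≤ S.card := by
        rw [Nat.one_le_iff_ne_zero]
        intro h0
        rw [h0, Nat.cast_zero] at hs4
        linarith
      have hsn : (S.card : ℝ) ≤ n := by
        exact_mod_cast (Finset.card_le_univ S).trans hcardκ
      have hs0 : (0 : ℝ) < S.card := by exact_mod_cast hs1
      refine exists_peelable_of_expanding hn hab hd hz hc hs1 ((Finset.card_le_card hS).trans hS₀L)
        ?_ h0 ?_ hS₁ (le_trans ?_ hcard₁)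
      · gcongr
        rw [div_le_iff₀ hs0]
        calc (n : ℝ) * d = n * d / h * h := by field_simp
          _ ≤ n * d / h * (4 * S.card) := by
              gcongr
              linarith
          _ = _ := by ring
      · refine hlast.imp_left fun hl j hj => ?_
        by_contra! hja
        have := (Finset.mem_filter.1 (hS hj)).2
        rw [hl j hja, norm_zero] at this
        linarith
      · gcongr
        exact peelRate_le_peelRate hn0' (by positivity) hs4 hsn) (by
      refine lt_of_le_of_lt ?_ (hD.trans_le (by linarith))
      have : 0 ≤ 1 - peelRate n (h / 4) := by linarith [hθ0.2.1]
      gcongr)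
  have h5 : (Fintype.card {j : Fin n // (j : ℕ) < b} : ℝ) * (W * q ^ D) ^ 2 ≤
      n * (W * q ^ D) ^ 2 := by
    gcongr
  linarith

end BlockKernel

/-! ### Resampling and the drift of the height -/

section Drift

open scoped ENNReal

variable {Ω Y : Type*} [MeasurableSpace Ω] [MeasurableSpace Y] {μ : Measure Ω} {P : Measure Y}
  [IsProbabilityMeasure P]

/-- If `R` resamples part of `A` without changing the law, and `f` does not depend on that part, then
conditional bounds for the probability of `D` integrate against `f`. -/
theorem lintegral_mul_indicator_le [SFinite μ] {R : Ω → Y → Ω}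
    (hR : MeasurePreserving (fun z : Ω × Y => R z.1 z.2) (μ.prod P) μ) {f : Ω → ℝ≥0∞}
    (hf : Measurable f) (hfR : ∀ A y, f (R A y) = f A) {D : Set Ω} (hD : MeasurableSet D) {q : ℝ≥0∞}
    (hq : ∀ A, f A ≠ 0 → P {y | R A y ∈ D} ≤ q) :
    ∫⁻ A, f A * D.indicator 1 A ∂μ ≤ q * ∫⁻ A, f A ∂μ := by
  have hm : Measurable fun A => f A * D.indicator (1 : Ω → ℝ≥0∞) A :=
    hf.mul (measurable_one.indicator hD)
  have h0 : ∫⁻ z, f (R z.1 z.2) * D.indicator (1 : Ω → ℝ≥0∞) (R z.1 z.2) ∂(μ.prod P) =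
      ∫⁻ A, ∫⁻ y, f (R A y) * D.indicator (1 : Ω → ℝ≥0∞) (R A y) ∂P ∂μ :=
    lintegral_prod _ (hm.comp hR.measurable).aemeasurable
  rw [← hR.lintegral_comp hm, h0, ← lintegral_const_mul _ hf]
  refine lintegral_mono fun A => ?_
  simp only [hfR]
  have h1 : Measurable fun y => D.indicator (1 : Ω → ℝ≥0∞) (R A y) :=
    ((measurable_one.indicator hD).comp hR.measurable).comp measurable_prodMk_left
  rw [lintegral_const_mul _ h1]
  have h2 : ∫⁻ y, D.indicator (1 : Ω → ℝ≥0∞) (R A y) ∂P = P {y | R A y ∈ D} := by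
    rw [← lintegral_indicator_one]
    · rfl
    · exact (hD.preimage hR.measurable).preimage measurable_prodMk_left
  rw [h2]
  by_cases h0 : f A = 0
  · simp [h0]
  · rw [mul_comm]
    gcongr
    exact hq A h0

theorem measurable_measure_resample {R : Ω → Y → Ω} [SFinite μ]
    (hR : MeasurePreserving (fun z : Ω × Y => R z.1 z.2) (μ.prod P) μ) {D : Set Ω}
    (hD : MeasurableSet D) : Measurable fun A => P {y | R A y ∈ D} :=
  measurable_measure_prodMk_left (hD.preimage hR.measurable)

/-- A height `g` that goes down by one unless the rare event `D k` occurs, and up by at most one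
otherwise, is unlikely to end at `2` or more. The conditional probability of `D k` needs to be small
only at those times when the height is not negligible against the remaining time. -/
theorem measure_two_le_height_le [IsProbabilityMeasure μ] {R : ℕ → Ω → Y → Ω}
    (hR : ∀ k, MeasurePreserving (fun z : Ω × Y => R k z.1 z.2) (μ.prod P) μ)
    {rel : ℕ → Ω → Ω → Prop} (hrel : ∀ k A A', rel (k + 1) A A' → rel k A A')
    (hrelR : ∀ k A y, rel k (R k A y) A)
    (hrelR' : ∀ k A A' y, rel k A A' → rel (k + 1) (R k A y) (R k A' y))
    {g : ℕ → Ω → ℕ} (hg : ∀ k, Measurable (g k)) (hgrel : ∀ k A A', rel k A A' → g k A = g k A')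
    {D : ℕ → Set Ω} (hD : ∀ k, MeasurableSet (D k))
    (hDrel : ∀ k A A', rel (k + 1) A A' → (A ∈ D k ↔ A' ∈ D k))
    {V : Set Ω} (hV : MeasurableSet V) (hVrel : ∀ A A', rel 0 A A' → (A ∈ V ↔ A' ∈ V)) {K G : ℕ}
    (hstep : ∀ k < K, ∀ A ∈ V, g (k + 1) A ≤ g k A + 1)
    (hdown : ∀ k < K, ∀ A ∈ V, A ∉ D k → g (k + 1) A + 1 ≤ g k A) (hG : ∀ A, g 0 A ≤ G)
    {y q : ℝ≥0∞} (hy : 2 ≤ y) (hq : y ^ 20 * q ≤ 1) :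
    y ^ (10 * K + 20) * μ {A | A ∈ V ∧ 2 ≤ g K A ∧
        ∀ k < K, K ≤ k + 10 * g k A → P {w | R k A w ∈ D k} ≤ q} ≤
      2 ^ K * y ^ (10 * G) + 2 * y ^ (10 * K + 10) := by
  have hy1 : 1 ≤ y := le_trans (by norm_num) hy
  let good : ℕ → Set Ω := fun k =>
    {A | A ∈ V ∧ ∀ j < k, K ≤ j + 10 * g j A → P {w | R j A w ∈ D j} ≤ q}
  have hrel0 : ∀ {j k : ℕ}, j ≤ k → ∀ {A A'}, rel k A A' → rel j A A' := by
    intro j k hjk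
    induction k, hjk using Nat.le_induction with
    | base => exact fun h => h
    | succ k _ ih => exact fun h => ih (hrel k _ _ h)
  have hcp : ∀ k A A', rel k A A' → P {w | R k A w ∈ D k} = P {w | R k A' w ∈ D k} := by
    intro k A A' h
    congr 1
    ext w
    exact hDrel k _ _ (hrelR' k _ _ w h)
  have hgood : ∀ k A A', rel k A A' → (A ∈ good (k + 1) ↔ A' ∈ good (k + 1)) := by
    intro k A A' h
    refine and_congr (hVrel _ _ (hrel0 (Nat.zero_le k) h)) (forall_congr' fun j => ?_)
    refine forall_congr' fun hj => ?_
    have hj' := hrel0 (Nat.lt_succ_iff.1 hj) h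
    rw [hgrel j _ _ hj', hcp j _ _ hj']
  have hgoodm : ∀ k, MeasurableSet (good k) := by
    intro k
    have : good k = V ∩ ⋂ j, ⋂ _ : j < k,
        ({A | K ≤ j + 10 * g j A}ᶜ ∪ {A | P {w | R j A w ∈ D j} ≤ q}) := by
      ext A
      simp only [good, Set.mem_ofPred_eq, Set.mem_inter_iff, Set.mem_iInter, Set.mem_union,
        Set.mem_compl_iff, imp_iff_not_or]
    rw [this]
    refine hV.inter (MeasurableSet.iInter fun j => MeasurableSet.iInter fun _ =>
      MeasurableSet.union (MeasurableSet.compl ?_) ?_)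
    · exact measurableSet_le measurable_const (measurable_const.add ((hg j).const_mul 10))
    · exact measurableSet_le (measurable_measure_resample (hR j) (hD j)) measurable_const
  have hgoodle : ∀ k, good (k + 1) ⊆ good k := fun k A hA =>
    ⟨hA.1, fun j hj => hA.2 j (hj.trans (Nat.lt_succ_self k))⟩
  -- the potential: one step up costs `y ^ 12`, one step down gains `y ^ 8`, and a step up has
  -- probability at most `q ≤ y ^ (-20)` as long as the height is not negligible
  let w : ℕ → Ω → ℝ≥0∞ := fun k A => y ^ (10 * g k A + 2 * k)
  have hw : ∀ k, Measurable (w k) := fun k =>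
    (measurable_of_countable fun i : ℕ => y ^ (10 * i + 2 * k)).comp (hg k)
  let Z : ℕ → Ω → ℝ≥0∞ := fun k => (good k).indicator (w k)
  let act : ℕ → Set Ω := fun k => {A | K ≤ k + 10 * g k A}
  have hact : ∀ k, MeasurableSet (act k) := fun k =>
    measurableSet_le measurable_const (measurable_const.add ((hg k).const_mul 10))
  let f : ℕ → Ω → ℝ≥0∞ := fun k => (good (k + 1) ∩ act k).indicator (w k)
  have hfm : ∀ k, Measurable (f k) := fun k => (hw k).indicator ((hgoodm _).inter (hact k))
  have hrec : ∀ k < K, y ^ 8 * ∫⁻ A, Z (k + 1) A ∂μ ≤ 2 * ∫⁻ A, Z k A ∂μ + y ^ (K + k + 19) := by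
    intro k hk
    have hfR : ∀ A x, f k (R k A x) = f k A := by
      intro A x
      have h := hrelR k A x
      have h1 : R k A x ∈ good (k + 1) ∩ act k ↔ A ∈ good (k + 1) ∩ act k := by
        refine and_congr (hgood k _ _ h) ?_
        simp only [act, Set.mem_ofPred_eq, hgrel k _ _ h]
      have h2 : w k (R k A x) = w k A := by simp only [w, hgrel k _ _ h]
      by_cases hA : A ∈ good (k + 1) ∩ act k
      · simp only [f]
        rw [Set.indicator_of_mem hA, Set.indicator_of_mem (h1.2 hA), h2]
      · simp only [f]
        rw [Set.indicator_of_notMem hA, Set.indicator_of_notMem (mt h1.1 hA)]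
    have hfreeze := lintegral_mul_indicator_le (hR k) (hfm k) hfR (hD k) (q := q) (by
      intro A hA
      have hA' : A ∈ good (k + 1) ∩ act k := by
        by_contra h
        exact hA (Set.indicator_of_notMem h _)
      exact hA'.1.2 k (Nat.lt_succ_self k) hA'.2)
    have hpt : ∀ A, y ^ 8 * Z (k + 1) A ≤
        f k A + y ^ 20 * (f k A * (D k).indicator 1 A) + y ^ (K + k + 19) := by
      intro A
      by_cases hA : A ∈ good (k + 1)
      swap
      · simp only [Z]
        rw [Set.indicator_of_notMem hA, mul_zero]
        exact zero_le
      have hZ : Z (k + 1) A = y ^ (10 * g (k + 1) A + 2 * (k + 1)) := Set.indicator_of_mem hA _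
      rw [hZ, ← pow_add]
      have h1 := hstep k hk A hA.1
      by_cases ha : A ∈ act k
      · have hf : f k A = y ^ (10 * g k A + 2 * k) := Set.indicator_of_mem (show A ∈ good (k + 1) ∩ act k from ⟨hA, ha⟩) _
        refine le_trans ?_ le_self_add
        by_cases hAD : A ∈ D k
        · refine le_trans ?_ le_add_self
          rw [Set.indicator_of_mem hAD, hf, Pi.one_apply, mul_one, ← pow_add]
          exact pow_le_pow_right₀ hy1 (by omega)
        · have h2 := hdown k hk A hA.1 hAD
          refine le_trans ?_ le_self_add
          rw [hf]
          exact pow_le_pow_right₀ hy1 (by omega)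
      · refine le_trans ?_ le_add_self
        simp only [act, Set.mem_ofPred_eq, not_le] at ha
        exact pow_le_pow_right₀ hy1 (by omega)
    have hfZ : ∫⁻ A, f k A ∂μ ≤ ∫⁻ A, Z k A ∂μ := by
      refine lintegral_mono fun A => ?_
      exact Set.indicator_le_indicator_of_subset
        (Set.inter_subset_left.trans (hgoodle k)) (fun _ => zero_le) A
    have hmD : Measurable fun A => f k A * (D k).indicator (1 : Ω → ℝ≥0∞) A :=
      (hfm k).mul (measurable_one.indicator (hD k))
    calc y ^ 8 * ∫⁻ A, Z (k + 1) A ∂μ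
        = ∫⁻ A, y ^ 8 * Z (k + 1) A ∂μ :=
          (lintegral_const_mul _ ((hw (k + 1)).indicator (hgoodm (k + 1)))).symm
      _ ≤ ∫⁻ A, f k A + y ^ 20 * (f k A * (D k).indicator 1 A) + y ^ (K + k + 19) ∂μ :=
          lintegral_mono hpt
      _ = ∫⁻ A, f k A ∂μ + y ^ 20 * ∫⁻ A, f k A * (D k).indicator 1 A ∂μ + y ^ (K + k + 19) := by
          rw [lintegral_add_right _ measurable_const, lintegral_add_left (hfm k),
            lintegral_const_mul _ hmD, lintegral_const, measure_univ, mul_one]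
      _ ≤ ∫⁻ A, Z k A ∂μ + ∫⁻ A, Z k A ∂μ + y ^ (K + k + 19) := by
          gcongr
          calc _ ≤ y ^ 20 * (q * ∫⁻ A, f k A ∂μ) := by gcongr
            _ = y ^ 20 * q * ∫⁻ A, f k A ∂μ := (mul_assoc _ _ _).symm
            _ ≤ 1 * ∫⁻ A, Z k A ∂μ := by gcongr
            _ = _ := one_mul _
      _ = _ := by rw [two_mul]
  have hsum : ∀ k ≤ K, y ^ (8 * k) * ∫⁻ A, Z k A ∂μ ≤
      2 ^ k * y ^ (10 * G) + 2 * y ^ (K + 9 * k + 10) := by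
    intro k
    induction k with
    | zero =>
      intro _
      refine le_trans ?_ le_self_add
      simp only [mul_zero, pow_zero, one_mul]
      calc ∫⁻ A, Z 0 A ∂μ ≤ ∫⁻ _, y ^ (10 * G) ∂μ := by
            refine lintegral_mono fun A => (Set.indicator_le_self' (fun _ _ => zero_le) A).trans ?_
            exact pow_le_pow_right₀ hy1 (by have := hG A; omega)
        _ = _ := by simp
    | succ k ih =>
      intro hk
      have h1 := hrec k (by omega)
      have h2 := ih (by omega)
      have h4 : (4 : ℝ≥0∞) ≤ y ^ 9 := by
        calc (4 : ℝ≥0∞) = 2 ^ 2 := by norm_num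
          _ ≤ y ^ 2 := by gcongr
          _ ≤ y ^ 9 := pow_le_pow_right₀ hy1 (by norm_num)
      calc y ^ (8 * (k + 1)) * ∫⁻ A, Z (k + 1) A ∂μ
          = y ^ (8 * k) * (y ^ 8 * ∫⁻ A, Z (k + 1) A ∂μ) := by ring
        _ ≤ y ^ (8 * k) * (2 * ∫⁻ A, Z k A ∂μ + y ^ (K + k + 19)) := by gcongr
        _ = 2 * (y ^ (8 * k) * ∫⁻ A, Z k A ∂μ) + y ^ (K + 9 * k + 19) := by ring
        _ ≤ 2 * (2 ^ k * y ^ (10 * G) + 2 * y ^ (K + 9 * k + 10)) + y ^ (K + 9 * k + 19) := by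
            gcongr
        _ = 2 ^ (k + 1) * y ^ (10 * G) + (4 * y ^ (K + 9 * k + 10) + y ^ (K + 9 * k + 19)) := by
            ring
        _ ≤ 2 ^ (k + 1) * y ^ (10 * G) +
            (y ^ 9 * y ^ (K + 9 * k + 10) + y ^ (K + 9 * k + 19)) := by gcongr
        _ = _ := by ring
  have hfin := hsum K le_rfl
  have hset : {A | A ∈ V ∧ 2 ≤ g K A ∧ ∀ k < K, K ≤ k + 10 * g k A → P {w | R k A w ∈ D k} ≤ q} ⊆
      {A | y ^ (20 + 2 * K) ≤ Z K A} := by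
    rintro A ⟨h1, h2, h3⟩
    have hZ : Z K A = y ^ (10 * g K A + 2 * K) := Set.indicator_of_mem (show A ∈ good K from ⟨h1, h3⟩) _
    simp only [Set.mem_ofPred_eq]
    rw [hZ]
    exact pow_le_pow_right₀ hy1 (by omega)
  have hmarkov := mul_meas_ge_le_lintegral (μ := μ) ((hw K).indicator (hgoodm K)) (y ^ (20 + 2 * K))
  calc _ ≤ y ^ (10 * K + 20) * μ {A | y ^ (20 + 2 * K) ≤ Z K A} := by gcongr
    _ = y ^ (8 * K) * (y ^ (20 + 2 * K) * μ {A | y ^ (20 + 2 * K) ≤ Z K A}) := by ring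
    _ ≤ y ^ (8 * K) * ∫⁻ A, Z K A ∂μ := by gcongr
    _ ≤ _ := hfin
    _ = _ := by ring_nf

end Drift

/-! ### Resampling rows and columns of the array -/

section Resample

theorem measurePreserving_update {ι X : Type*} [Fintype ι] [DecidableEq ι] [MeasurableSpace X]
    (Q : Measure X) [IsProbabilityMeasure Q] (a : ι) :
    MeasurePreserving (fun z : (ι → X) × X => Function.update z.1 a z.2)
      ((Measure.pi fun _ => Q).prod Q) (Measure.pi fun _ => Q) := by
  have hm : Measurable fun z : (ι → X) × X => Function.update z.1 a z.2 := by
    refine measurable_pi_lambda _ fun i => ?_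
    by_cases hi : i = a
    · subst hi; simpa using measurable_snd
    · simp only [Function.update_of_ne hi]
      exact (measurable_pi_apply i).comp measurable_fst
  refine ⟨hm, (Measure.pi_eq fun s hs => ?_).symm⟩
  rw [Measure.map_apply hm (MeasurableSet.univ_pi hs)]
  have h1 : (fun z : (ι → X) × X => Function.update z.1 a z.2) ⁻¹' Set.univ.pi s =
      (Set.univ.pi (Function.update s a Set.univ)) ×ˢ s a := by
    ext ⟨A, y⟩
    simp only [Set.mem_preimage, Set.mem_univ_pi, Set.mem_prod]
    constructor
    · intro h
      refine ⟨fun i => ?_, by simpa using h a⟩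
      by_cases hi : i = a
      · subst hi; simp
      · simpa [Function.update_of_ne hi] using h i
    · rintro ⟨h1, h2⟩ i
      by_cases hi : i = a
      · subst hi; simpa using h2
      · simpa [Function.update_of_ne hi] using h1 i
  rw [h1, Measure.prod_prod, Measure.pi_pi, ← Finset.mul_prod_erase _ _ (Finset.mem_univ a),
    ← Finset.mul_prod_erase _ (fun i => Q (s i)) (Finset.mem_univ a), Function.update_self,
    measure_univ, one_mul, mul_comm]
  congr 1
  refine Finset.prod_congr rfl fun i hi => ?_
  rw [Function.update_of_ne (Finset.ne_of_mem_erase hi)]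

variable {ν : Measure ℂ} [IsProbabilityMeasure ν] (p : unitInterval)

/-- The entries are i.i.d., so that the transpose has the same law. -/
theorem measurePreserving_transpose (n : ℕ) :
    MeasurePreserving (fun (A : Fin n → Fin n → ℂ) i j => A j i) (sparseArrayLaw n ν p)
      (sparseArrayLaw n ν p) := by
  have hm : Measurable fun (A : Fin n → Fin n → ℂ) i j => A j i := by fun_prop
  refine ⟨hm, ?_⟩
  conv_rhs => rw [sparseArrayLaw]
  refine (Measure.pi_eq_generateFrom (fun _ => generateFrom_pi) (fun _ => isPiSystem_pi)
    (fun _ => ⟨fun _ => Set.univ, fun _ => ⟨fun _ => Set.univ, fun _ _ => MeasurableSet.univ, by simp⟩,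
      fun _ => measure_lt_top _ _, by simp [Set.iUnion_const]⟩) fun s hs => ?_).symm
  choose t ht hts using hs
  simp only [Set.mem_univ_pi, Set.mem_ofPred_eq] at ht
  have h1 : ∀ i, s i = Set.univ.pi (t i) := fun i => (hts i).symm
  have hsm : MeasurableSet (Set.univ.pi s) := MeasurableSet.univ_pi fun i => by
    rw [h1]; exact MeasurableSet.univ_pi (ht i)
  rw [Measure.map_apply hm hsm]
  have h2 : (fun (A : Fin n → Fin n → ℂ) i j => A j i) ⁻¹' Set.univ.pi s =
      Set.univ.pi fun j => Set.univ.pi fun i => t i j := by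
    ext A
    simp only [h1, Set.mem_preimage, Set.mem_univ_pi]
    exact forall_comm
  rw [h2, sparseArrayLaw, Measure.pi_pi]
  simp only [h1, Measure.pi_pi]
  exact Finset.prod_comm

/-- Replacement of row `a`. -/
def replaceRow {n : ℕ} (a : ℕ) (A : Fin n → Fin n → ℂ) (y : Fin n → ℂ) : Fin n → Fin n → ℂ :=
  fun i j => if (i : ℕ) = a then y j else A i j

theorem measurePreserving_replaceRow (n a : ℕ) :
    MeasurePreserving (fun z : (Fin n → Fin n → ℂ) × (Fin n → ℂ) => replaceRow a z.1 z.2)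
      ((sparseArrayLaw n ν p).prod (Measure.pi fun _ => sparseEntryLaw ν p))
      (sparseArrayLaw n ν p) := by
  by_cases ha : a < n
  · convert! measurePreserving_update (Measure.pi fun _ : Fin n => sparseEntryLaw ν p)
      (⟨a, ha⟩ : Fin n) using 1
    funext z i j
    by_cases hi : i = ⟨a, ha⟩
    · subst hi; simp [replaceRow]
    · have : (i : ℕ) ≠ a := fun h => hi (Fin.ext h)
      simp [replaceRow, this, hi]
  · convert! measurePreserving_fst (μ := sparseArrayLaw n ν p)
      (ν := Measure.pi fun _ : Fin n => sparseEntryLaw ν p) using 1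
    funext z i j
    have : (i : ℕ) ≠ a := fun h => ha (h ▸ i.2)
    simp [replaceRow, this]

/-- Replacement of the entries that are new at time `s + 1`: those of row `s / 2` if `s` is odd, and
those of column `s / 2` if `s` is even. -/
def resampleAt {n : ℕ} (s : ℕ) (A : Fin n → Fin n → ℂ) (y : Fin n → ℂ) : Fin n → Fin n → ℂ :=
  if s % 2 = 1 then replaceRow (s / 2) A y else fun i j => replaceRow (s / 2) (fun i j => A j i) y j i

theorem measurePreserving_resampleAt (n s : ℕ) :
    MeasurePreserving (fun z : (Fin n → Fin n → ℂ) × (Fin n → ℂ) => resampleAt s z.1 z.2)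
      ((sparseArrayLaw n ν p).prod (Measure.pi fun _ => sparseEntryLaw ν p))
      (sparseArrayLaw n ν p) := by
  by_cases hs : s % 2 = 1
  · simp only [resampleAt, hs, if_true]
    exact measurePreserving_replaceRow p n (s / 2)
  · simp only [resampleAt, hs, if_false]
    have h1 := (measurePreserving_transpose (ν := ν) p n).prod
      (MeasurePreserving.id (Measure.pi fun _ : Fin n => sparseEntryLaw ν p))
    exact (measurePreserving_transpose p n).comp ((measurePreserving_replaceRow p n (s / 2)).comp h1)

/-- Two arrays agree on the block at time `s`. -/
def AgreeAt {n : ℕ} (s : ℕ) (A A' : Fin n → Fin n → ℂ) : Prop :=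
  ∀ i j : Fin n, (i : ℕ) < s / 2 → (j : ℕ) < (s + 1) / 2 → A i j = A' i j

theorem AgreeAt.mono {n s s' : ℕ} {A A' : Fin n → Fin n → ℂ} (h : AgreeAt s' A A') (hs : s ≤ s') :
    AgreeAt s A A' := fun i j hi hj => h i j (by omega) (by omega)

theorem agreeAt_resampleAt {n : ℕ} (s : ℕ) (A : Fin n → Fin n → ℂ) (y : Fin n → ℂ) :
    AgreeAt s (resampleAt s A y) A := by
  intro i j hi hj
  by_cases hs : s % 2 = 1
  · have : (i : ℕ) ≠ s / 2 := by omega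
    simp [resampleAt, hs, replaceRow, this]
  · have : (j : ℕ) ≠ s / 2 := by omega
    simp [resampleAt, hs, replaceRow, this]

theorem AgreeAt.resampleAt {n s : ℕ} {A A' : Fin n → Fin n → ℂ} (h : AgreeAt s A A')
    (y : Fin n → ℂ) : AgreeAt (s + 1) (resampleAt s A y) (resampleAt s A' y) := by
  intro i j hi hj
  by_cases hs : s % 2 = 1
  · by_cases hi' : (i : ℕ) = s / 2
    · simp [_root_.resampleAt, hs, replaceRow, hi']
    · simpa [_root_.resampleAt, hs, replaceRow, hi'] using h i j (by omega) (by omega)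
  · by_cases hj' : (j : ℕ) = s / 2
    · simp [_root_.resampleAt, hs, replaceRow, hj']
    · simpa [_root_.resampleAt, hs, replaceRow, hj'] using h i j (by omega) (by omega)

theorem AgreeAt.blockAtTime_eq {n s : ℕ} {A A' : Fin n → Fin n → ℂ} (h : AgreeAt s A A') (d : ℝ)
    (z : ℂ) : blockAtTime (shiftedMatrix A d z) s = blockAtTime (shiftedMatrix A' d z) s := by
  ext i j
  change shiftedMatrix A d z i j = shiftedMatrix A' d z i j
  rw [shiftedMatrix_apply, shiftedMatrix_apply, h i j i.2 j.2]

end Resample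

/-! ### Measurability and locality of the process -/

section TakenCount

variable {n : ℕ} (d C ε : ℝ) (z : ℂ)

theorem takenCount_succ (A : Fin n → Fin n → ℂ) (k : ℕ) : takenCount A d C ε z (k + 1) =
    if logSum n (blockAtTime (shiftedMatrix A d z) (2 * minorSize n ε + k + 1))
        (takenCount A d C ε z k + 1) ≤
      logSum n (blockAtTime (shiftedMatrix A d z) (2 * minorSize n ε + k))
        (takenCount A d C ε z k) + (stepError n d C (takenCount A d C ε z k + 1) : EReal)
    then takenCount A d C ε z k + 1 else takenCount A d C ε z k := by
  rw [takenCount]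

theorem takenCount_eq_of_agreeAt {A A' : Fin n → Fin n → ℂ} {k : ℕ}
    (h : AgreeAt (2 * minorSize n ε + k) A A') :
    takenCount A d C ε z k = takenCount A' d C ε z k := by
  induction k with
  | zero => rfl
  | succ k ih =>
    have h' : AgreeAt (2 * minorSize n ε + k) A A' := h.mono (by omega)
    have h1 := AgreeAt.blockAtTime_eq (s := 2 * minorSize n ε + k + 1) h d z
    rw [takenCount_succ, takenCount_succ, ih h', h1, h'.blockAtTime_eq d z]

theorem continuous_shiftedMatrix : Continuous fun A : Fin n → Fin n → ℂ => shiftedMatrix A d z := by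
  refine continuous_pi fun i => continuous_pi fun j => ?_
  simp only [shiftedMatrix_apply]
  fun_prop

theorem continuous_topProd_leadingBlock (a b r : ℕ) :
    Continuous fun A : Fin n → Fin n → ℂ => topProd (leadingBlock (shiftedMatrix A d z) a b) r :=
  (continuous_topProd r).comp ((continuous_shiftedMatrix d z).matrix_submatrix _ _)

theorem measurableSet_logSum_le (hn : 0 < n) (s r : ℕ) (δ : ℝ) :
    MeasurableSet {A : Fin n → Fin n → ℂ |
      logSum n (blockAtTime (shiftedMatrix A d z) (s + 1)) (r + 1) ≤
        logSum n (blockAtTime (shiftedMatrix A d z) s) r + (δ : EReal)} := by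
  have h1 : {A : Fin n → Fin n → ℂ |
      logSum n (blockAtTime (shiftedMatrix A d z) (s + 1)) (r + 1) ≤
        logSum n (blockAtTime (shiftedMatrix A d z) s) r + (δ : EReal)} =
      {A | topProd (blockAtTime (shiftedMatrix A d z) s) r ≤ 0} ∪
      {A | topProd (blockAtTime (shiftedMatrix A d z) s) r * Real.exp (-(n * δ)) ≤
        topProd (blockAtTime (shiftedMatrix A d z) (s + 1)) (r + 1)} := by
    ext A
    simp only [Set.mem_ofPred_eq, Set.mem_union]
    by_cases h0 : 0 < topProd (blockAtTime (shiftedMatrix A d z) s) r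
    · rw [logSum_succ_le_iff hn h0 δ]
      simp [h0]
    · rw [logSum_eq_top hn h0, EReal.top_add_coe]
      simp [not_lt.1 h0]
  rw [h1]
  have hc : ∀ s r, Measurable fun A : Fin n → Fin n → ℂ =>
      topProd (blockAtTime (shiftedMatrix A d z) s) r := fun s r =>
    (continuous_topProd_leadingBlock d z _ _ r).measurable
  exact (measurableSet_le (hc _ _) measurable_const).union
    (measurableSet_le ((hc _ _).mul_const _) (hc _ _))

theorem measurable_takenCount (hn : 0 < n) (k : ℕ) :
    Measurable fun A : Fin n → Fin n → ℂ => takenCount A d C ε z k := by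
  induction k with
  | zero => exact measurable_const
  | succ k ih =>
    let F : (Fin n → Fin n → ℂ) × ℕ → ℕ := fun x =>
      open Classical in
      if logSum n (blockAtTime (shiftedMatrix x.1 d z) (2 * minorSize n ε + k + 1)) (x.2 + 1) ≤
        logSum n (blockAtTime (shiftedMatrix x.1 d z) (2 * minorSize n ε + k)) x.2 +
          (stepError n d C (x.2 + 1) : EReal) then x.2 + 1 else x.2
    have hF : Measurable F := measurable_from_prod_countable_left fun r =>
      Measurable.ite (measurableSet_logSum_le d z hn (2 * minorSize n ε + k) r
        (stepError n d C (r + 1))) (measurable_const (a := r + 1)) (measurable_const (a := r))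
    have h1 : (fun A : Fin n → Fin n → ℂ => takenCount A d C ε z (k + 1)) =
        fun A => F (A, takenCount A d C ε z k) := by
      funext A
      rw [takenCount_succ]
    rw [h1]
    exact hF.comp (measurable_id.prodMk ih)

variable {d C ε z}

theorem topProd_blockAtTime_le (M : Matrix (Fin n) (Fin n) ℂ) (s r : ℕ) :
    topProd (blockAtTime M s) r ≤ topProd (blockAtTime M (s + 1)) r := by
  refine topProd_le_of_forall_le (fun j => ?_) r
  let f : {i : Fin n // (i : ℕ) < s / 2} → {i : Fin n // (i : ℕ) < (s + 1) / 2} :=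
    fun i => ⟨i, by have := i.2; omega⟩
  let g : {j : Fin n // (j : ℕ) < (s + 1) / 2} → {j : Fin n // (j : ℕ) < (s + 1 + 1) / 2} :=
    fun j => ⟨j, by have := j.2; omega⟩
  have hf : Function.Injective f := fun i i' h => by
    have h1 := congrArg Subtype.val h
    exact Subtype.ext h1
  have hg : Function.Injective g := fun i i' h => by
    have h1 := congrArg Subtype.val h
    exact Subtype.ext h1
  exact singularValues_submatrix_le (blockAtTime M (s + 1)) hf hg j

/-- If the initial log sum is finite, then so are all log sums of the process. -/
theorem topProd_takenCount_pos (hn : 0 < n) {A : Fin n → Fin n → ℂ}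
    (h0 : 0 < topProd (blockAtTime (shiftedMatrix A d z) (2 * minorSize n ε)) (keptCount n ε))
    (k : ℕ) : 0 < topProd (blockAtTime (shiftedMatrix A d z) (2 * minorSize n ε + k))
      (takenCount A d C ε z k) := by
  induction k with
  | zero => exact h0
  | succ k ih =>
    rw [takenCount_succ]
    split_ifs with h
    · rw [logSum_succ_le_iff hn ih] at h
      exact (mul_pos ih (Real.exp_pos _)).trans_le h
    · exact ih.trans_le (topProd_blockAtTime_le _ _ _)

/-- The height is nonnegative, as the number of nonzero singular values is at most the number of rows. -/
theorem two_mul_takenCount_le (hn : 0 < n) {A : Fin n → Fin n → ℂ}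
    (h0 : 0 < topProd (blockAtTime (shiftedMatrix A d z) (2 * minorSize n ε)) (keptCount n ε))
    (k : ℕ) : 2 * takenCount A d C ε z k ≤ 2 * minorSize n ε + k := by
  have h1 := (le_card_of_topProd_pos (topProd_takenCount_pos (C := C) hn h0 k)).1
  have h2 : Fintype.card {i : Fin n // (i : ℕ) < (2 * minorSize n ε + k) / 2} ≤
      (2 * minorSize n ε + k) / 2 := by
    rw [Fintype.card_subtype]
    refine (Finset.card_le_card_of_injOn (fun i : Fin n => (i : ℕ)) (t := Finset.range _)
      (fun i hi => ?_) fun i _ j _ h => Fin.ext h).trans_eq (Finset.card_range _)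
    simpa using hi
  omega

end TakenCount

/-! ### Failure of a step -/

section StepFailure

open Module InnerProductSpace

variable {n : ℕ}

theorem sum_dite_lt {M : Type*} [AddCommMonoid M] {b : ℕ} (f : {j : Fin n // (j : ℕ) < b} → M) :
    ∑ j : Fin n, (if h : (j : ℕ) < b then f ⟨j, h⟩ else 0) = ∑ j, f j := by
  refine (Fintype.sum_of_injective Subtype.val Subtype.val_injective f _ (fun j hj => ?_)
    fun j => ?_).symm
  · have : ¬ (j : ℕ) < b := fun h => hj ⟨⟨j, h⟩, rfl⟩
    rw [dif_neg this]
  · rw [dif_pos j.2]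

/-- The projections of the standard basis vectors, extended by `0` to all column indices. -/
noncomputable def extendProj {b : ℕ} (H : Submodule ℂ (EuclideanSpace ℂ {j : Fin n // (j : ℕ) < b}))
    (j : Fin n) : EuclideanSpace ℂ {j : Fin n // (j : ℕ) < b} :=
  if h : (j : ℕ) < b then coordProj H ⟨j, h⟩ else 0

theorem sum_extendProj {b : ℕ} (H : Submodule ℂ (EuclideanSpace ℂ {j : Fin n // (j : ℕ) < b}))
    {M : Type*} [AddCommMonoid M] (f : Fin n → EuclideanSpace ℂ {j : Fin n // (j : ℕ) < b} → M)
    (hf : ∀ j, f j 0 = 0) : ∑ j, f j (extendProj H j) =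
      ∑ j : {j : Fin n // (j : ℕ) < b}, f j (coordProj H j) := by
  rw [← sum_dite_lt]
  refine Finset.sum_congr rfl fun j _ => ?_
  unfold extendProj
  split_ifs
  · rfl
  · exact hf j

theorem sum_norm_sq_inner_extendProj_le {b : ℕ}
    (H : Submodule ℂ (EuclideanSpace ℂ {j : Fin n // (j : ℕ) < b}))
    (v : EuclideanSpace ℂ {j : Fin n // (j : ℕ) < b}) :
    ∑ j, ‖⟪v, extendProj H j⟫_ℂ‖ ^ 2 ≤ ‖v‖ ^ 2 := by
  rw [sum_extendProj H (fun _ x => ‖⟪v, x⟫_ℂ‖ ^ 2) (by simp)]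
  exact sum_norm_sq_inner_coordProj_le H v

theorem sum_norm_sq_extendProj {b : ℕ}
    (H : Submodule ℂ (EuclideanSpace ℂ {j : Fin n // (j : ℕ) < b})) :
    ∑ j, ‖extendProj H j‖ ^ 2 = finrank ℂ H := by
  rw [sum_extendProj H (fun _ x => ‖x‖ ^ 2) (by simp)]
  exact sum_norm_sq_coordProj H

theorem norm_extendProj_le_one {b : ℕ}
    (H : Submodule ℂ (EuclideanSpace ℂ {j : Fin n // (j : ℕ) < b})) (j : Fin n) :
    ‖extendProj H j‖ ≤ 1 := by
  unfold extendProj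
  split_ifs
  · exact norm_coordProj_le_one H _
  · simp

theorem card_filter_extendProj {b : ℕ}
    (H : Submodule ℂ (EuclideanSpace ℂ {j : Fin n // (j : ℕ) < b})) {W : ℝ} (hW : 0 ≤ W) :
    (Finset.univ.filter fun j => W < ‖extendProj H j‖).card =
      (Finset.univ.filter fun j => W < ‖coordProj H j‖).card := by
  rw [Finset.card_filter, Finset.card_filter]
  exact sum_extendProj H (fun _ x => if W < ‖x‖ then 1 else 0) (by simp [not_lt.2 hW])

/-- Appending row `a` to the block with `a` rows and `b` columns multiplies the product of the top `r`
singular values, when one more of them is taken, by less than `ρ`. -/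
def RowFails (A : Fin n → Fin n → ℂ) (d : ℝ) (z : ℂ) (a b r : ℕ) (ρ : ℝ) : Prop :=
  0 < topProd (leadingBlock (shiftedMatrix A d z) a b) r ∧
    topProd (leadingBlock (shiftedMatrix A d z) (a + 1) b) (r + 1) <
      topProd (leadingBlock (shiftedMatrix A d z) a b) r * ρ

theorem measurableSet_rowFails (d : ℝ) (z : ℂ) (a b r : ℕ) (ρ : ℝ) :
    MeasurableSet {A : Fin n → Fin n → ℂ | RowFails A d z a b r ρ} := by
  have hc : ∀ a b r, Measurable fun A : Fin n → Fin n → ℂ =>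
      topProd (leadingBlock (shiftedMatrix A d z) a b) r := fun a b r =>
    (continuous_topProd_leadingBlock d z a b r).measurable
  exact (measurableSet_lt measurable_const (hc _ _ _)).inter
    (measurableSet_lt (hc _ _ _) ((hc _ _ _).mul_const _))

/-- After a failure, the bottom right singular space is an approximate kernel, and the new row is
nearly orthogonal to it. -/
theorem RowFails.norm_le {A : Fin n → Fin n → ℂ} {d : ℝ} {z : ℂ} {a b r : ℕ} {ρ : ℝ}
    (h : RowFails A d z a b r ρ) (ha : a < n) :
    (∀ u ∈ (topSpace (Matrix.toEuclideanLin (leadingBlock (shiftedMatrix A d z) a b)) r)ᗮ,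
      ‖Matrix.toEuclideanLin (leadingBlock (shiftedMatrix A d z) a b) u‖ ≤ ρ * ‖u‖) ∧
    ‖(topSpace (Matrix.toEuclideanLin (leadingBlock (shiftedMatrix A d z) a b)) r)ᗮ.starProjection
      (WithLp.toLp 2 fun j : {j : Fin n // (j : ℕ) < b} =>
        star (shiftedMatrix A d z ⟨a, ha⟩ (j : Fin n)))‖ ≤ ρ := by
  obtain ⟨h0, h1⟩ := h
  set M := leadingBlock (shiftedMatrix A d z) a b with hM
  set N := leadingBlock (shiftedMatrix A d z) (a + 1) b with hN
  let f : {i : Fin n // (i : ℕ) < a} → {i : Fin n // (i : ℕ) < a + 1} :=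
    fun i => ⟨i, by have := i.2; omega⟩
  have hf : Function.Injective f := fun i i' h => by
    have h1 := congrArg Subtype.val h
    exact Subtype.ext h1
  have hMN : M = N.submatrix f id := rfl
  have hσ : ∀ j, (Matrix.toEuclideanLin M).singularValues j ≤
      (Matrix.toEuclideanLin N).singularValues j := fun j =>
    singularValues_submatrix_le N hf Function.injective_id j
  refine ⟨fun u hu => (norm_apply_le_of_mem_topSpace_orthogonal _ hu).trans ?_, ?_⟩
  · have h2 := (topProd_le_of_forall_le hσ (r + 1)).trans_lt h1
    rw [topProd_succ] at h2
    gcongr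
    exact (lt_of_mul_lt_mul_left h2 h0.le).le
  · have h3 := prod_singularValues_mul_norm_row_le M N hf hMN
      (i₀ := ⟨⟨a, ha⟩, Nat.lt_succ_self a⟩) (r := r) (fun i hi => by
        have h4 := congrArg (fun i : {i : Fin n // (i : ℕ) < a + 1} => ((i : Fin n) : ℕ)) hi
        have := i.2
        simp only [f] at h4
        omega) ((topProd_pos_iff M r).1 h0)
    exact (lt_of_mul_lt_mul_left (h3.trans_lt h1) h0.le).le

theorem leadingBlock_replaceRow (A : Fin n → Fin n → ℂ) (d : ℝ) (z : ℂ) (a b : ℕ) (y : Fin n → ℂ) :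
    leadingBlock (shiftedMatrix (replaceRow a A y) d z) a b =
      leadingBlock (shiftedMatrix A d z) a b := by
  ext i j
  change shiftedMatrix (replaceRow a A y) d z i j = shiftedMatrix A d z i j
  have : ((i : Fin n) : ℕ) ≠ a := i.2.ne
  rw [shiftedMatrix_apply, shiftedMatrix_apply, replaceRow, if_neg this]

/-- The projection of a new random row is an affine function of the independent entries. -/
theorem norm_sum_extendProj_sub_le_of_rowFails {A : Fin n → Fin n → ℂ} {d : ℝ} {z : ℂ}
    {a b r : ℕ} {ρ : ℝ} (ha : a < n) {H : Submodule ℂ (EuclideanSpace ℂ {j : Fin n // (j : ℕ) < b})}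
    (hH : H = (topSpace (Matrix.toEuclideanLin (leadingBlock (shiftedMatrix A d z) a b)) r)ᗮ)
    {y : Fin n → ℂ} (h : RowFails (replaceRow a A y) d z a b r ρ) :
    ‖∑ j, ((((√d)⁻¹ : ℝ) : ℂ) * star (y j)) • extendProj H j -
      ∑ j : Fin n, (if a = (j : ℕ) then star z else 0) • extendProj H j‖ ≤ ρ := by
  have h1 := (h.norm_le ha).2
  rw [starProjection_eq_sum, leadingBlock_replaceRow, ← hH] at h1
  refine le_trans (le_of_eq ?_) h1
  rw [← Finset.sum_sub_distrib]
  congr 1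
  simp_rw [← sub_smul]
  rw [sum_extendProj H (fun j x => ((((√d)⁻¹ : ℝ) : ℂ) * star (y j) -
    (if a = (j : ℕ) then star z else 0)) • x) (by simp)]
  refine Finset.sum_congr rfl fun j _ => ?_
  congr 1
  rw [shiftedMatrix_apply, replaceRow, if_pos rfl, star_sub, star_mul', apply_ite star, star_zero]
  congr 1
  · congr 1
    exact (Complex.conj_ofReal _).symm
  · simp [Fin.ext_iff]

end StepFailure

/-! ### Anticoncentration of the projection of a new row -/

section StepProbability

open Module InnerProductSpace

variable {ν : Measure ℂ} [IsProbabilityMeasure ν] (p : unitInterval)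

theorem prod_sparseEntryLaw_real_le {c t : ℝ} (hc : 0 < c) :
    ((sparseEntryLaw ν p).prod (sparseEntryLaw ν p)).real
      {z | c ≤ ‖z.1 - z.2‖ ∧ ‖z.1 - z.2‖ ≤ t} ≤ 2 * p := by
  have hm : MeasurableSet {y : ℂ | y ≠ 0} := (measurableSet_singleton (0 : ℂ)).compl
  have hsub : {z : ℂ × ℂ | c ≤ ‖z.1 - z.2‖ ∧ ‖z.1 - z.2‖ ≤ t} ⊆
      Prod.fst ⁻¹' {y | y ≠ 0} ∪ Prod.snd ⁻¹' {y | y ≠ 0} := by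
    rintro ⟨x, y⟩ ⟨h, -⟩
    by_contra h0
    simp only [Set.mem_union, Set.mem_preimage, Set.mem_ofPred_eq, not_or, not_not] at h0
    simp only [h0.1, h0.2, sub_zero, norm_zero] at h
    linarith
  have h1 := sparseEntryLaw_real_ne_zero_le (ν := ν) p
  refine (measureReal_mono hsub).trans ((measureReal_union_le _ _).trans ?_)
  rw [measureReal_def, measureReal_def, measurePreserving_fst.measure_preimage hm.nullMeasurableSet,
    measurePreserving_snd.measure_preimage hm.nullMeasurableSet, ← measureReal_def]
  linarith

/-- Two independent entries differ by an amount bounded above and below with a probability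
comparable to `p`. -/
theorem le_prod_sparseEntryLaw_real_and_le (hν : ∫ x, ‖x‖ ^ 2 ∂ν = 1) {c : ℝ} (hc : 0 < c)
    (hc₁ : 0 < ν.real {y | c ≤ ‖y‖}) (hp : (p : ℝ) ≤ 1 / 2) :
    p * ν.real {y | c ≤ ‖y‖} / 4 ≤ ((sparseEntryLaw ν p).prod (sparseEntryLaw ν p)).real
      {z | c ≤ ‖z.1 - z.2‖ ∧ ‖z.1 - z.2‖ ≤ 16 / ν.real {y | c ≤ ‖y‖}} := by
  set c₁ := ν.real {y | c ≤ ‖y‖} with hc₁def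
  set t := 16 / c₁ with ht
  have ht0 : 0 < t / 2 := by positivity
  have hm : MeasurableSet {y : ℂ | t / 2 ≤ ‖y‖} := measurableSet_le measurable_const (by fun_prop)
  have h1 := le_prod_sparseEntryLaw_real (ν := ν) p hc hp
  have hsub : {z : ℂ × ℂ | c ≤ ‖z.1 - z.2‖} ⊆
      {z | c ≤ ‖z.1 - z.2‖ ∧ ‖z.1 - z.2‖ ≤ t} ∪
        (Prod.fst ⁻¹' {y | t / 2 ≤ ‖y‖} ∪ Prod.snd ⁻¹' {y | t / 2 ≤ ‖y‖}) := by
    rintro ⟨x, y⟩ h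
    by_cases hxy : ‖x - y‖ ≤ t
    · exact Or.inl ⟨h, hxy⟩
    · right
      by_contra h0
      simp only [Set.mem_union, Set.mem_preimage, Set.mem_ofPred_eq, not_or, not_le] at h0
      have := norm_sub_le x y
      linarith [h0.1, h0.2]
  have h2 := (measureReal_mono (μ := (sparseEntryLaw ν p).prod (sparseEntryLaw ν p)) hsub).trans
    ((measureReal_union_le _ _).trans (add_le_add_right (measureReal_union_le _ _) _))
  have h3 : (sparseEntryLaw ν p).real {y | t / 2 ≤ ‖y‖} ≤ p * (c₁ / 8) := by
    rw [sparseEntryLaw_real_le_norm p ht0]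
    have h4 := mul_meas_ge_le_integral_of_nonneg (Eventually.of_forall fun x : ℂ => norm_nonneg x)
      (integrable_norm_of_integral_sq hν).1 (t / 2)
    have h5 := h4.trans (integrable_norm_of_integral_sq hν).2
    have h6 : ν.real {y | t / 2 ≤ ‖y‖} ≤ c₁ / 8 := by
      rw [← le_div_iff₀' ht0] at h5
      refine h5.trans (le_of_eq ?_)
      rw [ht]
      field_simp
      norm_num
    exact mul_le_mul_of_nonneg_left h6 p.2.1
  have h7 : ((sparseEntryLaw ν p).prod (sparseEntryLaw ν p)).real
      (Prod.fst ⁻¹' {y | t / 2 ≤ ‖y‖}) ≤ p * (c₁ / 8) := by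
    rw [measureReal_def, measurePreserving_fst.measure_preimage hm.nullMeasurableSet]
    exact h3
  have h8 : ((sparseEntryLaw ν p).prod (sparseEntryLaw ν p)).real
      (Prod.snd ⁻¹' {y | t / 2 ≤ ‖y‖}) ≤ p * (c₁ / 8) := by
    rw [measureReal_def, measurePreserving_snd.measure_preimage hm.nullMeasurableSet]
    exact h3
  linarith

variable {n b : ℕ} {σ : ℂ → ℂ}

/-- A random row is unlikely to be nearly orthogonal to a space of dimension proportional to the
number of columns; the scale is that of the typical length of its projection. -/
theorem measureReal_norm_sum_extendProj_le_coarse {c t c₁ d ρ : ℝ} (hc : 0 < c) (hc₁ : 0 < c₁)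
    (hβ : p * c₁ / 4 ≤ ((sparseEntryLaw ν p).prod (sparseEntryLaw ν p)).real
      {z | c ≤ ‖z.1 - z.2‖ ∧ ‖z.1 - z.2‖ ≤ t}) (hd : d = p * n) (hd0 : 0 < d)
    (hσ : ∀ x y, ‖star (σ x) - star (σ y)‖ = ‖x - y‖)
    (H : Submodule ℂ (EuclideanSpace ℂ {j : Fin n // (j : ℕ) < b})) {s : ℝ} (hs0 : 0 < s)
    (hs : s = finrank ℂ H / n) (hds : 32 ≤ c₁ * d * s) (hρ : 2 * ρ ^ 2 ≤ c₁ * c ^ 2 * s ^ 2 / 256)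
    (v : EuclideanSpace ℂ {j : Fin n // (j : ℕ) < b}) {E : Set (Fin n → ℂ)} (hE : MeasurableSet E)
    (hEv : ∀ y ∈ E, ‖∑ j, ((((√d)⁻¹ : ℝ) : ℂ) * star (σ (y j))) • extendProj H j - v‖ ≤ ρ) :
    (Measure.pi fun _ => sparseEntryLaw ν p).real E ≤
      Real.exp (-(c₁ * d * s / 80)) + 1024 * (t / c) ^ 2 / (c₁ * d * s ^ 2) +
        131072 * (t / c) ^ 4 / (c₁ ^ 2 * n * s ^ 3) := by
  classical
  have hn0 : (0 : ℝ) < n := by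
    rcases Nat.eq_zero_or_pos n with h | h
    · rw [hd, h] at hd0; simp at hd0
    · exact_mod_cast h
  have hp0 : (0 : ℝ) < p := by
    by_contra h
    have : (p : ℝ) = 0 := le_antisymm (not_lt.1 h) p.2.1
    rw [hd, this] at hd0; simp at hd0
  set h : ℝ := (finrank ℂ H : ℝ) with hh
  have hhs : h = s * n := by rw [hs]; field_simp
  set W : ℝ := √(s / 2) with hW
  have hW0 : 0 < W := Real.sqrt_pos.2 (by positivity)
  have hW2 : W ^ 2 = s / 2 := Real.sq_sqrt (by positivity)
  set G : Finset (Fin n) := Finset.univ.filter fun j => W ≤ ‖extendProj H j‖ with hG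
  have hGcard : h / 2 ≤ G.card := by
    have h1 := sum_norm_sq_extendProj H
    rw [← Finset.sum_filter_add_sum_filter_not Finset.univ fun j => W ≤ ‖extendProj H j‖] at h1
    have h2 : ∑ j ∈ G, ‖extendProj H j‖ ^ 2 ≤ G.card := by
      calc _ ≤ ∑ j ∈ G, (1 : ℝ) := Finset.sum_le_sum fun j _ =>
            pow_le_one₀ (norm_nonneg _) (norm_extendProj_le_one H j)
        _ = _ := by simp
    have h3 : ∑ j ∈ Finset.univ.filter (fun j => ¬ W ≤ ‖extendProj H j‖), ‖extendProj H j‖ ^ 2 ≤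
        n * W ^ 2 := by
      calc _ ≤ ∑ j ∈ Finset.univ.filter (fun j => ¬ W ≤ ‖extendProj H j‖), W ^ 2 :=
            Finset.sum_le_sum fun j hj => pow_le_pow_left₀ (norm_nonneg _)
              (not_le.1 (Finset.mem_filter.1 hj).2).le 2
        _ = ((Finset.univ.filter fun j => ¬ W ≤ ‖extendProj H j‖).card : ℝ) * W ^ 2 := by
            rw [Finset.sum_const, nsmul_eq_mul]
        _ ≤ _ := by
            gcongr
            exact_mod_cast (Finset.card_le_univ _).trans_eq (Fintype.card_fin n)
    rw [hW2] at h3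
    have h4 : (n : ℝ) * (s / 2) = h / 2 := by rw [hhs]; ring
    linarith
  set β : ℝ := p * c₁ / 4 with hβdef
  have hβh : β * h = c₁ * d * s / 4 := by rw [hhs, hd]; ring
  set N : ℕ := ⌊β * h / 4⌋₊ with hN
  have hN1 : (N : ℝ) ≤ β * h / 4 := Nat.floor_le (by rw [hβh]; positivity)
  have hN2 : β * h / 8 ≤ N := by
    have := Nat.lt_floor_add_one (β * h / 4)
    rw [← hN] at this
    linarith
  have hN3 : 1 ≤ N := by
    have : (0 : ℝ) < N := lt_of_lt_of_le (by linarith) hN2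
    exact_mod_cast this
  have hNW : c₁ * d * s ^ 2 / 64 ≤ N * W ^ 2 := by
    rw [hW2]
    calc c₁ * d * s ^ 2 / 64 = (β * h / 8) * (s / 2) := by rw [hβh]; ring
      _ ≤ _ := by gcongr
  have hsd : (√d)⁻¹ ^ 2 = d⁻¹ := by rw [inv_pow, Real.sq_sqrt hd0.le]
  have hmain := measureReal_ball_sum_le_of_bessel (sparseEntryLaw ν p)
    (τ := fun y => (((√d)⁻¹ : ℝ) : ℂ) * star (σ y)) (κ := (√d)⁻¹)
    (inv_pos.2 (Real.sqrt_pos.2 hd0)) (fun y y' => by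
      rw [← mul_sub, norm_mul, hσ, Complex.norm_real, norm_inv,
        Real.norm_of_nonneg (Real.sqrt_nonneg _)])
    (sum_norm_sq_inner_extendProj_le H) (G := G) hW0 (fun j hj => (Finset.mem_filter.1 hj).2)
    (sum_norm_sq_extendProj H).le hc hβ (prod_sparseEntryLaw_real_le p hc) hN3 (ρ := ρ) (by
      refine hρ.trans ?_
      calc c₁ * c ^ 2 * s ^ 2 / 256 = c₁ * d * s ^ 2 / 64 * (d⁻¹ * c ^ 2 / 4) := by
            field_simp
            norm_num
        _ ≤ N * W ^ 2 * (d⁻¹ * c ^ 2 / 4) := by gcongr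
        _ = _ := by rw [← hsd]; ring) v hE hEv
  refine hmain.trans ?_
  rw [add_assoc]
  have he : (3 : ℝ) / 5 ≤ 1 - Real.exp (-1) := by
    have := Real.exp_neg_one_lt_d9
    linarith
  refine add_le_add (Real.exp_le_exp.2 ?_) (add_le_add ?_ ?_)
  · have h5 : 3 / 5 * β * (h / 2) ≤ (1 - Real.exp (-1)) * β * G.card := by
      have : 0 ≤ β := by positivity
      gcongr
    have h6 : c₁ * d * s / 80 = β * h / 20 := by rw [hβh]; ring
    rw [h6]
    linarith
  · calc 16 * ((t / c) ^ 2 / (N * W ^ 2)) ≤ 16 * ((t / c) ^ 2 / (c₁ * d * s ^ 2 / 64)) := by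
          gcongr
      _ = _ := by field_simp; ring
  · calc 8 * ((t / c) ^ 4 * ((2 * p) ^ 2 * h) / (N * W ^ 2) ^ 2)
        ≤ 8 * ((t / c) ^ 4 * ((2 * p) ^ 2 * h) / (c₁ * d * s ^ 2 / 64) ^ 2) := by
          have : 0 ≤ h := by rw [hhs]; positivity
          gcongr
      _ = _ := by rw [hhs, hd]; field_simp; ring

/-- A random row is unlikely to be nearly orthogonal, at an arbitrarily fine scale, to a space with
many large coordinate projections. -/
theorem measureReal_norm_sum_extendProj_le_fine {c d ρ W : ℝ} (hc : 0 < c) (hp : (p : ℝ) ≤ 1 / 2)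
    (hσ : ∀ x y, ‖star (σ x) - star (σ y)‖ = ‖x - y‖)
    (H : Submodule ℂ (EuclideanSpace ℂ {j : Fin n // (j : ℕ) < b})) {L N : ℕ} (hW : 0 ≤ W)
    (hL : L < (Finset.univ.filter fun j => W < ‖coordProj H j‖).card)
    (hρ : 2 * ρ < (1 / 8 : ℝ) ^ N * ((√d)⁻¹ * W * c))
    (v : EuclideanSpace ℂ {j : Fin n // (j : ℕ) < b}) {E : Set (Fin n → ℂ)} (hE : MeasurableSet E)
    (hEv : ∀ y ∈ E, ‖∑ j, ((((√d)⁻¹ : ℝ) : ℂ) * star (σ (y j))) • extendProj H j - v‖ ≤ ρ) :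
    (Measure.pi fun _ => sparseEntryLaw ν p).real E ≤
      Real.exp (N - 3 / 10 * (p * ν.real {y | c ≤ ‖y‖} * (L + 1))) + N.choose (N / 2) / 2 ^ N := by
  classical
  rw [← card_filter_extendProj H hW] at hL
  have hκ : (0 : ℝ) ≤ (√d)⁻¹ := by positivity
  have hmain := measureReal_ball_sum_le (sparseEntryLaw ν p)
    (fun j y => ((((√d)⁻¹ : ℝ) : ℂ) * star (σ y)) • extendProj H j)
    (Finset.univ.filter fun j => W < ‖extendProj H j‖) (mul_nonneg hκ hW) (fun j hj y y' => by
      rw [← sub_smul, ← mul_sub, norm_smul, norm_mul, hσ, Complex.norm_real, norm_inv,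
        Real.norm_of_nonneg (Real.sqrt_nonneg _)]
      have := (Finset.mem_filter.1 hj).2.le
      calc (√d)⁻¹ * W * ‖y - y'‖ = (√d)⁻¹ * ‖y - y'‖ * W := by ring
        _ ≤ _ := by gcongr) (le_prod_sparseEntryLaw_real p hc hp) N hρ v hE hEv
  refine hmain.trans (add_le_add (Real.exp_le_exp.2 ?_) le_rfl)
  have he : (3 : ℝ) / 5 ≤ 1 - Real.exp (-1) := by
    have := Real.exp_neg_one_lt_d9
    linarith
  have hL' : (L : ℝ) + 1 ≤ (Finset.univ.filter fun j => W < ‖extendProj H j‖).card := by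
    exact_mod_cast hL
  have h0 : 0 ≤ (p : ℝ) * ν.real {y | c ≤ ‖y‖} := mul_nonneg p.2.1 measureReal_nonneg
  have h5 : 3 / 5 * (p * ν.real {y | c ≤ ‖y‖} / 2) * (L + 1) ≤
      (1 - Real.exp (-1)) * (p * ν.real {y | c ≤ ‖y‖} / 2) *
        (Finset.univ.filter fun j => W < ‖extendProj H j‖).card := by
    gcongr
  linarith

end StepProbability

/-! ### Numerical estimates for the allowed errors -/

section StepNumerics

open Module

/-- A bound for the conditional probability that a step fails, in terms of the mean number `d` of
nonzero entries per row; `c₁` is the probability that `ξ` has modulus at least `c`. The first bracket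
serves while many singular values are left, the second one near the end. -/
noncomputable def failBound (c c₁ d : ℝ) : ℝ :=
  (Real.exp (-(c₁ * (d ^ (1 / 4 : ℝ)) ^ 3 / 880)) +
      123904 * (16 / c₁ / c) ^ 2 / (c₁ * (d ^ (1 / 4 : ℝ)) ^ 2) +
      174456832 * (16 / c₁ / c) ^ 4 / (c₁ ^ 2 * d ^ (1 / 4 : ℝ))) +
    (Real.exp (⌊√(Real.log d)⌋₊ - 3 / 40 * c₁ * Real.log d) +
      (⌊√(Real.log d)⌋₊.choose (⌊√(Real.log d)⌋₊ / 2) : ℝ) / 2 ^ ⌊√(Real.log d)⌋₊)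

/-- As long as `u = n / (n - r)` is at most `d ^ (1 / 4)`, the scale `exp (-(log u)^2)` lies below the
typical length of the projection of a row, which is a power of `u`. -/
theorem coarse_scale {c c₁ : ℝ} (hc : 0 < c) (hc₁ : 0 < c₁) : ∃ X : ℝ, ∀ d u s : ℝ,
    X ≤ u → u ^ 4 ≤ d → 1 / (11 * u) ≤ s → 32 ≤ c₁ * d * s ∧
      2 * Real.exp (-Real.log u ^ 2) ^ 2 ≤ c₁ * c ^ 2 * s ^ 2 / 256 := by
  refine ⟨max 5 (max (352 / c₁) (61952 / (c₁ * c ^ 2))), fun d u s hu hd hs => ?_⟩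
  have h5 : 5 ≤ u := (le_max_left _ _).trans hu
  have h1 : 352 / c₁ ≤ u := ((le_max_left _ _).trans (le_max_right _ _)).trans hu
  have h2 : 61952 / (c₁ * c ^ 2) ≤ u := ((le_max_right _ _).trans (le_max_right _ _)).trans hu
  have hu0 : 0 < u := by linarith
  rw [div_le_iff₀ (by positivity)] at h1 h2
  constructor
  · have h3 : u ≤ u ^ 3 := le_self_pow₀ (by linarith) (by norm_num)
    calc (32 : ℝ) ≤ c₁ * u / 11 := by linarith
      _ ≤ c₁ * u ^ 3 / 11 := by gcongr
      _ = c₁ * u ^ 4 * (1 / (11 * u)) := by field_simp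
      _ ≤ c₁ * d * (1 / (11 * u)) := by gcongr
      _ ≤ _ := by
        have : 0 ≤ c₁ * d := mul_nonneg hc₁.le ((pow_nonneg hu0.le 4).trans hd)
        gcongr
  · have hl : 3 / 2 ≤ Real.log u := by
      rw [Real.le_log_iff_exp_le hu0]
      refine le_trans ?_ h5
      have : Real.exp (3 / 2) ^ 2 ≤ 5 ^ 2 := by
        rw [← Real.exp_nat_mul]
        have h6 : Real.exp ((2 : ℕ) * (3 / 2)) = Real.exp 1 ^ 3 := by
          rw [← Real.exp_nat_mul]; norm_num
        rw [h6]
        have := Real.exp_one_lt_d9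
        calc Real.exp 1 ^ 3 ≤ 2.8 ^ 3 := by
              gcongr
              linarith
          _ ≤ _ := by norm_num
      exact le_of_sq_le_sq this (by norm_num)
    have h3 : Real.exp (-Real.log u ^ 2) ^ 2 ≤ (u ^ 3)⁻¹ := by
      have h6 : (u ^ 3)⁻¹ = Real.exp (-(3 * Real.log u)) := by
        rw [Real.exp_neg, ← Real.exp_log hu0, ← Real.exp_nat_mul, Real.log_exp]
        norm_num
      rw [h6, ← Real.exp_nat_mul, Real.exp_le_exp]
      push_cast
      nlinarith
    calc 2 * Real.exp (-Real.log u ^ 2) ^ 2 ≤ 2 * (u ^ 3)⁻¹ := by gcongr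
      _ ≤ c₁ * c ^ 2 * (1 / (11 * u)) ^ 2 / 256 := by
          rw [← div_eq_mul_inv, div_le_iff₀ (by positivity)]
          have : c₁ * c ^ 2 * (1 / (11 * u)) ^ 2 / 256 * u ^ 3 = u * (c₁ * c ^ 2) / 30976 := by
            field_simp
            norm_num
          rw [this]
          linarith
      _ ≤ _ := by gcongr

theorem two_point_seven_pow_le_exp (k : ℕ) : (2.7 : ℝ) ^ k ≤ Real.exp k := by
  have h : Real.exp k = Real.exp 1 ^ k := by rw [← Real.exp_nat_mul, mul_one]
  rw [h]
  have := Real.exp_one_gt_d9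
  gcongr
  linarith

/-- The number of rounds after which peeling at the rate `peelRate` exhausts a column set. -/
theorem one_sub_peelRate_pow_mul_lt {u : ℝ} {n h L : ℕ} (hu : 1 ≤ u) (hh : 1 ≤ h)
    (hnh : (n : ℝ) ≤ 11 * h * u) (hLn : L ≤ n) (hhn : h ≤ n) :
    (1 - peelRate n ((h : ℝ) / 4)) ^ ⌈(Real.log u + 6) ^ 2⌉₊ * L < (h : ℝ) / 4 := by
  have hu0 : 0 < u := by linarith
  have hh0 : (0 : ℝ) < h := by exact_mod_cast hh
  have hhn' : (h : ℝ) ≤ n := by exact_mod_cast hhn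
  have hn0 : (0 : ℝ) < n := hh0.trans_le hhn'
  have hLn' : (L : ℝ) ≤ n := by exact_mod_cast hLn
  set lam := Real.log u with hlam
  have hlam0 : 0 ≤ lam := Real.log_nonneg hu
  have hlog44 : Real.log (n / (h / 4)) ≤ lam + 4 := by
    have h1 : (n : ℝ) / (h / 4) ≤ 44 * u := by
      rw [div_le_iff₀ (by positivity)]
      linarith
    calc Real.log (n / (h / 4)) ≤ Real.log (44 * u) := Real.log_le_log (by positivity) h1
      _ = Real.log 44 + lam := Real.log_mul (by norm_num) hu0.ne'
      _ ≤ _ := by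
        have : Real.log 44 ≤ (4 : ℕ) := by
          rw [Real.log_le_iff_le_exp (by norm_num)]
          exact le_trans (by norm_num) (two_point_seven_pow_le_exp 4)
        push_cast at this
        linarith
  have hlog0 : 0 ≤ Real.log (n / (h / 4)) := by
    refine Real.log_nonneg ((one_le_div (by positivity)).2 ?_)
    linarith
  set D : ℕ := ⌈(lam + 6) ^ 2⌉₊ with hD
  set θ := peelRate n ((h : ℝ) / 4) with hθ
  have hθ1 : 1 / (lam + 6) ≤ θ := by
    rw [hθ, peelRate]
    exact one_div_le_one_div_of_le (by linarith) (by linarith)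
  have hθ2 : θ ≤ 1 := by
    rw [hθ, peelRate, div_le_one (by linarith)]
    linarith
  have hθD : lam + 6 ≤ θ * D := by
    have h6 : 0 < lam + 6 := by linarith
    calc lam + 6 = 1 / (lam + 6) * (lam + 6) ^ 2 := by field_simp
      _ ≤ 1 / (lam + 6) * D := by
          gcongr
          exact Nat.le_ceil _
      _ ≤ θ * D := by gcongr
  have h1 : (1 - θ) ^ D ≤ Real.exp (-(lam + 6)) := by
    calc (1 - θ) ^ D ≤ Real.exp (-θ) ^ D :=
          pow_le_pow_left₀ (by linarith) (by linarith [Real.add_one_le_exp (-θ)]) D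
      _ = Real.exp (-(θ * D)) := by rw [← Real.exp_nat_mul]; ring_nf
      _ ≤ _ := by gcongr
  have h2 : Real.exp (-(lam + 6)) = u⁻¹ * Real.exp (-6) := by
    rw [neg_add, Real.exp_add, Real.exp_neg, Real.exp_log hu0]
  have h3 : Real.exp (-6) < 1 / 44 := by
    have h5 := two_point_seven_pow_le_exp 6
    push_cast at h5
    rw [Real.exp_neg, one_div]
    exact inv_strictAnti₀ (by norm_num) (lt_of_lt_of_le (by norm_num) h5)
  have hu' : 0 < u⁻¹ := inv_pos.2 hu0
  calc (1 - θ) ^ D * L ≤ u⁻¹ * Real.exp (-6) * n := by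
        rw [← h2]
        exact mul_le_mul h1 hLn' (Nat.cast_nonneg _) (Real.exp_pos _).le
    _ < u⁻¹ * (1 / 44) * n := by gcongr
    _ ≤ u⁻¹ * (1 / 44) * (11 * h * u) := by gcongr
    _ = h / 4 := by field_simp; norm_num

/-- Losing a factor polynomial in `d = exp l` and `u = exp lam` in each of about `lam^2` rounds is
affordable at the scale `exp (-(l lam)^8)`. -/
theorem mul_pow_le_exp {l lam W q : ℝ} {D : ℕ} (hl : 10 ≤ l) (hlam : 1 ≤ lam)
    (hD : D = ⌈(lam + 6) ^ 2⌉₊) (hW0 : 0 ≤ W) (hW : W ≤ Real.exp (5 * l - l ^ 8 * lam ^ 8))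
    (hq0 : 0 ≤ q) (hq : q ≤ Real.exp (4 * (l * lam))) :
    44 * Real.exp lam * (W * q ^ D) ^ 2 ≤ 1 := by
  have hDle : (D : ℝ) ≤ 50 * lam ^ 2 := by
    have h1 := (Nat.ceil_lt_add_one (sq_nonneg (lam + 6))).le
    rw [← hD] at h1
    nlinarith
  have hqD : q ^ D ≤ Real.exp (200 * (l * lam ^ 3)) := by
    calc q ^ D ≤ Real.exp (4 * (l * lam)) ^ D := pow_le_pow_left₀ hq0 hq D
      _ = Real.exp (D * (4 * (l * lam))) := by rw [← Real.exp_nat_mul]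
      _ ≤ Real.exp (50 * lam ^ 2 * (4 * (l * lam))) :=
          Real.exp_le_exp.2 (mul_le_mul_of_nonneg_right hDle (by positivity))
      _ = _ := by ring_nf
  have hpow : 250 * (l * lam ^ 3) ≤ l ^ 8 * lam ^ 8 := by
    have h0 : (250 : ℝ) ≤ l ^ 7 :=
      le_trans (by norm_num) (pow_le_pow_left₀ (by norm_num) hl 7)
    have h1 : (250 : ℝ) * l ≤ l ^ 8 := by
      calc 250 * l ≤ l ^ 7 * l := mul_le_mul_of_nonneg_right h0 (by linarith)
        _ = _ := (pow_succ l 7).symm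
    have h2 : lam ^ 3 ≤ lam ^ 8 := pow_le_pow_right₀ hlam (by norm_num)
    calc 250 * (l * lam ^ 3) = 250 * l * lam ^ 3 := by ring
      _ ≤ _ := mul_le_mul h1 h2 (by positivity) (by positivity)
  have hlam3 : lam ≤ lam ^ 3 := le_self_pow₀ hlam (by norm_num)
  have h1lam3 : 1 ≤ lam ^ 3 := one_le_pow₀ hlam
  have hll : l ≤ l * lam ^ 3 := le_mul_of_one_le_right (by linarith) h1lam3
  have hWq : W * q ^ D ≤ Real.exp (-(20 * (l * lam ^ 3))) := by
    calc W * q ^ D ≤ Real.exp (5 * l - l ^ 8 * lam ^ 8) * Real.exp (200 * (l * lam ^ 3)) :=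
          mul_le_mul hW hqD (by positivity) (Real.exp_pos _).le
      _ = Real.exp (5 * l - l ^ 8 * lam ^ 8 + 200 * (l * lam ^ 3)) := (Real.exp_add _ _).symm
      _ ≤ _ := Real.exp_le_exp.2 (by linarith)
  have h2 : (44 : ℝ) ≤ Real.exp (10 : ℕ) :=
    le_trans (by norm_num) (two_point_seven_pow_le_exp 10)
  push_cast at h2
  calc 44 * Real.exp lam * (W * q ^ D) ^ 2
      ≤ Real.exp 10 * Real.exp lam * Real.exp (-(20 * (l * lam ^ 3))) ^ 2 := by
        have h3 : (W * q ^ D) ^ 2 ≤ Real.exp (-(20 * (l * lam ^ 3))) ^ 2 :=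
          pow_le_pow_left₀ (by positivity) hWq 2
        exact mul_le_mul (mul_le_mul_of_nonneg_right h2 (Real.exp_pos _).le) h3 (by positivity)
          (by positivity)
    _ = Real.exp (10 + lam + (2 : ℕ) * (-(20 * (l * lam ^ 3)))) := by
        rw [Real.exp_add, Real.exp_add, Real.exp_nat_mul]
    _ ≤ 1 := by
        rw [Real.exp_le_one_iff]
        push_cast
        have h3 : 10 * lam ^ 3 ≤ l * lam ^ 3 := mul_le_mul_of_nonneg_right hl (by linarith)
        linarith

/-- The parameters of the peeling argument: at the scale `exp (-(log d log u)^8)` it is enough to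
lose a factor polynomial in `d` and `u` in each of `(log u)^2` rounds. -/
theorem fine_scale {c : ℝ} (hc : 0 < c) (hc1 : c ≤ 1) {x : ℝ} (hx : 0 < x) : ∃ X : ℝ, 1 ≤ X ∧
    ∀ (d u C : ℝ) (n h L N : ℕ), X ≤ d → 3 ≤ u → 1 ≤ C → 1 ≤ h → (n : ℝ) ≤ 11 * h * u → L ≤ n →
      h ≤ n → (N : ℝ) ≤ Real.log d →
      ∃ (c' W q : ℝ) (D : ℕ), 0 < c' ∧ c' ≤ x ∧ c' ≤ (√d)⁻¹ * c ∧
        Real.exp (-(C * Real.log d ^ 8 * Real.log u ^ 8)) ≤ W ∧ 1 ≤ q ∧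
        1 + (4 * (n * d / h) + x) ≤ q * c' ∧
        (1 - peelRate n ((h : ℝ) / 4)) ^ D * L < (h : ℝ) / 4 ∧
        n * (W * q ^ D) ^ 2 ≤ (h : ℝ) / 4 ∧
        2 * Real.exp (-(C * Real.log d ^ 8 * Real.log u ^ 8)) <
          (1 / 8 : ℝ) ^ N * ((√d)⁻¹ * W * c) := by
  set m := min x c with hm
  have hm0 : 0 < m := lt_min hx hc
  set B₀ := Real.log ((45 + x) / m) with hB₀
  refine ⟨Real.exp (max 10 (max B₀ (-Real.log c))), Real.one_le_exp (le_max_of_le_left (by norm_num)),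
    fun d u C n h L N hd hu hC hh hnh hLn hhn hN => ?_⟩
  have hd0 : 0 < d := (Real.exp_pos _).trans_le hd
  have hu0 : 0 < u := by linarith
  have hl := (Real.le_log_iff_exp_le hd0).2 hd
  set l := Real.log d with hldef
  have hl10 : 10 ≤ l := (le_max_left _ _).trans hl
  have hlB : B₀ ≤ l := ((le_max_left _ _).trans (le_max_right _ _)).trans hl
  have hlc : -Real.log c ≤ l := ((le_max_right _ _).trans (le_max_right _ _)).trans hl
  have hd1 : 1 ≤ d := by
    refine le_trans ?_ hd
    exact Real.one_le_exp (le_max_of_le_left (by norm_num))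
  set lam := Real.log u with hlam
  have hlam1 : 1 ≤ lam := by
    rw [hlam, Real.le_log_iff_exp_le hu0]
    have := Real.exp_one_lt_d9
    linarith
  have hh0 : (0 : ℝ) < h := by exact_mod_cast hh
  have hn0 : (0 : ℝ) < n := hh0.trans_le (by exact_mod_cast hhn)
  have hsd0 : 0 < √d := Real.sqrt_pos.2 hd0
  have hsd1 : 1 ≤ √d := by rwa [Real.one_le_sqrt]
  set ρ := Real.exp (-(C * l ^ 8 * lam ^ 8)) with hρ
  have hρ0 : 0 < ρ := Real.exp_pos _
  set W := 3 * 8 ^ N * √d * ρ / c with hW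
  have hW0 : 0 < W := by positivity
  set q := (45 + x) / m * (u * d * √d) with hq
  set D : ℕ := ⌈(lam + 6) ^ 2⌉₊ with hD
  have hud : 1 ≤ u * d := by nlinarith
  have hnd : (n : ℝ) * d / h ≤ 11 * (u * d) := by
    rw [div_le_iff₀ hh0]
    calc (n : ℝ) * d ≤ 11 * h * u * d := by gcongr
      _ = _ := by ring
  have hq1 : 1 ≤ q := by
    have h1 : 1 ≤ (45 + x) / m := by
      rw [one_le_div hm0]
      have := min_le_left x c
      linarith
    have h2 : 1 ≤ u * d * √d := by nlinarith
    nlinarith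
  refine ⟨m / √d, W, q, D, by positivity, ?_, ?_, ?_, hq1, ?_, ?_, ?_, ?_⟩
  · exact (div_le_self hm0.le hsd1).trans (min_le_left _ _)
  · rw [div_eq_inv_mul]
    gcongr
    exact min_le_right _ _
  · rw [hW, le_div_iff₀ hc]
    have h8 : (1 : ℝ) ≤ 8 ^ N := one_le_pow₀ (by norm_num)
    have h9 : 1 ≤ 3 * 8 ^ N * √d := by
      calc (1 : ℝ) ≤ 8 ^ N * 1 := by linarith
        _ ≤ 8 ^ N * √d := by gcongr
        _ ≤ _ := by
          have : 0 ≤ 8 ^ N * √d := by positivity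
          linarith
    calc ρ * c ≤ ρ * 1 := by gcongr
      _ = 1 * ρ := by ring
      _ ≤ 3 * 8 ^ N * √d * ρ := by gcongr
  · have : q * (m / √d) = (45 + x) * (u * d) := by
      rw [hq]; field_simp
    rw [this]
    nlinarith
  · exact one_sub_peelRate_pow_mul_lt (by linarith) hh hnh hLn hhn
  · have hWexp : W ≤ Real.exp (5 * l - l ^ 8 * lam ^ 8) := by
      have h3 : (3 : ℝ) ≤ Real.exp (l / 5) := by
        refine le_trans ?_ (Real.exp_le_exp.2 (show (2 : ℝ) ≤ l / 5 by linarith))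
        have := Real.add_one_le_exp (2 : ℝ)
        linarith
      have h8 : (8 : ℝ) ^ N ≤ Real.exp (3 * l) := by
        have h81 : (8 : ℝ) ≤ Real.exp (3 : ℕ) :=
          le_trans (by norm_num) (two_point_seven_pow_le_exp 3)
        push_cast at h81
        calc (8 : ℝ) ^ N ≤ Real.exp 3 ^ N := by gcongr
          _ = Real.exp (N * 3) := by rw [← Real.exp_nat_mul]
          _ ≤ _ := Real.exp_le_exp.2 (by linarith)
      have hsd : √d = Real.exp (l / 2) := by rw [Real.exp_half, Real.exp_log hd0]
      have hci : c⁻¹ ≤ Real.exp l := by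
        rw [← Real.exp_log hc, ← Real.exp_neg]
        gcongr
      have hρ' : ρ ≤ Real.exp (-(l ^ 8 * lam ^ 8)) := by
        rw [hρ]
        gcongr
        exact le_mul_of_one_le_left (by positivity) hC
      calc W = 3 * 8 ^ N * √d * ρ * c⁻¹ := by rw [hW, div_eq_mul_inv]
        _ ≤ Real.exp (l / 5) * Real.exp (3 * l) * Real.exp (l / 2) *
            Real.exp (-(l ^ 8 * lam ^ 8)) * Real.exp l := by
            rw [hsd]
            gcongr
        _ = Real.exp (l / 5 + 3 * l + l / 2 + -(l ^ 8 * lam ^ 8) + l) := by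
            simp only [Real.exp_add]
        _ ≤ _ := by
            gcongr
            linarith
    have hqexp : q ≤ Real.exp (4 * (l * lam)) := by
      have h1 : (45 + x) / m ≤ Real.exp l := by
        rw [← Real.exp_log (show 0 < (45 + x) / m by positivity)]
        gcongr
      have hsd : √d = Real.exp (l / 2) := by rw [Real.exp_half, Real.exp_log hd0]
      calc q ≤ Real.exp l * (Real.exp lam * Real.exp l * Real.exp (l / 2)) := by
            rw [hq, hsd, Real.exp_log hu0, Real.exp_log hd0]
            gcongr
            rw [← Real.exp_log hd0]
            exact h1
        _ = Real.exp (l + (lam + l + l / 2)) := by simp only [Real.exp_add]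
        _ ≤ _ := by
            gcongr
            nlinarith
    have h44 := mul_pow_le_exp hl10 hlam1 hD hW0.le hWexp (by linarith) hqexp
    rw [Real.exp_log hu0] at h44
    calc (n : ℝ) * (W * q ^ D) ^ 2 ≤ 11 * h * u * (W * q ^ D) ^ 2 := by gcongr
      _ = h / 4 * (44 * u * (W * q ^ D) ^ 2) := by ring
      _ ≤ h / 4 * 1 := by gcongr
      _ = _ := mul_one _
  · have : (1 / 8 : ℝ) ^ N * ((√d)⁻¹ * W * c) = 3 * ρ := by
      rw [hW, one_div, inv_pow]
      field_simp
    rw [this]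
    linarith

end StepNumerics

/-! ### The conditional probability of a failing step -/

section StepFailureBound

open Module

theorem card_subtype_val_lt {n b : ℕ} (hb : b ≤ n) : Fintype.card {j : Fin n // (j : ℕ) < b} = b := by
  rw [Fintype.card_subtype, Fin.card_filter_val_lt, min_eq_right hb]

theorem failBound_nonneg {c c₁ d : ℝ} (hc₁ : 0 < c₁) (hd : 0 < d) : 0 ≤ failBound c c₁ d := by
  have : 0 < d ^ (1 / 4 : ℝ) := Real.rpow_pos_of_pos hd _
  unfold failBound
  positivity

theorem stepError_eq (n : ℕ) (d C : ℝ) (r : ℕ) (hn : 0 < n) : n * stepError n d C (r + 1) =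
    if ((r + 1 : ℕ) : ℝ) < n * (1 - d ^ (-(1 / 4 : ℝ))) then Real.log (n / (n - r)) ^ 2
    else C * Real.log d ^ 8 * Real.log (n / (n - r)) ^ 8 := by
  have hn0 : (n : ℝ) ≠ 0 := by exact_mod_cast hn.ne'
  have h1 : (n : ℝ) - ((r + 1 : ℕ) : ℝ) + 1 = n - r := by push_cast; ring
  rw [stepError, h1]
  split_ifs
  · field_simp
  · field_simp

variable {ν : Measure ℂ} [IsProbabilityMeasure ν]

/-- The conditional probability of failure of a step, for a past that is expanding. The isometry `σ` of
`ℂ` is the identity for a row; for a column, seen as a row of the conjugate transpose, it is the complex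
conjugation. -/
theorem exists_measureReal_rowFails_le (hν : ∫ x, ‖x‖ ^ 2 ∂ν = 1) {c : ℝ} (hc : 0 < c) (hc1 : c ≤ 1)
    (hc₁ : 0 < ν.real {y | c ≤ ‖y‖}) {x : ℝ} (hx : 0 < x) :
    ∃ X : ℝ, 1 ≤ X ∧ ∀ (p : unitInterval) (n : ℕ) (d C : ℝ) (z : ℂ) (A : Fin n → Fin n → ℂ) (a b r : ℕ)
      (σ : ℂ → ℂ), (p : ℝ) ≤ 1 / 2 → d = p * n → X ≤ d → 1 ≤ C → ‖z‖ = x → n ≤ 2 * a → a < n →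
      b ≤ a + 1 → r < b → n ≤ r + 11 * (b - r) → X * (n - r) ≤ n →
      Expanding A c d ⌊n * Real.log d / (4 * d)⌋₊ ∅ →
      (b ≤ a ∨ r + 2 ≤ b ∨
        ∃ e : Fin n, (e : ℕ) = a ∧ Expanding A c d ⌊n * Real.log d / (4 * d)⌋₊ {e}) →
      Isometry σ →
      (Measure.pi fun _ => sparseEntryLaw ν p).real {y | RowFails (replaceRow a A fun j => σ (y j))
        d z a b r (Real.exp (-(n * stepError n d C (r + 1))))} ≤
          failBound c (ν.real {y | c ≤ ‖y‖}) d := by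
  set c₁ := ν.real {y | c ≤ ‖y‖} with hc₁def
  obtain ⟨X₁, hX₁⟩ := coarse_scale hc hc₁
  obtain ⟨X₂, hX₂1, hX₂⟩ := fine_scale hc hc1 hx
  refine ⟨max 3 (max X₁ X₂), le_max_of_le_left (by norm_num), ?_⟩
  intro p n d C z A a b r σ hp hd hXd hC hz hna han hab hrb hnr hXn hexp hlast hσ
  have h3 : 3 ≤ max 3 (max X₁ X₂) := le_max_left _ _
  have hX₁' : X₁ ≤ max 3 (max X₁ X₂) := (le_max_left _ _).trans (le_max_right _ _)
  have hX₂' : X₂ ≤ max 3 (max X₁ X₂) := (le_max_right _ _).trans (le_max_right _ _)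
  set X := max 3 (max X₁ X₂) with hX
  have hd3 : 3 ≤ d := h3.trans hXd
  have hd0 : 0 < d := by linarith
  have hn : 0 < n := by omega
  have hn0 : (0 : ℝ) < n := by exact_mod_cast hn
  have hbn : b ≤ n := by omega
  have hrn : (0 : ℝ) < n - r := by
    have : (r : ℝ) < n := by exact_mod_cast (by omega : r < n)
    linarith
  set ρ := Real.exp (-(n * stepError n d C (r + 1))) with hρ
  set M := leadingBlock (shiftedMatrix A d z) a b with hM
  set H := (topSpace (Matrix.toEuclideanLin M) r)ᗮ with hH
  set E : Set (Fin n → ℂ) := {y | RowFails (replaceRow a A fun j => σ (y j)) d z a b r ρ} with hE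
  have hEm : MeasurableSet E := by
    refine (measurableSet_rowFails (n := n) d z a b r ρ).preimage ?_
    refine measurable_pi_lambda _ fun i => measurable_pi_lambda _ fun j => ?_
    by_cases hi : (i : ℕ) = a
    · simp only [replaceRow, hi, if_true]
      exact hσ.continuous.measurable.comp (measurable_pi_apply j)
    · simp only [replaceRow, hi, if_false]
      exact measurable_const
  rcases Set.eq_empty_or_nonempty E with hE0 | ⟨y₀, hy₀⟩
  · rw [hE0, measureReal_empty]
    exact failBound_nonneg hc₁ hd0
  have hker : ∀ u ∈ H, ‖Matrix.toEuclideanLin M u‖ ≤ ρ * ‖u‖ := by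
    have := (RowFails.norm_le hy₀ han).1
    rwa [leadingBlock_replaceRow] at this
  have hEv : ∀ y ∈ E, ‖∑ j, ((((√d)⁻¹ : ℝ) : ℂ) * star (σ (y j))) • extendProj H j -
      ∑ j : Fin n, (if a = (j : ℕ) then star z else 0) • extendProj H j‖ ≤ ρ := fun y hy =>
    norm_sum_extendProj_sub_le_of_rowFails han hH hy
  have hσ' : ∀ x y, ‖star (σ x) - star (σ y)‖ = ‖x - y‖ := by
    intro x y
    rw [← star_sub, norm_star, ← dist_eq_norm, hσ.dist_eq, dist_eq_norm]
  have hfin : finrank ℂ H = b - r := by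
    rw [hH, finrank_topSpace_orthogonal _ (by
      rw [finrank_euclideanSpace, card_subtype_val_lt hbn]; exact hrb.le), finrank_euclideanSpace,
      card_subtype_val_lt hbn]
  have hh1 : 1 ≤ finrank ℂ H := by omega
  have hh0 : (0 : ℝ) < finrank ℂ H := by exact_mod_cast hh1
  have hnr' : (n : ℝ) - r ≤ 11 * finrank ℂ H := by
    have : (n : ℝ) ≤ r + 11 * finrank ℂ H := by rw [hfin]; exact_mod_cast hnr
    linarith
  set u : ℝ := n / (n - r) with hu
  have hu0 : 0 < u := by positivity
  have hXu : X ≤ u := by rw [hu, le_div_iff₀ hrn]; exact hXn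
  have hnhu : (n : ℝ) ≤ 11 * finrank ℂ H * u := by
    calc (n : ℝ) = (n - r) * u := by rw [hu]; field_simp
      _ ≤ _ := by gcongr
  have hstep := stepError_eq n d C r hn
  rw [← hu] at hstep
  have hq₁ : 0 < d ^ (1 / 4 : ℝ) := Real.rpow_pos_of_pos hd0 _
  have hq4 : (d ^ (1 / 4 : ℝ)) ^ 4 = d := by
    rw [← Real.rpow_natCast, ← Real.rpow_mul hd0.le]
    norm_num
  set w := d ^ (1 / 4 : ℝ) with hw
  have hw' : d ^ (-(1 / 4 : ℝ)) = w⁻¹ := by rw [Real.rpow_neg hd0.le]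
  rw [hw'] at hstep
  by_cases hreg : ((r + 1 : ℕ) : ℝ) < n * (1 - w⁻¹)
  · -- many singular values are left: the scale is a power of `n / (n - r)` below the typical one
    rw [if_pos hreg] at hstep
    have huw : u ≤ w := by
      rw [hu, div_le_iff₀ hrn]
      have h1 : (n : ℝ) * w⁻¹ ≤ n - r := by
        push_cast at hreg
        linarith
      calc (n : ℝ) = w * (n * w⁻¹) := by field_simp
        _ ≤ _ := by gcongr
    have hu4 : u ^ 4 ≤ d := by
      rw [← hq4]
      gcongr
    set s : ℝ := finrank ℂ H / n with hs
    have hs0 : 0 < s := by positivity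
    have hsu : 1 / (11 * u) ≤ s := by
      rw [hs, div_le_div_iff₀ (by positivity) hn0]
      linarith
    have hsw : 1 / (11 * w) ≤ s := le_trans (by gcongr) hsu
    obtain ⟨h32, hρs⟩ := hX₁ d u s (hX₁'.trans hXu) hu4 hsu
    have hmain := measureReal_norm_sum_extendProj_le_coarse p hc hc₁
      (le_prod_sparseEntryLaw_real_and_le p hν hc hc₁ hp) hd hd0 hσ' H hs0 hs h32 (ρ := ρ) (by
        rw [hρ, hstep]; exact hρs) _ hEm hEv
    refine hmain.trans ?_
    have hfine : 0 ≤ Real.exp (⌊√(Real.log d)⌋₊ - 3 / 40 * c₁ * Real.log d) +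
      (⌊√(Real.log d)⌋₊.choose (⌊√(Real.log d)⌋₊ / 2) : ℝ) / 2 ^ ⌊√(Real.log d)⌋₊ := by
      positivity
    rw [failBound]
    refine le_add_of_le_of_nonneg ?_ hfine
    have hds : w ^ 3 / 11 ≤ d * s := by
      calc w ^ 3 / 11 = w ^ 4 * (1 / (11 * w)) := by field_simp
        _ ≤ d * s := by rw [hq4]; gcongr
    have hds2 : w ^ 2 / 121 ≤ d * s ^ 2 := by
      calc w ^ 2 / 121 = w ^ 4 * (1 / (11 * w)) ^ 2 := by field_simp; norm_num
        _ ≤ d * s ^ 2 := by rw [hq4]; gcongr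
    have hdn : d ≤ n := by
      rw [hd]
      have := p.2.2
      exact mul_le_of_le_one_left hn0.le this
    have hns3 : w / 1331 ≤ n * s ^ 3 := by
      calc w / 1331 = w ^ 4 * (1 / (11 * w)) ^ 3 := by field_simp; norm_num
        _ ≤ n * s ^ 3 := by rw [hq4]; gcongr
    refine add_le_add (add_le_add (Real.exp_le_exp.2 ?_) ?_) ?_
    · have : c₁ * (w ^ 3 / 11) ≤ c₁ * (d * s) := by gcongr
      linarith
    · calc 1024 * (16 / c₁ / c) ^ 2 / (c₁ * d * s ^ 2)
          = 1024 * (16 / c₁ / c) ^ 2 / (c₁ * (d * s ^ 2)) := by rw [mul_assoc]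
        _ ≤ 1024 * (16 / c₁ / c) ^ 2 / (c₁ * (w ^ 2 / 121)) := by gcongr
        _ = _ := by simp only [← hw]; field_simp; ring
    · calc 131072 * (16 / c₁ / c) ^ 4 / (c₁ ^ 2 * n * s ^ 3)
          = 131072 * (16 / c₁ / c) ^ 4 / (c₁ ^ 2 * (n * s ^ 3)) := by rw [mul_assoc]
        _ ≤ 131072 * (16 / c₁ / c) ^ 4 / (c₁ ^ 2 * (w / 1331)) := by gcongr
        _ = _ := by simp only [← hw]; field_simp; ring
  · -- few singular values are left: the scale is fine enough for peeling
    rw [if_neg hreg] at hstep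
    have hl1 : 1 ≤ Real.log d := by
      rw [Real.le_log_iff_exp_le hd0]
      have := Real.exp_one_lt_d9
      linarith
    have hld : Real.log d ≤ d := (Real.log_le_sub_one_of_pos hd0).trans (by linarith)
    set L := ⌊n * Real.log d / (4 * d)⌋₊ with hL
    set N := ⌊√(Real.log d)⌋₊ with hN
    have hLn : L ≤ n := by
      have h1 : (L : ℝ) ≤ n * Real.log d / (4 * d) := Nat.floor_le (by positivity)
      have h2 : n * Real.log d / (4 * d) ≤ n := by
        rw [div_le_iff₀ (by positivity)]
        gcongr
        linarith
      exact_mod_cast h1.trans h2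
    have hNl : (N : ℝ) ≤ Real.log d := by
      refine (Nat.floor_le (Real.sqrt_nonneg _)).trans ?_
      rw [Real.sqrt_le_left (by linarith)]
      exact le_self_pow₀ hl1 (by norm_num)
    obtain ⟨c', W, q, D, hc'0, hc'x, hc'c, hρW, hq1, hq, hD, hDW, hρN⟩ :=
      hX₂ d u C n (finrank ℂ H) L N (hX₂'.trans hXd) (h3.trans hXu) hC hh1 hnhu hLn (by omega) hNl
    rw [← hstep] at hρW hρN
    have hW0 : 0 ≤ W := (Real.exp_pos _).le.trans hρW
    have hcard := lt_card_filter_coordProj (A := A) (z := z) (a := a) (b := b) hn hna hab hbn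
      (by linarith) hc'0 (by rw [hz]; exact hc'x) hc'c hh1 (Real.exp_pos _).le hρW hker hq1
      (by rw [hz]; exact hq) hexp (hlast.imp_right (Or.imp_left fun h => by omega)) hD hDW
    have hmain := measureReal_norm_sum_extendProj_le_fine (ν := ν) p hc hp hσ' H hW0 hcard hρN _ hEm hEv
    refine hmain.trans ?_
    rw [failBound]
    refine le_add_of_nonneg_of_le (by positivity) (add_le_add (Real.exp_le_exp.2 ?_) le_rfl)
    have hpL : Real.log d / 4 ≤ p * (L + 1) := by
      have h1 := (Nat.lt_floor_add_one (n * Real.log d / (4 * d))).le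
      rw [← hL] at h1
      calc Real.log d / 4 = p * (n * Real.log d / (4 * d)) := by
            have : (p : ℝ) * (n * Real.log d / (4 * d)) = (p * n) * Real.log d / (4 * d) := by ring
            rw [this, ← hd]
            field_simp
        _ ≤ _ := mul_le_mul_of_nonneg_left h1 p.2.1
    have h2 : c₁ * (Real.log d / 4) ≤ c₁ * (p * (L + 1)) := by gcongr
    linarith

theorem tendsto_choose_half_div_two_pow :
    Tendsto (fun N : ℕ => (N.choose (N / 2) : ℝ) / 2 ^ N) atTop (𝓝 0) := by
  have h1 : ∀ N : ℕ, (N.choose (N / 2) : ℝ) / 2 ^ N ≤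
      2 * (((N / 2).centralBinom : ℝ) / 4 ^ (N / 2)) := by
    intro N
    rcases Nat.even_or_odd' N with ⟨k, rfl | rfl⟩
    · have h2 : 2 * k / 2 = k := by omega
      rw [h2, pow_mul, ← Nat.centralBinom_eq_two_mul_choose]
      norm_num
      have : (0 : ℝ) ≤ (k.centralBinom : ℝ) / 4 ^ k := by positivity
      linarith
    · have h2 : (2 * k + 1) / 2 = k := by omega
      rw [h2]
      have h3 : (2 * k + 1).choose k ≤ 2 ^ 2 * k.centralBinom := by
        have h4 := Nat.choose_mul_succ_eq (2 * k) k
        have h5 : 2 * k + 1 - k = k + 1 := by omega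
        rw [h5, ← Nat.centralBinom_eq_two_mul_choose] at h4
        have h6 : (k + 1) * (2 * k + 1).choose k ≤ (k + 1) * (2 ^ 2 * k.centralBinom) := by
          rw [mul_comm (k + 1), ← h4]
          calc k.centralBinom * (2 * k + 1) ≤ k.centralBinom * ((k + 1) * 2 ^ 2) := by
                gcongr; omega
            _ = _ := by ring
        exact Nat.le_of_mul_le_mul_left h6 (Nat.succ_pos k)
      have h3' : ((2 * k + 1).choose k : ℝ) ≤ 2 ^ 2 * k.centralBinom := by exact_mod_cast h3
      rw [pow_succ, pow_mul, div_le_iff₀ (by positivity)]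
      calc ((2 * k + 1).choose k : ℝ) ≤ 2 ^ 2 * k.centralBinom := h3'
        _ = _ := by
          have : (4 : ℝ) ^ k ≠ 0 := by positivity
          norm_num
          field_simp
          ring
  refine squeeze_zero (fun N => by positivity) h1 ?_
  have h2 : Tendsto (fun N : ℕ => N / 2) atTop atTop :=
    Nat.tendsto_div_const_atTop (by norm_num)
  simpa using (tendsto_centralBinom_div_four_pow.comp h2).const_mul 2

theorem tendsto_failBound {c c₁ : ℝ} (hc₁ : 0 < c₁) :
    Tendsto (failBound c c₁) atTop (𝓝 0) := by
  have hw : Tendsto (fun d : ℝ => d ^ (1 / 4 : ℝ)) atTop atTop := tendsto_rpow_atTop (by norm_num)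
  have h1 : Tendsto (fun d : ℝ => Real.exp (-(c₁ * (d ^ (1 / 4 : ℝ)) ^ 3 / 880))) atTop (𝓝 0) := by
    refine Real.tendsto_exp_atBot.comp (tendsto_neg_atTop_atBot.comp ?_)
    exact (((tendsto_pow_atTop (by norm_num)).comp hw).const_mul_atTop hc₁).atTop_div_const
      (by norm_num)
  have h2 : Tendsto (fun d : ℝ => 123904 * (16 / c₁ / c) ^ 2 / (c₁ * (d ^ (1 / 4 : ℝ)) ^ 2)) atTop
      (𝓝 0) :=
    Tendsto.const_div_atTop (((tendsto_pow_atTop (by norm_num)).comp hw).const_mul_atTop hc₁) _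
  have h3 : Tendsto (fun d : ℝ => 174456832 * (16 / c₁ / c) ^ 4 / (c₁ ^ 2 * d ^ (1 / 4 : ℝ))) atTop
      (𝓝 0) :=
    Tendsto.const_div_atTop (hw.const_mul_atTop (by positivity)) _
  have hs : Tendsto (fun d : ℝ => √(Real.log d)) atTop atTop :=
    Real.tendsto_sqrt_atTop.comp Real.tendsto_log_atTop
  have h4 : Tendsto (fun d : ℝ => Real.exp (⌊√(Real.log d)⌋₊ - 3 / 40 * c₁ * Real.log d)) atTop
      (𝓝 0) := by
    have h5 : Tendsto (fun x : ℝ => Real.exp (x * (1 - 3 / 40 * c₁ * x))) atTop (𝓝 0) := by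
      refine Real.tendsto_exp_atBot.comp ?_
      refine Tendsto.atTop_mul_atBot₀ tendsto_id ?_
      refine tendsto_atBot_add_const_left _ 1 ?_
      exact tendsto_neg_atTop_atBot.comp (tendsto_id.const_mul_atTop (by positivity))
    refine squeeze_zero' (Eventually.of_forall fun _ => (Real.exp_pos _).le) ?_ (h5.comp hs)
    filter_upwards [eventually_ge_atTop 1] with d hd
    have hl : 0 ≤ Real.log d := Real.log_nonneg hd
    simp only [Function.comp_apply]
    rw [Real.exp_le_exp]
    have h6 : (⌊√(Real.log d)⌋₊ : ℝ) ≤ √(Real.log d) := Nat.floor_le (Real.sqrt_nonneg _)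
    have h7 := Real.mul_self_sqrt hl
    calc _ ≤ √(Real.log d) - 3 / 40 * c₁ * (√(Real.log d) * √(Real.log d)) := by rw [h7]; gcongr
      _ = _ := by ring
  have h5 := tendsto_choose_half_div_two_pow.comp (tendsto_nat_floor_atTop.comp hs)
  have := ((h1.add h2).add h3).add (h4.add h5)
  simp only [add_zero] at this
  exact this

end StepFailureBound

/-! ### Decay of the height -/

section HeightDecay

open scoped ENNReal

theorem Expanding.star {n : ℕ} {A : Fin n → Fin n → ℂ} {c d : ℝ} {L : ℕ} {E : Finset (Fin n)}
    (h : Expanding A c d L E) : Expanding (fun i j => star (A i j)) c d L E := by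
  intro S hE h1 hL S₁ hS₁ hcard
  refine (h S hE h1 hL S₁ hS₁ hcard).imp (fun ⟨i, hi, h2⟩ => ⟨i, hi, ?_⟩)
    fun ⟨i, hi, hiS, h2⟩ => ⟨i, hi, hiS, ?_⟩
  · simpa [IsolatedRow] using h2
  · simpa [UniqueRow] using h2

/-- The blocks of the conjugate transpose are the conjugate transposes of the blocks, with the same
singular values. -/
theorem topProd_leadingBlock_star {n : ℕ} (A : Fin n → Fin n → ℂ) (d : ℝ) (z : ℂ) (a b r : ℕ) :
    topProd (leadingBlock (shiftedMatrix (fun i j => star (A j i)) d (star z)) a b) r =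
      topProd (leadingBlock (shiftedMatrix A d z) b a) r := by
  rw [← topProd_conjTranspose]
  congr 1
  ext i j
  change star (shiftedMatrix (fun i j => star (A j i)) d (star z) j i) = shiftedMatrix A d z i j
  rw [shiftedMatrix_apply, shiftedMatrix_apply, star_sub, star_mul', star_star]
  congr 1
  · simp
  · simp only [eq_comm (a := (j : Fin n))]
    split_ifs <;> simp

/-- The conditions on the pattern of nonzero entries under which every step of the process is likely
to succeed: expansion for rows, for columns, and for those last columns that may enter a block before
the row of the same index, while the height is minimal. -/
def RegularPattern {n : ℕ} (A : Fin n → Fin n → ℂ) (c d : ℝ) (L : ℕ) : Prop :=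
  Expanding A c d L ∅ ∧ Expanding (fun i j => A j i) c d L ∅ ∧
    ∀ e : Fin n, n ≤ e + 12 → Expanding A c d L {e}

variable {n : ℕ} {d C ε : ℝ} {z : ℂ}

theorem keptCount_le_takenCount (A : Fin n → Fin n → ℂ) (k : ℕ) :
    keptCount n ε ≤ takenCount A d C ε z k := by
  induction k with
  | zero => exact le_rfl
  | succ k ih =>
    rw [takenCount_succ]
    split_ifs <;> omega

theorem takenCount_succ_eq_iff (hn : 0 < n) {A : Fin n → Fin n → ℂ}
    (h0 : 0 < topProd (blockAtTime (shiftedMatrix A d z) (2 * minorSize n ε)) (keptCount n ε))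
    (k : ℕ) : takenCount A d C ε z (k + 1) = takenCount A d C ε z k ↔
      topProd (blockAtTime (shiftedMatrix A d z) (2 * minorSize n ε + k + 1))
          (takenCount A d C ε z k + 1) <
        topProd (blockAtTime (shiftedMatrix A d z) (2 * minorSize n ε + k))
          (takenCount A d C ε z k) *
          Real.exp (-(n * stepError n d C (takenCount A d C ε z k + 1))) := by
  rw [takenCount_succ, ← not_le, ← logSum_succ_le_iff hn (topProd_takenCount_pos hn h0 k)]
  split_ifs with h <;> simp [h]

variable {ν : Measure ℂ} [IsProbabilityMeasure ν]

/-- On a regular pattern, a step fails with small conditional probability as long as the height is at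
least a fixed proportion of the remaining time. -/
theorem exists_measureReal_takenCount_eq_le (hν : ∫ x, ‖x‖ ^ 2 ∂ν = 1) {c : ℝ} (hc : 0 < c)
    (hc1 : c ≤ 1) (hc₁ : 0 < ν.real {y | c ≤ ‖y‖}) {x : ℝ} (hx : 0 < x) :
    ∃ X : ℝ, 1 ≤ X ∧ ∀ (p : unitInterval) (n : ℕ) (d C ε : ℝ) (z : ℂ) (A : Fin n → Fin n → ℂ) (k : ℕ),
      (p : ℝ) ≤ 1 / 2 → d = p * n → X ≤ d → 1 ≤ C → ‖z‖ = x → n ≤ 2 * minorSize n ε →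
      2 * minorSize n ε + k < 2 * n → X * (n - keptCount n ε) ≤ n →
      RegularPattern A c d ⌊n * Real.log d / (4 * d)⌋₊ →
      0 < topProd (blockAtTime (shiftedMatrix A d z) (2 * minorSize n ε)) (keptCount n ε) →
      2 * n ≤ 2 * minorSize n ε + k +
        10 * (2 * minorSize n ε + k - 2 * takenCount A d C ε z k) →
      (Measure.pi fun _ => sparseEntryLaw ν p).real {w |
        takenCount (resampleAt (2 * minorSize n ε + k) A w) d C ε z (k + 1) =
          takenCount (resampleAt (2 * minorSize n ε + k) A w) d C ε z k} ≤
        failBound c (ν.real {y | c ≤ ‖y‖}) d := by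
  obtain ⟨X, hX1, hX⟩ := exists_measureReal_rowFails_le hν hc hc1 hc₁ hx
  refine ⟨X, hX1, ?_⟩
  intro p n d C ε z A k hp hd hXd hC hz hm hk hXn hreg h0 hactive
  have hn : 0 < n := by omega
  set s := 2 * minorSize n ε + k with hs
  set r := takenCount A d C ε z k with hr
  have hr0 : keptCount n ε ≤ r := keptCount_le_takenCount A k
  have hrs : 2 * r ≤ s := two_mul_takenCount_le hn h0 k
  have hXr : X * (n - r) ≤ n := by
    refine le_trans (mul_le_mul_of_nonneg_left ?_ (by linarith)) hXn
    have : (keptCount n ε : ℝ) ≤ r := by exact_mod_cast hr0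
    linarith
  have hstep : ∀ w, takenCount (resampleAt s A w) d C ε z (k + 1) =
      takenCount (resampleAt s A w) d C ε z k →
      0 < topProd (leadingBlock (shiftedMatrix (resampleAt s A w) d z) (s / 2) ((s + 1) / 2)) r ∧
      topProd (leadingBlock (shiftedMatrix (resampleAt s A w) d z) ((s + 1) / 2) ((s + 1 + 1) / 2))
        (r + 1) < topProd (leadingBlock (shiftedMatrix (resampleAt s A w) d z) (s / 2) ((s + 1) / 2))
        r * Real.exp (-(n * stepError n d C (r + 1))) := by
    intro w hw
    have hag := agreeAt_resampleAt s A w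
    have hrw : takenCount (resampleAt s A w) d C ε z k = r := takenCount_eq_of_agreeAt d C ε z hag
    have h0w : 0 < topProd (blockAtTime (shiftedMatrix (resampleAt s A w) d z)
        (2 * minorSize n ε)) (keptCount n ε) := by
      rwa [(hag.mono (s := 2 * minorSize n ε) (by omega)).blockAtTime_eq d z]
    have h1 := topProd_takenCount_pos (C := C) hn h0w k
    rw [takenCount_succ_eq_iff hn h0w] at hw
    rw [hrw] at hw h1
    exact ⟨h1, hw⟩
  rcases Nat.even_or_odd' s with ⟨a, ha | ha⟩
  · -- a column step is a row step for the conjugate transpose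
    have e1 : s / 2 = a := by omega
    have e2 : (s + 1) / 2 = a := by omega
    have e3 : (s + 1 + 1) / 2 = a + 1 := by omega
    rw [e1, e2, e3] at hstep
    refine le_trans (measureReal_mono (fun w hw => ?_) (measure_ne_top _ _))
      (hX p n d C (star z) (fun i j => star (A j i)) a a r star hp hd hXd hC (by rwa [norm_star])
        (by omega) (by omega) (by omega) (by omega) (by omega) hXr hreg.2.1.star (Or.inl le_rfl)
        (starₗᵢ ℂ).isometry)
    have hA : (replaceRow a (fun i j => star (A j i)) fun j => star (w j)) =
        fun i j => star (resampleAt s A w j i) := by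
      have h2 : ¬ s % 2 = 1 := by omega
      funext i j
      simp only [resampleAt, h2, if_false, e1, replaceRow]
      split_ifs <;> rfl
    change RowFails _ d (star z) a a r _
    rw [hA, RowFails, topProd_leadingBlock_star, topProd_leadingBlock_star]
    exact hstep w hw
  · have e1 : s / 2 = a := by omega
    have e2 : (s + 1) / 2 = a + 1 := by omega
    have e3 : (s + 1 + 1) / 2 = a + 1 := by omega
    rw [e1, e2, e3] at hstep
    refine le_trans (measureReal_mono (fun w hw => ?_) (measure_ne_top _ _))
      (hX p n d C z A a (a + 1) r id hp hd hXd hC hz (by omega) (by omega) (by omega) (by omega)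
        (by omega) hXr hreg.1 (Or.inr ?_) isometry_id)
    · have hA : (replaceRow a A fun j => id (w j)) = resampleAt s A w := by
        have h2 : s % 2 = 1 := by omega
        simp only [resampleAt, h2, if_true, e1, id]
      change RowFails _ d z a (a + 1) r _
      rw [hA, RowFails]
      exact hstep w hw
    · by_cases h : r + 2 ≤ a + 1
      · exact Or.inl h
      · exact Or.inr ⟨⟨a, by omega⟩, rfl, hreg.2.2 _ (by simp only; omega)⟩

/-- The drift theorem for twice the height, which is an integer. At the final time this integer is even, so
that the process ends at height `0` as soon as it ends below `2`. -/
theorem exists_measure_finalHeight_ne_zero_le (hν : ∫ x, ‖x‖ ^ 2 ∂ν = 1) {c : ℝ} (hc : 0 < c)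
    (hc1 : c ≤ 1) (hc₁ : 0 < ν.real {y | c ≤ ‖y‖}) {x : ℝ} (hx : 0 < x) :
    ∃ X : ℝ, 1 ≤ X ∧ ∀ (p : unitInterval) (n : ℕ) (d C ε : ℝ) (z : ℂ) (y : ℝ≥0∞),
      (p : ℝ) ≤ 1 / 2 → d = p * n → X ≤ d → 1 ≤ C → ‖z‖ = x → n ≤ 2 * minorSize n ε →
      minorSize n ε ≤ n → X * (n - keptCount n ε) ≤ n →
      20 * (minorSize n ε - keptCount n ε) ≤ 18 * (n - minorSize n ε) + 10 → 2 ≤ y → y ≠ ⊤ →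
      y ^ 20 * ENNReal.ofReal (failBound c (ν.real {y | c ≤ ‖y‖}) d) ≤ 1 →
      y ^ 10 * sparseArrayLaw n ν p {A |
        0 < topProd (blockAtTime (shiftedMatrix A d z) (2 * minorSize n ε)) (keptCount n ε) ∧
        RegularPattern A c d ⌊n * Real.log d / (4 * d)⌋₊ ∧ finalHeight A d C ε z ≠ 0} ≤ 3 := by
  obtain ⟨X, hX1, hX⟩ := exists_measureReal_takenCount_eq_le hν hc hc1 hc₁ hx
  refine ⟨X, hX1, ?_⟩
  intro p n d C ε z y hp hd hXd hC hz hm hmn hXn hG hy hyt hq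
  have hn : 0 < n := by
    rcases Nat.eq_zero_or_pos n with rfl | h
    · simp at hd; linarith
    · exact h
  set m := minorSize n ε with hmdef
  set V : Set (Fin n → Fin n → ℂ) :=
    {A | 0 < topProd (blockAtTime (shiftedMatrix A d z) (2 * m)) (keptCount n ε)} with hV
  -- the horizon is `2 (n - m)` half-steps, and the initial height is small compared to it
  have hbd := measure_two_le_height_le (μ := sparseArrayLaw n ν p)
    (P := Measure.pi fun _ : Fin n => sparseEntryLaw ν p)
    (R := fun k => resampleAt (2 * m + k)) (fun k => measurePreserving_resampleAt p n _)
    (rel := fun k => AgreeAt (2 * m + k)) (fun k A A' h => h.mono (by omega))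
    (fun k A w => agreeAt_resampleAt _ A w) (fun k A A' w h => h.resampleAt w)
    (g := fun k A => 2 * m + k - 2 * takenCount A d C ε z k)
    (fun k => (measurable_from_top (f := fun t : ℕ => 2 * m + k - 2 * t)).comp
      (measurable_takenCount d C ε z hn k))
    (fun k A A' h => by simp only [takenCount_eq_of_agreeAt d C ε z h])
    (D := fun k => {A | takenCount A d C ε z (k + 1) = takenCount A d C ε z k})
    (fun k => measurableSet_eq_fun (measurable_takenCount d C ε z hn (k + 1))
      (measurable_takenCount d C ε z hn k))
    (fun k A A' h => by
      have h1 : AgreeAt (2 * m + (k + 1)) A A' := h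
      have h2 : AgreeAt (2 * m + k) A A' := h1.mono (by omega)
      simp only [Set.mem_ofPred_eq, takenCount_eq_of_agreeAt d C ε z h1,
        takenCount_eq_of_agreeAt d C ε z h2])
    (V := V) (measurableSet_lt measurable_const
      (continuous_topProd_leadingBlock d z _ _ _).measurable)
    (fun A A' h => by
      have h1 : AgreeAt (2 * m) A A' := h
      simp only [hV, Set.mem_ofPred_eq, h1.blockAtTime_eq d z])
    (K := 2 * (n - m)) (G := 2 * (m - keptCount n ε))
    (fun k _ A _ => by
      have h1 := takenCount_succ d C ε z A k
      split_ifs at h1 <;> omega)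
    (fun k _ A hA hAD => by
      have h1 := takenCount_succ d C ε z A k
      have h2 := two_mul_takenCount_le (C := C) hn hA (k + 1)
      simp only [Set.mem_ofPred_eq] at hAD
      split_ifs at h1 <;> omega)
    (fun A => by simp only [takenCount]; omega) hy hq
  have hy1 : 1 ≤ y := le_trans (by norm_num) hy
  have h1 : (2 : ℝ≥0∞) ^ (2 * (n - m)) * y ^ (10 * (2 * (m - keptCount n ε))) ≤
      y ^ (10 * (2 * (n - m)) + 10) := by
    calc (2 : ℝ≥0∞) ^ (2 * (n - m)) * y ^ (10 * (2 * (m - keptCount n ε)))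
        ≤ y ^ (2 * (n - m)) * y ^ (10 * (2 * (m - keptCount n ε))) := by gcongr
      _ = y ^ (2 * (n - m) + 10 * (2 * (m - keptCount n ε))) := (pow_add _ _ _).symm
      _ ≤ _ := pow_le_pow_right₀ hy1 (by omega)
  have hY0 : y ^ (10 * (2 * (n - m)) + 10) ≠ 0 := pow_ne_zero _ (by
    rintro rfl; simp at hy1)
  have hYt : y ^ (10 * (2 * (n - m)) + 10) ≠ ⊤ := ENNReal.pow_ne_top hyt
  rw [← ENNReal.mul_le_mul_iff_right hY0 hYt, ← mul_assoc, ← pow_add]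
  refine (mul_le_mul' le_rfl (measure_mono fun A hA => ?_)).trans (hbd.trans ?_)
  · obtain ⟨hAV, hreg, hfin⟩ := hA
    refine ⟨hAV, ?_, fun k hk hact => ?_⟩
    · have h1 := two_mul_takenCount_le (C := C) hn hAV (2 * (n - m))
      by_contra h2
      have h3 : takenCount A d C ε z (2 * (n - m)) = n := by omega
      refine hfin ?_
      rw [finalHeight, height, h3, ← hmdef]
      push_cast [hmn]
      ring
    · have h1 := hX p n d C ε z A k hp hd hXd hC hz hm (by omega) hXn hreg hAV (by omega)
      rw [Measure.real, ← ENNReal.le_ofReal_iff_toReal_le (measure_ne_top _ _)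
        (failBound_nonneg hc₁ (by linarith))] at h1
      exact h1
  · calc _ ≤ y ^ (10 * (2 * (n - m)) + 10) + 2 * y ^ (10 * (2 * (n - m)) + 10) := by gcongr
      _ = _ := by ring

end HeightDecay

/-! ### The rank of the initial minor -/

section InitialMinor

open Module
open scoped ENNReal

variable {n : ℕ} {d : ℝ} {z : ℂ}

theorem topProd_leadingBlock_mono (M : Matrix (Fin n) (Fin n) ℂ) {a a' : ℕ} (h : a ≤ a') (b r : ℕ) :
    topProd (leadingBlock M a b) r ≤ topProd (leadingBlock M a' b) r := by
  refine topProd_le_of_forall_le (fun j => ?_) r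
  let f : {i : Fin n // (i : ℕ) < a} → {i : Fin n // (i : ℕ) < a'} :=
    fun i => ⟨i, i.2.trans_le h⟩
  have hf : Function.Injective f := fun i i' h => by
    have h1 := congrArg Subtype.val h
    exact Subtype.ext h1
  exact singularValues_submatrix_le (leadingBlock M a' b) hf Function.injective_id j

/-- Row `a` leaves the rank of the first `b` columns at a value below `r₀`. -/
def RankStalls (A : Fin n → Fin n → ℂ) (d : ℝ) (z : ℂ) (b r₀ a : ℕ) : Prop :=
  ∃ r < r₀, 0 < topProd (leadingBlock (shiftedMatrix A d z) a b) r ∧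
    topProd (leadingBlock (shiftedMatrix A d z) (a + 1) b) (r + 1) = 0

theorem measurableSet_rankStalls (d : ℝ) (z : ℂ) (b r₀ a : ℕ) :
    MeasurableSet {A : Fin n → Fin n → ℂ | RankStalls A d z b r₀ a} := by
  have h1 : {A : Fin n → Fin n → ℂ | RankStalls A d z b r₀ a} = ⋃ r ∈ Set.Iio r₀,
      ({A | 0 < topProd (leadingBlock (shiftedMatrix A d z) a b) r} ∩
        {A | topProd (leadingBlock (shiftedMatrix A d z) (a + 1) b) (r + 1) = 0}) := by
    ext A
    simp only [RankStalls, Set.mem_ofPred_eq, Set.mem_iUnion, Set.mem_inter_iff, Set.mem_Iio,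
      exists_prop]
  rw [h1]
  exact MeasurableSet.biUnion (Set.to_countable _) fun r _ =>
    (measurableSet_lt measurable_const (continuous_topProd_leadingBlock d z _ _ _).measurable).inter
      (measurableSet_eq_fun (continuous_topProd_leadingBlock d z _ _ _).measurable measurable_const)

/-- If the rank of the minor is small, then many rows stall. -/
theorem sub_le_card_filter_rankStalls (A : Fin n → Fin n → ℂ) (d : ℝ) (z : ℂ) (m r₀ : ℕ)
    [DecidablePred (RankStalls A d z m r₀)]
    (h : ¬ 0 < topProd (leadingBlock (shiftedMatrix A d z) m m) r₀) :
    m - r₀ ≤ ((Finset.range m).filter (RankStalls A d z m r₀)).card := by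
  have key : ∀ a ≤ m, ∃ r < r₀, 0 < topProd (leadingBlock (shiftedMatrix A d z) a m) r ∧
      a ≤ r + ((Finset.range a).filter (RankStalls A d z m r₀)).card := by
    intro a
    induction a with
    | zero =>
      intro _
      refine ⟨0, Nat.pos_of_ne_zero ?_, by simp [topProd], by simp⟩
      rintro rfl
      exact h (by simp [topProd])
    | succ a ih =>
      intro ha
      obtain ⟨r, hr, h0, hcard⟩ := ih (by omega)
      rw [Finset.range_add_one, Finset.filter_insert]
      by_cases h1 : 0 < topProd (leadingBlock (shiftedMatrix A d z) (a + 1) m) (r + 1)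
      · refine ⟨r + 1, ?_, h1, ?_⟩
        · refine lt_of_le_of_ne hr fun h2 => h ?_
          rw [← h2]
          exact h1.trans_le (topProd_leadingBlock_mono _ ha m _)
        · have h2 : ((Finset.range a).filter (RankStalls A d z m r₀)).card ≤ (if RankStalls A d z m r₀ a
              then insert a ((Finset.range a).filter (RankStalls A d z m r₀)) else
                (Finset.range a).filter (RankStalls A d z m r₀)).card := by
            refine Finset.card_le_card ?_
            split_ifs
            · exact Finset.subset_insert _ _
            · exact subset_rfl
          omega
      · have h2 : RankStalls A d z m r₀ a :=
          ⟨r, hr, h0, le_antisymm (not_lt.1 h1) (topProd_nonneg _ _)⟩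
        refine ⟨r, hr, h0.trans_le (topProd_leadingBlock_mono _ (by omega) m _), ?_⟩
        rw [if_pos h2, Finset.card_insert_of_notMem (by simp)]
        omega
  obtain ⟨r, hr, -, hcard⟩ := key m le_rfl
  omega

variable {ν : Measure ℂ} [IsProbabilityMeasure ν]

/-- A bound on the conditional probability that a row stalls, in terms of the proportion `s` of
the missing rank. -/
noncomputable def stallBound (c c₁ d n s : ℝ) : ℝ :=
  Real.exp (-(c₁ * d * s / 80)) + 1024 * (16 / c₁ / c) ^ 2 / (c₁ * d * s ^ 2) +
    131072 * (16 / c₁ / c) ^ 4 / (c₁ ^ 2 * n * s ^ 3)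

/-- A stalling row is orthogonal to the kernel of the block above it, whose dimension is at least `b - r₀`;
this has a small probability by anticoncentration at any scale. -/
theorem measureReal_rankStalls_le (hν : ∫ x, ‖x‖ ^ 2 ∂ν = 1) {c : ℝ} (hc : 0 < c)
    (hc₁ : 0 < ν.real {y | c ≤ ‖y‖}) (p : unitInterval) (hp : (p : ℝ) ≤ 1 / 2) (hd : d = p * n)
    (hd0 : 0 < d) {a b r₀ : ℕ} (ha : a < n) (hb : b ≤ n) {s : ℝ} (hs : 0 < s)
    (hsb : n * s ≤ b - r₀) (hds : 32 ≤ ν.real {y | c ≤ ‖y‖} * d * s) (A : Fin n → Fin n → ℂ) :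
    (Measure.pi fun _ => sparseEntryLaw ν p).real
      {y | RankStalls (replaceRow a A y) d z b r₀ a} ≤
        stallBound c (ν.real {y | c ≤ ‖y‖}) d n s := by
  set c₁ := ν.real {y | c ≤ ‖y‖} with hc₁def
  have hn0 : (0 : ℝ) < n := by exact_mod_cast (Nat.zero_le a).trans_lt ha
  set E : Set (Fin n → ℂ) := {y | RankStalls (replaceRow a A y) d z b r₀ a} with hE
  rcases Set.eq_empty_or_nonempty E with hE0 | ⟨y₀, r, hr, h0, h1⟩
  · rw [hE0, measureReal_empty, stallBound]
    positivity
  rw [leadingBlock_replaceRow] at h0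
  have hzero : ∀ {y r}, topProd (leadingBlock (shiftedMatrix (replaceRow a A y) d z) (a + 1) b)
      (r + 1) = 0 → ¬ 0 < topProd (leadingBlock (shiftedMatrix A d z) a b) (r + 1) := by
    intro y r h
    have h2 := topProd_leadingBlock_mono (shiftedMatrix (replaceRow a A y) d z) (Nat.le_succ a) b
      (r + 1)
    rw [leadingBlock_replaceRow] at h2
    exact not_lt.2 (h2.trans_eq h)
  -- the block without the new row determines the rank at which the stall happens
  have huniq : ∀ {r r'}, 0 < topProd (leadingBlock (shiftedMatrix A d z) a b) r →
      ¬ 0 < topProd (leadingBlock (shiftedMatrix A d z) a b) (r' + 1) → r ≤ r' := by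
    intro r r' h h'
    by_contra hlt
    rw [topProd_pos_iff] at h h'
    exact h' fun j hj => h j (by omega)
  have hEr : ∀ y ∈ E, ∀ ρ > 0, RowFails (replaceRow a A y) d z a b r ρ := by
    rintro y ⟨r', -, h0', h1'⟩ ρ hρ
    rw [leadingBlock_replaceRow] at h0'
    obtain rfl : r = r' := le_antisymm (huniq h0 (hzero h1')) (huniq h0' (hzero h1))
    refine ⟨by rwa [leadingBlock_replaceRow], ?_⟩
    rw [h1', leadingBlock_replaceRow]
    positivity
  have hrb : r < b := by
    have h2 : (0 : ℝ) < n * s := by positivity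
    have h3 : (r₀ : ℝ) < b := by linarith
    exact hr.trans (by exact_mod_cast h3)
  set H := (topSpace (Matrix.toEuclideanLin (leadingBlock (shiftedMatrix A d z) a b)) r)ᗮ with hH
  have hfin : finrank ℂ H = b - r := by
    rw [hH, finrank_topSpace_orthogonal _ (by
      rw [finrank_euclideanSpace, card_subtype_val_lt hb]; exact hrb.le), finrank_euclideanSpace,
      card_subtype_val_lt hb]
  set s' : ℝ := finrank ℂ H / n with hs'
  have hss' : s ≤ s' := by
    rw [hs', le_div_iff₀ hn0, hfin, Nat.cast_sub hrb.le]
    have : (r : ℝ) ≤ r₀ := by exact_mod_cast hr.le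
    linarith
  have hs'0 : 0 < s' := hs.trans_le hss'
  obtain ⟨ρ, hρ0, hρ⟩ : ∃ ρ : ℝ, 0 < ρ ∧ 2 * ρ ^ 2 ≤ c₁ * c ^ 2 * s' ^ 2 / 256 := by
    have h2 : 0 < c₁ * c ^ 2 * s' ^ 2 / 256 := by positivity
    have h3 : Tendsto (fun ρ : ℝ => 2 * ρ ^ 2) (𝓝[>] 0) (𝓝 0) := by
      have h4 : Continuous fun ρ : ℝ => 2 * ρ ^ 2 := by fun_prop
      simpa using (h4.tendsto 0).mono_left nhdsWithin_le_nhds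
    obtain ⟨ρ, h5, h6⟩ := ((h3.eventually_lt_const h2).and self_mem_nhdsWithin).exists
    exact ⟨ρ, h6, h5.le⟩
  have hEm : MeasurableSet E := by
    refine (measurableSet_rankStalls (n := n) d z b r₀ a).preimage ?_
    refine measurable_pi_lambda _ fun i => measurable_pi_lambda _ fun j => ?_
    by_cases hi : (i : ℕ) = a
    · simp only [replaceRow, hi, if_true]
      exact measurable_pi_apply j
    · simp only [replaceRow, hi, if_false]
      exact measurable_const
  have hmain := measureReal_norm_sum_extendProj_le_coarse (ν := ν) p hc hc₁
    (le_prod_sparseEntryLaw_real_and_le p hν hc hc₁ hp) hd hd0 (σ := id)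
    (fun x y => by rw [← star_sub, norm_star]; rfl) H hs'0 rfl
    (hds.trans (by gcongr)) hρ _ hEm (fun y hy =>
      norm_sum_extendProj_sub_le_of_rowFails ha hH (hEr y hy ρ hρ0))
  refine hmain.trans ?_
  rw [stallBound]
  have e1 : Real.exp (-(c₁ * d * s' / 80)) ≤ Real.exp (-(c₁ * d * s / 80)) := by
    refine Real.exp_le_exp.2 ?_
    have : c₁ * d * s ≤ c₁ * d * s' := by gcongr
    linarith
  have e2 : 1024 * (16 / c₁ / c) ^ 2 / (c₁ * d * s' ^ 2) ≤
      1024 * (16 / c₁ / c) ^ 2 / (c₁ * d * s ^ 2) := by gcongr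
  have e3 : 131072 * (16 / c₁ / c) ^ 4 / (c₁ ^ 2 * n * s' ^ 3) ≤
      131072 * (16 / c₁ / c) ^ 4 / (c₁ ^ 2 * n * s ^ 3) := by gcongr
  exact add_le_add (add_le_add e1 e2) e3

/-- Markov's inequality for the number of stalling rows. -/
theorem sub_mul_measure_topProd_eq_zero_le (hν : ∫ x, ‖x‖ ^ 2 ∂ν = 1) {c : ℝ} (hc : 0 < c)
    (hc₁ : 0 < ν.real {y | c ≤ ‖y‖}) (p : unitInterval) (hp : (p : ℝ) ≤ 1 / 2) (hd : d = p * n)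
    (hd0 : 0 < d) {m r₀ : ℕ} (hm : m ≤ n) {s : ℝ} (hs : 0 < s)
    (hsb : n * s ≤ m - r₀) (hds : 32 ≤ ν.real {y | c ≤ ‖y‖} * d * s) :
    ((m - r₀ : ℕ) : ℝ≥0∞) * sparseArrayLaw n ν p
      {A | ¬ 0 < topProd (leadingBlock (shiftedMatrix A d z) m m) r₀} ≤
        m * ENNReal.ofReal (stallBound c (ν.real {y | c ≤ ‖y‖}) d n s) := by
  classical
  set q := ENNReal.ofReal (stallBound c (ν.real {y | c ≤ ‖y‖}) d n s) with hq
  let F : (Fin n → Fin n → ℂ) → ℝ≥0∞ := fun A =>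
    ∑ a ∈ Finset.range m, {A : Fin n → Fin n → ℂ | RankStalls A d z m r₀ a}.indicator 1 A
  have hF : Measurable F := Finset.measurable_sum _ fun a _ =>
    measurable_one.indicator (measurableSet_rankStalls d z m r₀ a)
  have h1 : ∀ a ∈ Finset.range m, sparseArrayLaw n ν p {A | RankStalls A d z m r₀ a} ≤ q := by
    intro a ha
    have han : a < n := (Finset.mem_range.1 ha).trans_le hm
    have hE := measurableSet_rankStalls (n := n) d z m r₀ a
    have hR := measurePreserving_replaceRow (ν := ν) p n a
    rw [← hR.measure_preimage hE.nullMeasurableSet, Measure.prod_apply (hR.measurable hE)]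
    refine (lintegral_mono fun A => ?_).trans (lintegral_const q).le |>.trans_eq (by
      rw [measure_univ, mul_one])
    have h2 := measureReal_rankStalls_le (z := z) hν hc hc₁ p hp hd hd0 han hm hs hsb hds A
    rw [hq]
    refine (ENNReal.le_ofReal_iff_toReal_le (measure_ne_top _ _) ?_).2 h2
    exact measureReal_nonneg.trans h2
  calc ((m - r₀ : ℕ) : ℝ≥0∞) * sparseArrayLaw n ν p
        {A | ¬ 0 < topProd (leadingBlock (shiftedMatrix A d z) m m) r₀}
      ≤ ((m - r₀ : ℕ) : ℝ≥0∞) * sparseArrayLaw n ν p {A | ((m - r₀ : ℕ) : ℝ≥0∞) ≤ F A} := by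
        refine mul_le_mul' le_rfl (measure_mono fun A hA => ?_)
        have h2 := sub_le_card_filter_rankStalls A d z m r₀ hA
        have h3 : F A = (((Finset.range m).filter (RankStalls A d z m r₀)).card : ℝ≥0∞) := by
          simp only [F, Set.indicator_apply, Set.mem_ofPred_eq, Pi.one_apply]
          rw [Finset.sum_boole]
        simp only [Set.mem_ofPred_eq]
        rw [h3]
        exact_mod_cast h2
    _ ≤ ∫⁻ A, F A ∂(sparseArrayLaw n ν p) := mul_meas_ge_le_lintegral hF _
    _ = ∑ a ∈ Finset.range m, sparseArrayLaw n ν p {A | RankStalls A d z m r₀ a} := by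
        rw [lintegral_finsetSum _ fun a _ =>
          measurable_one.indicator (measurableSet_rankStalls d z m r₀ a)]
        refine Finset.sum_congr rfl fun a _ => ?_
        exact lintegral_indicator_one (measurableSet_rankStalls d z m r₀ a)
    _ ≤ _ := by
        refine (Finset.sum_le_card_nsmul _ _ q h1).trans_eq ?_
        rw [Finset.card_range, nsmul_eq_mul]

end InitialMinor

/-! ### The initial and the final height with high probability -/

section HighProbability

open scoped ENNReal

variable {ν : Measure ℂ} [IsProbabilityMeasure ν]

theorem card_filter_le_add_twelve_le (n : ℕ) :
    (Finset.univ.filter fun e : Fin n => n ≤ e + 12).card ≤ 12 := by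
  refine (Finset.card_le_card_of_injOn (fun e : Fin n => n - 1 - e) (t := Finset.range 12)
    (fun e he => ?_) fun e _ e' _ h => Fin.ext ?_).trans_eq (Finset.card_range _)
  · have := e.2
    simp only [Finset.coe_filter, Finset.mem_univ, true_and, Set.mem_ofPred_eq] at he
    simp only [Finset.coe_range, Set.mem_Iio]
    omega
  · have := e.2
    have := e'.2
    simp only at h
    omega

/-- A bound for the probability that the pattern of nonzero entries is not expanding. -/
noncomputable def patternBound (c₁ d : ℝ) : ℝ :=
  4 * Real.exp 2 * d * Real.exp (-(c₁ * √d / 16))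

/-- A union bound: expansion is needed for the rows, for the columns, and for at most twelve last
columns. -/
theorem measure_not_regularPattern_le (hν : ∫ x, ‖x‖ ^ 2 ∂ν = 1) {n : ℕ} {c d : ℝ} (hc : 0 < c)
    {p : unitInterval} (hp : (p : ℝ) ≤ 1 / 2) (hd : d = p * n) (hd1 : 1 ≤ d)
    (hx : patternBound (ν.real {y | c ≤ ‖y‖}) d ≤ 1 / 2) :
    sparseArrayLaw n ν p {A | ¬ RegularPattern A c d ⌊n * Real.log d / (4 * d)⌋₊} ≤
      14 * ENNReal.ofReal (2 * patternBound (ν.real {y | c ≤ ‖y‖}) d) := by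
  have hd0 : 0 < d := by linarith
  have hn0 : (0 : ℝ) ≤ n := Nat.cast_nonneg n
  set L := ⌊n * Real.log d / (4 * d)⌋₊ with hL
  set b := ENNReal.ofReal (2 * patternBound (ν.real {y | c ≤ ‖y‖}) d) with hb
  have hLr : (L : ℝ) ≤ n * Real.log d / (4 * d) :=
    Nat.floor_le (div_nonneg (mul_nonneg hn0 (Real.log_nonneg hd1)) (by linarith))
  have hLn : 4 * L ≤ n := by
    have h1 : Real.log d ≤ d := (Real.log_le_sub_one_of_pos hd0).trans (by linarith)
    have h2 : n * Real.log d / (4 * d) ≤ n / 4 := by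
      rw [div_le_div_iff₀ (by positivity) (by norm_num)]
      nlinarith
    have h3 : (4 : ℝ) * L ≤ n := by linarith
    exact_mod_cast h3
  have hpL : 4 * (p : ℝ) * L ≤ Real.log d := by
    calc 4 * (p : ℝ) * L ≤ 4 * p * (n * Real.log d / (4 * d)) :=
          mul_le_mul_of_nonneg_left hLr (mul_nonneg (by norm_num) p.2.1)
      _ = (p * n) * Real.log d / d := by field_simp
      _ = Real.log d := by rw [← hd]; field_simp
  have hE : ∀ E : Finset (Fin n), E.card ≤ 1 →
      sparseArrayLaw n ν p {A | ¬ Expanding A c d L E} ≤ b := by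
    intro E hE
    have h1 := measureReal_not_expanding_le p hν hc hp hd hd1 hLn hpL hE rfl hx
    exact (ENNReal.le_ofReal_iff_toReal_le (measure_ne_top _ _) (measureReal_nonneg.trans h1)).2 h1
  have hT : sparseArrayLaw n ν p {A | ¬ Expanding (fun i j => A j i) c d L ∅} ≤ b := by
    have h1 := measurePreserving_transpose (ν := ν) p n
    refine le_trans ?_ (hE ∅ (by simp))
    refine le_trans (Measure.le_map_apply h1.measurable.aemeasurable
      {A : Fin n → Fin n → ℂ | ¬ Expanding A c d L ∅}) ?_
    rw [h1.map_eq]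
  have hsub : {A : Fin n → Fin n → ℂ | ¬ RegularPattern A c d L} ⊆
      ({A | ¬ Expanding A c d L ∅} ∪ {A | ¬ Expanding (fun i j => A j i) c d L ∅}) ∪
        ⋃ e ∈ Finset.univ.filter fun e : Fin n => n ≤ e + 12, {A | ¬ Expanding A c d L {e}} := by
    intro A hA
    by_contra h
    simp only [Set.mem_union, Set.mem_ofPred_eq, Set.mem_iUnion, Finset.mem_filter,
      Finset.mem_univ, true_and, not_or, not_exists, not_not] at h
    exact hA ⟨h.1.1, h.1.2, h.2⟩
  refine (measure_mono hsub).trans ((measure_union_le _ _).trans ?_)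
  have h1 : sparseArrayLaw n ν p (⋃ e ∈ Finset.univ.filter fun e : Fin n => n ≤ e + 12,
      {A | ¬ Expanding A c d L {e}}) ≤ 12 * b := by
    refine (measure_biUnion_finset_le _ _).trans ?_
    refine (Finset.sum_le_card_nsmul _ _ b fun e _ => hE {e} (by simp)).trans ?_
    rw [nsmul_eq_mul]
    gcongr
    exact_mod_cast card_filter_le_add_twelve_le n
  calc _ ≤ (b + b) + 12 * b :=
        add_le_add ((measure_union_le _ _).trans (add_le_add (hE ∅ (by simp)) hT)) h1
    _ = 14 * b := by ring

theorem tendsto_patternBound {c₁ : ℝ} (hc₁ : 0 < c₁) :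
    Tendsto (patternBound c₁) atTop (𝓝 0) := by
  have h1 := (tendsto_rpow_mul_exp_neg_mul_atTop_nhds_zero 2 (c₁ / 16) (by positivity)).comp
    Real.tendsto_sqrt_atTop
  have h2 := h1.const_mul (4 * Real.exp 2)
  rw [mul_zero] at h2
  refine h2.congr' ?_
  filter_upwards [eventually_ge_atTop 0] with d hd
  simp only [Function.comp, patternBound]
  rw [Real.rpow_two, Real.sq_sqrt hd]
  ring_nf

/-- The bound for a stalling row is small compared to the proportion of the missing rank, if that proportion
is at least of order `d ^ (-1 / 8)`. -/
theorem exists_stallBound_le {c c₁ : ℝ} (hc : 0 < c) (hc₁ : 0 < c₁) :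
    ∃ K : ℝ, 0 < K ∧ ∀ w d n s : ℝ, 1 ≤ w → d = w ^ 8 → d ≤ n → 1 / (8 * w) ≤ s →
      stallBound c c₁ d n s ≤ K * s / w ^ 4 := by
  refine ⟨4096 * (80 / c₁ + 1024 * (16 / c₁ / c) ^ 2 / c₁ +
    131072 * (16 / c₁ / c) ^ 4 / c₁ ^ 2), by positivity, ?_⟩
  intro w d n s hw hd hdn hs
  have hw0 : 0 < w := by linarith
  have hd0 : 0 < d := by rw [hd]; positivity
  have hs0 : 0 < s := lt_of_lt_of_le (by positivity) hs
  have hn0 : 0 < n := hd0.trans_le hdn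
  have hw4 : 0 < w ^ 4 := by positivity
  have h2 : w ^ 4 / 4096 ≤ d * s ^ 2 := by
    calc w ^ 4 / 4096 ≤ w ^ 6 / 64 := by
          have : w ^ 4 ≤ w ^ 6 := pow_le_pow_right₀ hw (by norm_num)
          linarith
      _ = w ^ 8 * (1 / (8 * w)) ^ 2 := by field_simp; norm_num
      _ ≤ d * s ^ 2 := by rw [hd]; gcongr
  have h3 : w ^ 4 / 4096 ≤ d * s ^ 3 := by
    calc w ^ 4 / 4096 ≤ w ^ 5 / 512 := by
          have : w ^ 4 ≤ w ^ 5 := pow_le_pow_right₀ hw (by norm_num)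
          linarith
      _ = w ^ 8 * (1 / (8 * w)) ^ 3 := by field_simp; norm_num
      _ ≤ d * s ^ 3 := by rw [hd]; gcongr
  have h4 : w ^ 4 / 4096 ≤ n * s ^ 4 := by
    calc w ^ 4 / 4096 = w ^ 8 * (1 / (8 * w)) ^ 4 := by field_simp; norm_num
      _ ≤ n * s ^ 4 := by rw [← hd]; gcongr
  have e1 : Real.exp (-(c₁ * d * s / 80)) ≤ 80 / c₁ * s / (w ^ 4 / 4096) := by
    have h5 : 0 < c₁ * d * s / 80 := by positivity
    rw [Real.exp_neg]
    calc (Real.exp (c₁ * d * s / 80))⁻¹ ≤ (c₁ * d * s / 80)⁻¹ := by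
          refine inv_anti₀ h5 ?_
          linarith [Real.add_one_le_exp (c₁ * d * s / 80)]
      _ = 80 / c₁ * s / (d * s ^ 2) := by field_simp
      _ ≤ _ := by gcongr
  have e2 : 1024 * (16 / c₁ / c) ^ 2 / (c₁ * d * s ^ 2) ≤
      1024 * (16 / c₁ / c) ^ 2 / c₁ * s / (w ^ 4 / 4096) := by
    calc 1024 * (16 / c₁ / c) ^ 2 / (c₁ * d * s ^ 2)
        = 1024 * (16 / c₁ / c) ^ 2 / c₁ * s / (d * s ^ 3) := by field_simp
      _ ≤ _ := by gcongr
  have e3 : 131072 * (16 / c₁ / c) ^ 4 / (c₁ ^ 2 * n * s ^ 3) ≤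
      131072 * (16 / c₁ / c) ^ 4 / c₁ ^ 2 * s / (w ^ 4 / 4096) := by
    calc 131072 * (16 / c₁ / c) ^ 4 / (c₁ ^ 2 * n * s ^ 3)
        = 131072 * (16 / c₁ / c) ^ 4 / c₁ ^ 2 * s / (n * s ^ 4) := by field_simp
      _ ≤ _ := by gcongr
  refine (add_le_add (add_le_add e1 e2) e3).trans_eq ?_
  field_simp

section Sizes

variable {n : ℕ} {ε : ℝ}

theorem minorSize_le (hε : 0 ≤ ε) : minorSize n ε ≤ n := by
  have hn : (0 : ℝ) ≤ n := Nat.cast_nonneg n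
  refine Nat.floor_le_of_le ?_
  nlinarith

theorem minorSize_le_mul (hε : ε ≤ 1) : (minorSize n ε : ℝ) ≤ (1 - ε) * n :=
  Nat.floor_le (mul_nonneg (by linarith) (Nat.cast_nonneg n))

theorem keptCount_le_mul (hε : ε ≤ 1) :
    (keptCount n ε : ℝ) ≤ (1 - ε / 4) * minorSize n ε :=
  Nat.floor_le (mul_nonneg (by linarith) (Nat.cast_nonneg _))

theorem keptCount_le_minorSize (hε : 0 ≤ ε) : keptCount n ε ≤ minorSize n ε := by
  have hn : (0 : ℝ) ≤ minorSize n ε := Nat.cast_nonneg _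
  refine Nat.floor_le_of_le ?_
  nlinarith

theorem lt_minorSize_add_one : (1 - ε) * n < minorSize n ε + 1 := Nat.lt_floor_add_one _

theorem lt_keptCount_add_one : (1 - ε / 4) * minorSize n ε < keptCount n ε + 1 :=
  Nat.lt_floor_add_one _

theorem le_two_mul_minorSize (hε : ε ≤ 1 / 4) (hn : 4 ≤ n) : n ≤ 2 * minorSize n ε := by
  have h1 := lt_minorSize_add_one (n := n) (ε := ε)
  have hn' : (4 : ℝ) ≤ n := by exact_mod_cast hn
  have h2 : (n : ℝ) < 2 * minorSize n ε + 1 := by nlinarith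
  have h3 : n < 2 * minorSize n ε + 1 := by exact_mod_cast h2
  omega

theorem sub_keptCount_le (hε0 : 0 ≤ ε) : (n : ℝ) - keptCount n ε ≤ 5 / 4 * ε * n + 2 := by
  have h1 := lt_minorSize_add_one (n := n) (ε := ε)
  have h2 := lt_keptCount_add_one (n := n) (ε := ε)
  have h3 : (minorSize n ε : ℝ) ≤ n := by exact_mod_cast minorSize_le hε0
  have h4 : ε * minorSize n ε ≤ ε * n := by gcongr
  linarith

theorem twenty_mul_sub_keptCount_le (hε0 : 0 ≤ ε) (hε : ε ≤ 1) (hn : 1 ≤ ε * n) :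
    20 * (minorSize n ε - keptCount n ε) ≤ 18 * (n - minorSize n ε) + 10 := by
  have h1 := minorSize_le_mul (n := n) hε
  have h2 := lt_keptCount_add_one (n := n) (ε := ε)
  have h3 : (minorSize n ε : ℝ) ≤ n := by exact_mod_cast minorSize_le hε0
  have h4 : ε * minorSize n ε ≤ ε * n := by gcongr
  have h5 : (20 : ℝ) * ((minorSize n ε : ℝ) - keptCount n ε) ≤ 18 * (n - minorSize n ε) + 10 := by
    linarith
  rw [← Nat.cast_sub (keptCount_le_minorSize hε0), ← Nat.cast_sub (minorSize_le hε0)] at h5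
  exact_mod_cast h5

end Sizes

/-- A lower bound for the proportion `ε`: the power `-1/8` of the average number of nonzero entries in
a row. The maximum with `1` only serves to make it positive for all `n`. -/
noncomputable def minProportion (p : ℕ → unitInterval) (n : ℕ) : ℝ :=
  (max 1 ((p n : ℝ) * n)) ^ (-(1 / 8) : ℝ)

theorem minProportion_pos (p : ℕ → unitInterval) (n : ℕ) : 0 < minProportion p n :=
  Real.rpow_pos_of_pos (lt_of_lt_of_le one_pos (le_max_left _ _)) _

variable {p : ℕ → unitInterval}

theorem tendsto_minProportion (hd : Tendsto (fun n : ℕ => (p n : ℝ) * n) atTop atTop) :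
    Tendsto (minProportion p) atTop (𝓝 0) :=
  (tendsto_rpow_neg_atTop (by norm_num)).comp (tendsto_atTop_mono (fun _ => le_max_right _ _) hd)

theorem mul_natCast_le (p : unitInterval) (n : ℕ) : (p : ℝ) * n ≤ n :=
  mul_le_of_le_one_left (Nat.cast_nonneg n) p.2.2

variable {ε : ℕ → ℝ}

theorem eventually_one_div_le (hd : Tendsto (fun n : ℕ => (p n : ℝ) * n) atTop atTop)
    (hε₀ : ∀ᶠ n in atTop, minProportion p n ≤ ε n) :
    ∀ᶠ n : ℕ in atTop, 1 / ((p n : ℝ) * n) ^ (1 / 8 : ℝ) ≤ ε n := by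
  filter_upwards [hε₀, hd.eventually_ge_atTop 1] with n h1 h2
  rw [minProportion, max_eq_right h2, Real.rpow_neg (by linarith)] at h1
  simpa using h1

theorem eventually_one_le_mul (hd : Tendsto (fun n : ℕ => (p n : ℝ) * n) atTop atTop)
    (hε₀ : ∀ᶠ n in atTop, minProportion p n ≤ ε n) : ∀ᶠ n : ℕ in atTop, 1 ≤ ε n * n := by
  filter_upwards [eventually_one_div_le hd hε₀, hd.eventually_ge_atTop 1] with n h1 h2
  have h3 : ((p n : ℝ) * n) ^ (1 / 8 : ℝ) ≤ (p n : ℝ) * n := by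
    calc ((p n : ℝ) * n) ^ (1 / 8 : ℝ) ≤ ((p n : ℝ) * n) ^ (1 : ℝ) :=
          Real.rpow_le_rpow_of_exponent_le h2 (by norm_num)
      _ = _ := Real.rpow_one _
  have h4 : (0 : ℝ) < ((p n : ℝ) * n) ^ (1 / 8 : ℝ) := Real.rpow_pos_of_pos (by linarith) _
  rw [div_le_iff₀ h4] at h1
  have h5 : 0 ≤ ε n := by
    by_contra h6
    nlinarith
  calc 1 ≤ ε n * ((p n : ℝ) * n) ^ (1 / 8 : ℝ) := h1
    _ ≤ ε n * n := mul_le_mul_of_nonneg_left (h3.trans (mul_natCast_le _ _)) h5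

/-- With high probability the initial truncated sum is finite. -/
theorem tendsto_measure_topProd_initial (hν : ∫ x, ‖x‖ ^ 2 ∂ν = 1) {c : ℝ} (hc : 0 < c)
    (hc₁ : 0 < ν.real {y | c ≤ ‖y‖}) (hp : ∀ n, (p n : ℝ) ≤ 1 / 2)
    (hd : Tendsto (fun n : ℕ => (p n : ℝ) * n) atTop atTop)
    (hε₀ : ∀ᶠ n in atTop, minProportion p n ≤ ε n) (hε : Tendsto ε atTop (𝓝 0)) (z : ℂ) :
    Tendsto (fun n : ℕ => sparseArrayLaw n ν (p n) {A | ¬ 0 < topProd (leadingBlock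
      (shiftedMatrix A ((p n : ℝ) * n) z) (minorSize n (ε n)) (minorSize n (ε n)))
      (keptCount n (ε n))}) atTop (𝓝 0) := by
  set c₁ := ν.real {y | c ≤ ‖y‖} with hc₁def
  obtain ⟨K, hK0, hK⟩ := exists_stallBound_le hc hc₁
  have hw : Tendsto (fun n : ℕ => ((p n : ℝ) * n) ^ (1 / 8 : ℝ)) atTop atTop :=
    (tendsto_rpow_atTop (by norm_num)).comp hd
  have hlim : Tendsto (fun n : ℕ => ENNReal.ofReal (K / (((p n : ℝ) * n) ^ (1 / 8 : ℝ)) ^ 4)) atTop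
      (𝓝 0) := by
    have h1 := ((tendsto_pow_atTop (α := ℝ) (n := 4) (by norm_num)).comp hw).const_div_atTop K
    simpa using ENNReal.tendsto_ofReal h1
  refine tendsto_of_tendsto_of_tendsto_of_le_of_le' tendsto_const_nhds hlim
    (Eventually.of_forall fun _ => zero_le) ?_
  filter_upwards [eventually_one_div_le hd hε₀, hd.eventually_ge_atTop 1,
    hw.eventually_ge_atTop (256 / c₁), hε.eventually_le_const (by norm_num : (0 : ℝ) < 1 / 4),
    eventually_ge_atTop 4] with n h1 h2 h3 h4 h5
  set d := (p n : ℝ) * n with hddef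
  set w := d ^ (1 / 8 : ℝ) with hwdef
  have hd0 : 0 < d := by linarith
  have hw1 : 1 ≤ w := Real.one_le_rpow h2 (by norm_num)
  have hw0 : 0 < w := by linarith
  have hw8 : d = w ^ 8 := by
    rw [hwdef, ← Real.rpow_natCast, ← Real.rpow_mul hd0.le]
    norm_num
  have hε0 : 0 < ε n := lt_of_lt_of_le (by positivity) h1
  have hn0 : (0 : ℝ) < n := by
    have : (4 : ℝ) ≤ n := by exact_mod_cast h5
    linarith
  have hm2 : (n : ℝ) ≤ 2 * minorSize n (ε n) := by exact_mod_cast le_two_mul_minorSize h4 h5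
  have hr := keptCount_le_mul (n := n) (by linarith : ε n ≤ 1)
  have hs : 1 / (8 * w) ≤ ε n / 8 := by
    calc 1 / (8 * w) = 1 / w / 8 := by field_simp
      _ ≤ _ := by gcongr
  have hsb : n * (ε n / 8) ≤ (minorSize n (ε n) : ℝ) - keptCount n (ε n) := by
    have : ε n * n ≤ ε n * (2 * minorSize n (ε n)) := by gcongr
    linarith
  have hds : 32 ≤ c₁ * d * (ε n / 8) := by
    calc (32 : ℝ) = c₁ * (256 / c₁) * (1 / 8) := by field_simp; norm_num
      _ ≤ c₁ * w * (1 / 8) := by gcongr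
      _ ≤ c₁ * w ^ 7 * (1 / 8) := by
        gcongr
        exact le_self_pow₀ hw1 (by norm_num)
      _ = c₁ * w ^ 8 * (1 / (8 * w)) := by field_simp
      _ ≤ _ := by rw [← hw8]; gcongr
  have hm := minorSize_le (n := n) hε0.le
  have hmain := sub_mul_measure_topProd_eq_zero_le (z := z) hν hc hc₁ (p n) (hp n) hddef hd0 hm
    (by positivity) hsb hds
  have hst := hK w d n (ε n / 8) hw1 hw8 (mul_natCast_le _ _) hs
  set N := minorSize n (ε n) - keptCount n (ε n) with hN
  have hNr : n * (ε n / 8) ≤ (N : ℝ) := by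
    rwa [hN, Nat.cast_sub (keptCount_le_minorSize hε0.le)]
  have hN0 : 0 < N := by
    have : (0 : ℝ) < N := lt_of_lt_of_le (by positivity) hNr
    exact_mod_cast this
  have hN0' : (N : ℝ≥0∞) ≠ 0 := by exact_mod_cast hN0.ne'
  rw [← ENNReal.mul_le_mul_iff_right hN0' (ENNReal.natCast_ne_top N)]
  refine hmain.trans ?_
  rw [← ENNReal.ofReal_natCast, ← ENNReal.ofReal_natCast, ← ENNReal.ofReal_mul (Nat.cast_nonneg _),
    ← ENNReal.ofReal_mul (Nat.cast_nonneg _)]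
  refine ENNReal.ofReal_le_ofReal ?_
  have hmr : (minorSize n (ε n) : ℝ) ≤ n := by exact_mod_cast hm
  calc (minorSize n (ε n) : ℝ) * stallBound c c₁ d n (ε n / 8)
      ≤ minorSize n (ε n) * (K * (ε n / 8) / w ^ 4) := by gcongr
    _ ≤ n * (K * (ε n / 8) / w ^ 4) := by gcongr
    _ = n * (ε n / 8) * (K / w ^ 4) := by ring
    _ ≤ N * (K / w ^ 4) := by gcongr

/-- With high probability the process ends at height `0`. -/
theorem tendsto_measure_finalHeight_ne_zero (hν : ∫ x, ‖x‖ ^ 2 ∂ν = 1) {c : ℝ} (hc : 0 < c)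
    (hc1 : c ≤ 1) (hc₁ : 0 < ν.real {y | c ≤ ‖y‖}) (hp : ∀ n, (p n : ℝ) ≤ 1 / 2)
    (hd : Tendsto (fun n : ℕ => (p n : ℝ) * n) atTop atTop)
    (hε₀ : ∀ᶠ n in atTop, minProportion p n ≤ ε n) (hε : Tendsto ε atTop (𝓝 0)) {z : ℂ}
    (hz : z ≠ 0) {C : ℝ} (hC : 1 ≤ C) :
    Tendsto (fun n : ℕ => sparseArrayLaw n ν (p n)
      {A | finalHeight A ((p n : ℝ) * n) C (ε n) z ≠ 0}) atTop (𝓝 0) := by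
  obtain ⟨X, hX1, hX⟩ := exists_measure_finalHeight_ne_zero_le hν hc hc1 hc₁ (norm_pos_iff.2 hz)
  have h1 := tendsto_measure_topProd_initial hν hc hc₁ hp hd hε₀ hε z
  have hpat := (tendsto_patternBound hc₁).comp hd
  have h2 : Tendsto (fun n : ℕ => 14 * ENNReal.ofReal (2 * patternBound (ν.real {y | c ≤ ‖y‖})
      ((p n : ℝ) * n))) atTop (𝓝 0) := by
    have h3 := ENNReal.tendsto_ofReal (hpat.const_mul 2)
    have h4 := ENNReal.Tendsto.const_mul (a := 14) h3 (Or.inr (by norm_num))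
    simpa using h4
  have h12 := h1.add h2
  rw [add_zero] at h12
  rw [ENNReal.tendsto_nhds_zero]
  intro δ hδ
  have hδ2 : 0 < δ / 2 := ENNReal.half_pos hδ.ne'
  -- any fixed base `y` of the potential is admissible for large `n`, and gives the bound `3 / y ^ 10`
  obtain ⟨N, hN⟩ := ENNReal.exists_nat_mul_gt hδ2.ne' (by norm_num : (3 : ℝ≥0∞) ≠ ⊤)
  set y : ℝ≥0∞ := ((N + 2 : ℕ) : ℝ≥0∞) with hy
  have hy2 : 2 ≤ y := by rw [hy]; exact_mod_cast (by omega : 2 ≤ N + 2)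
  have hyt : y ≠ ⊤ := ENNReal.natCast_ne_top _
  have hy1 : 1 ≤ y := le_trans (by norm_num) hy2
  have hy10 : 3 ≤ y ^ 10 * (δ / 2) := by
    refine hN.le.trans (mul_le_mul' ?_ le_rfl)
    refine le_trans ?_ (le_self_pow₀ hy1 (by norm_num))
    rw [hy]
    exact_mod_cast (by omega : N ≤ N + 2)
  have hfail : ∀ᶠ n : ℕ in atTop,
      y ^ 20 * ENNReal.ofReal (failBound c (ν.real {y | c ≤ ‖y‖}) ((p n : ℝ) * n)) ≤ 1 := by
    have h3 := ENNReal.tendsto_ofReal ((tendsto_failBound (c := c) hc₁).comp hd)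
    have h4 := ENNReal.Tendsto.const_mul (a := y ^ 20) h3 (Or.inr (ENNReal.pow_ne_top hyt))
    rw [ENNReal.ofReal_zero, mul_zero] at h4
    exact (h4.eventually_lt_const zero_lt_one).mono fun n h => h.le
  have hXn : ∀ᶠ n : ℕ in atTop, X * (5 / 4 * ε n + 2 / n) ≤ 1 := by
    have h3 : Tendsto (fun n : ℕ => X * (5 / 4 * ε n + 2 / n)) atTop (𝓝 (X * (5 / 4 * 0 + 0))) :=
      ((hε.const_mul _).add (tendsto_const_div_atTop_nhds_zero_nat 2)).const_mul X
    rw [mul_zero, add_zero, mul_zero] at h3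
    exact (h3.eventually_lt_const zero_lt_one).mono fun n h => h.le
  filter_upwards [ENNReal.tendsto_nhds_zero.1 h12 (δ / 2) hδ2, hfail, hXn,
    hd.eventually_ge_atTop X, hε.eventually_le_const (by norm_num : (0 : ℝ) < 1 / 4),
    eventually_one_le_mul hd hε₀, eventually_ge_atTop 4,
    hpat.eventually_le_const (by norm_num : (0 : ℝ) < 1 / 2)] with n g1 g2 g3 g4 g5 g6 g7 g8
  have hn0 : (0 : ℝ) < n := by
    have : (4 : ℝ) ≤ n := by exact_mod_cast g7
    linarith
  have hε0 : 0 ≤ ε n := by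
    by_contra h6
    nlinarith
  have hkn : X * (n - keptCount n (ε n)) ≤ n := by
    calc X * (n - keptCount n (ε n)) ≤ X * (5 / 4 * ε n * n + 2) := by
          gcongr
          exact sub_keptCount_le hε0
      _ = X * (5 / 4 * ε n + 2 / n) * n := by field_simp
      _ ≤ 1 * n := by gcongr
      _ = n := one_mul _
  have hmain := hX (p n) n _ C (ε n) z y (hp n) rfl g4 hC rfl (le_two_mul_minorSize g5 g7)
    (minorSize_le hε0) hkn (twenty_mul_sub_keptCount_le hε0 (by linarith) g6) hy2 hyt g2
  have hreg := measure_not_regularPattern_le hν (n := n) hc (hp n) rfl (hX1.trans g4) g8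
  have hy0 : y ^ 10 ≠ 0 := pow_ne_zero _ (by rintro h; rw [h] at hy1; simp at hy1)
  have hmain2 := (ENNReal.mul_le_mul_iff_right hy0 (ENNReal.pow_ne_top hyt)).1 (hmain.trans hy10)
  set V : Set (Fin n → Fin n → ℂ) := {A | ¬ 0 < topProd (leadingBlock
      (shiftedMatrix A ((p n : ℝ) * n) z) (minorSize n (ε n)) (minorSize n (ε n)))
      (keptCount n (ε n))} with hV
  have hblock : ∀ A : Fin n → Fin n → ℂ, topProd (blockAtTime (shiftedMatrix A ((p n : ℝ) * n) z)
      (2 * minorSize n (ε n))) (keptCount n (ε n)) = topProd (leadingBlock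
      (shiftedMatrix A ((p n : ℝ) * n) z) (minorSize n (ε n)) (minorSize n (ε n)))
      (keptCount n (ε n)) := by
    intro A
    have e1 : 2 * minorSize n (ε n) / 2 = minorSize n (ε n) := by omega
    have e2 : (2 * minorSize n (ε n) + 1) / 2 = minorSize n (ε n) := by omega
    rw [blockAtTime, e1, e2]
  simp only [hblock] at hmain2
  calc sparseArrayLaw n ν (p n) {A | finalHeight A ((p n : ℝ) * n) C (ε n) z ≠ 0}
      ≤ sparseArrayLaw n ν (p n) ((V ∪ {A | ¬ RegularPattern A c ((p n : ℝ) * n)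
          ⌊n * Real.log ((p n : ℝ) * n) / (4 * ((p n : ℝ) * n))⌋₊}) ∪ _) :=
        measure_mono fun A hA => by
          by_cases hA1 : A ∈ V
          · exact Or.inl (Or.inl hA1)
          by_cases hA2 : RegularPattern A c ((p n : ℝ) * n)
            ⌊n * Real.log ((p n : ℝ) * n) / (4 * ((p n : ℝ) * n))⌋₊
          · exact Or.inr ⟨not_not.1 hA1, hA2, hA⟩
          · exact Or.inl (Or.inr hA2)
    _ ≤ (sparseArrayLaw n ν (p n) V + sparseArrayLaw n ν (p n) _) + _ :=
        (measure_union_le _ _).trans (add_le_add_left (measure_union_le _ _) _)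
    _ ≤ δ / 2 + δ / 2 := add_le_add ((add_le_add_right hreg _).trans g1) hmain2
    _ = δ := ENNReal.add_halves δ

end HighProbability

/-! ### The sum of the allowed errors -/

section ErrorSum

/-- Each step that takes a singular value costs at most the allowed error, and the other steps cost nothing,
since larger blocks have larger singular values. -/
theorem logSum_le_add_sum_stepError {n : ℕ} (hn : 0 < n) (A : Fin n → Fin n → ℂ) (d C ε : ℝ) (z : ℂ)
    (k : ℕ) : logSum n (blockAtTime (shiftedMatrix A d z) (2 * minorSize n ε + k))
        (takenCount A d C ε z k) ≤
      logSum n (blockAtTime (shiftedMatrix A d z) (2 * minorSize n ε)) (keptCount n ε) +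
        ((∑ r ∈ Finset.Ioc (keptCount n ε) (takenCount A d C ε z k), stepError n d C r : ℝ) :
          EReal) := by
  induction k with
  | zero => simp [takenCount]
  | succ k ih =>
    rw [takenCount_succ]
    split_ifs with h
    · refine h.trans ((add_le_add_left ih _).trans_eq ?_)
      rw [add_assoc, ← EReal.coe_add, Finset.sum_Ioc_succ_top (keptCount_le_takenCount A k)]
    · exact (logSum_le_logSum hn (topProd_blockAtTime_le _ _ _)).trans ih

theorem logPotential_le_of_finalHeight_eq_zero {n : ℕ} (hn : 0 < n) {A : Fin n → Fin n → ℂ}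
    {d C ε : ℝ} {z : ℂ} (hm : minorSize n ε ≤ n) (h : finalHeight A d C ε z = 0) :
    logPotential A d z ≤ truncatedLogPotential A d ε z +
      ((∑ r ∈ Finset.Ioc (keptCount n ε) n, stepError n d C r : ℝ) : EReal) := by
  have h1 := logSum_le_add_sum_stepError hn A d C ε z (2 * (n - minorSize n ε))
  have h2 : takenCount A d C ε z (2 * (n - minorSize n ε)) = n := by
    rw [finalHeight, height] at h
    push_cast [hm] at h
    have h3 : (takenCount A d C ε z (2 * (n - minorSize n ε)) : ℝ) = n := by linarith
    exact_mod_cast h3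
  have e1 : (2 * minorSize n ε + 2 * (n - minorSize n ε)) / 2 = n := by omega
  have e2 : (2 * minorSize n ε + 2 * (n - minorSize n ε) + 1) / 2 = n := by omega
  have e3 : 2 * minorSize n ε / 2 = minorSize n ε := by omega
  have e4 : (2 * minorSize n ε + 1) / 2 = minorSize n ε := by omega
  rw [h2, blockAtTime, blockAtTime, e1, e2, e3, e4] at h1
  refine le_trans (logSum_le_logSum hn (topProd_le_of_forall_le (fun j => ?_) n)) h1
  exact singularValues_submatrix_le _ Subtype.val_injective Subtype.val_injective j

theorem sum_inv_mul_sqrt_le {n : ℕ} (hn : 0 < n) {R : ℕ} (hR : R ≤ n) :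
    ∑ r ∈ Finset.Ioc R n, (n : ℝ)⁻¹ * √(n / (n - r + 1)) ≤ 2 * √((n - R) / n) := by
  have hn0 : (0 : ℝ) < n := by exact_mod_cast hn
  obtain ⟨U, hU⟩ : ∃ U, R + U = n := ⟨n - R, by omega⟩
  clear hR
  induction U generalizing R with
  | zero => simp [← hU]
  | succ U ih =>
    have h1 : R < n := by omega
    rw [← Finset.insert_Ioc_add_one_left_eq_Ioc h1, Finset.sum_insert (by simp)]
    have h2 := ih (R := R + 1) (by omega)
    have h3 : (0 : ℝ) < n - R := by
      have : (R : ℝ) < n := by exact_mod_cast h1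
      linarith
    have h3' : (0 : ℝ) ≤ n - (R + 1 : ℕ) := by
      have : ((R + 1 : ℕ) : ℝ) ≤ n := by exact_mod_cast h1
      linarith
    set a := √((n - (R + 1 : ℕ)) / n : ℝ) with ha
    set b := √((n - R) / n : ℝ) with hb
    have hb0 : 0 < b := Real.sqrt_pos.2 (by positivity)
    have ha0 : 0 ≤ a := Real.sqrt_nonneg _
    have ha2 : a ^ 2 = (n - (R + 1 : ℕ)) / n := Real.sq_sqrt (by positivity)
    have hb2 : b ^ 2 = (n - R) / n := Real.sq_sqrt (by positivity)
    have h4 : (n : ℝ)⁻¹ = (b - a) * (b + a) := by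
      have : (b - a) * (b + a) = b ^ 2 - a ^ 2 := by ring
      rw [this, ha2, hb2]
      push_cast
      field_simp
      ring
    have hab : a ≤ b := by
      by_contra! h
      have h5 : (b - a) * (b + a) ≤ 0 :=
        mul_nonpos_of_nonpos_of_nonneg (by linarith) (by linarith)
      rw [← h4] at h5
      exact absurd (inv_pos.2 hn0) (not_lt.2 h5)
    have h6 : √(n / (n - (R + 1 : ℕ) + 1) : ℝ) = b⁻¹ := by
      rw [hb, ← Real.sqrt_inv, inv_div]
      congr 2
      push_cast
      ring
    have h7 : (n : ℝ)⁻¹ * b⁻¹ ≤ 2 * (b - a) := by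
      rw [← div_eq_mul_inv, div_le_iff₀ hb0, h4]
      nlinarith
    rw [h6]
    linarith

theorem stepError_nonneg (n : ℕ) (d : ℝ) (r : ℕ) : 0 ≤ stepError n d 1 r := by
  rw [stepError]
  split_ifs <;> positivity

theorem log_sq_le {x : ℝ} (hx : 1 ≤ x) : Real.log x ^ 2 ≤ 16 * √x := by
  have h1 := Real.log_le_rpow_div (by linarith : 0 ≤ x) (by norm_num : (0 : ℝ) < 1 / 4)
  calc Real.log x ^ 2 ≤ (x ^ (1 / 4 : ℝ) / (1 / 4)) ^ 2 :=
        pow_le_pow_left₀ (Real.log_nonneg hx) h1 2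
    _ = 16 * (x ^ (1 / 4 : ℝ)) ^ 2 := by ring
    _ = 16 * √x := by
      rw [← Real.rpow_natCast, ← Real.rpow_mul (by linarith), Real.sqrt_eq_rpow]
      norm_num

theorem log_pow_eight_le {x : ℝ} (hx : 1 ≤ x) : Real.log x ^ 8 ≤ 16 ^ 8 * √x := by
  have h1 := Real.log_le_rpow_div (by linarith : 0 ≤ x) (by norm_num : (0 : ℝ) < 1 / 16)
  calc Real.log x ^ 8 ≤ (x ^ (1 / 16 : ℝ) / (1 / 16)) ^ 8 :=
        pow_le_pow_left₀ (Real.log_nonneg hx) h1 8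
    _ = 16 ^ 8 * (x ^ (1 / 16 : ℝ)) ^ 8 := by ring
    _ = 16 ^ 8 * √x := by
      rw [← Real.rpow_natCast (x ^ (1 / 16 : ℝ)), ← Real.rpow_mul (by linarith), Real.sqrt_eq_rpow]
      norm_num

/-- Both powers of logarithms are dominated by a square root, whose sum is comparable to the square root of
the number of terms. -/
theorem sum_stepError_le {n : ℕ} {d : ℝ} (hd : 1 ≤ d) (hdn : d ≤ n) {R : ℕ} (hR : R ≤ n) :
    ∑ r ∈ Finset.Ioc R n, stepError n d 1 r ≤
      32 * √((n - R) / n) +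
        2 * 16 ^ 8 * (Real.log d ^ 8 * √(2 * d ^ (-(1 / 4 : ℝ)))) := by
  have hn0 : (0 : ℝ) < n := by linarith
  have hn : 0 < n := by exact_mod_cast hn0
  have hd0 : 0 < d := by linarith
  set v := d ^ (-(1 / 4 : ℝ)) with hv
  have hv0 : 0 < v := Real.rpow_pos_of_pos hd0 _
  have hvd : d⁻¹ ≤ v := by
    rw [hv, ← Real.rpow_neg_one]
    exact Real.rpow_le_rpow_of_exponent_le hd (by norm_num)
  -- the second kind of error occurs for at most `U` values of `r`
  set U := ⌊n * v⌋₊ + 1 with hU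
  have hUn : (U : ℝ) / n ≤ 2 * v := by
    have h1 : ((⌊n * v⌋₊ : ℕ) : ℝ) ≤ n * v := Nat.floor_le (by positivity)
    have h2 : 1 ≤ n * v := by
      calc (1 : ℝ) = d * d⁻¹ := by field_simp
        _ ≤ n * v := by gcongr
    rw [div_le_iff₀ hn0, hU]
    push_cast
    linarith
  have hterm : ∀ r ∈ Finset.Ioc R n, stepError n d 1 r ≤
      16 * ((n : ℝ)⁻¹ * √(n / (n - r + 1))) + if r ∈ Finset.Ioc (n - U) n then
        16 ^ 8 * Real.log d ^ 8 * ((n : ℝ)⁻¹ * √(n / (n - r + 1))) else 0 := by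
    intro r hr
    rw [Finset.mem_Ioc] at hr
    have hr1 : (1 : ℝ) ≤ r := by exact_mod_cast (by omega : 1 ≤ r)
    have hrn : (r : ℝ) ≤ n := by exact_mod_cast hr.2
    have hx : (1 : ℝ) ≤ n / (n - r + 1) := by
      rw [one_le_div (by linarith)]
      linarith
    have h16 : 0 ≤ 16 * ((n : ℝ)⁻¹ * √(n / (n - r + 1))) := by positivity
    rw [stepError]
    by_cases hreg : (r : ℝ) < n * (1 - v)
    · rw [if_pos hreg]
      have h1 : (n : ℝ)⁻¹ * Real.log (n / (n - r + 1)) ^ 2 ≤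
          (n : ℝ)⁻¹ * (16 * √(n / (n - r + 1))) := by
        gcongr
        exact log_sq_le hx
      have h2 : (0 : ℝ) ≤ if r ∈ Finset.Ioc (n - U) n then
          16 ^ 8 * Real.log d ^ 8 * ((n : ℝ)⁻¹ * √(n / (n - r + 1))) else 0 := by
        split_ifs <;> positivity
      linarith
    · have hmem : r ∈ Finset.Ioc (n - U) n := by
        have h1 : ((n - r : ℕ) : ℝ) ≤ n * v := by
          rw [Nat.cast_sub hr.2]
          linarith
        have h2 : n - r ≤ ⌊n * v⌋₊ := Nat.le_floor h1
        rw [Finset.mem_Ioc]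
        omega
      rw [if_neg hreg, if_pos hmem, one_mul]
      have h1 : (n : ℝ)⁻¹ * Real.log d ^ 8 * Real.log (n / (n - r + 1)) ^ 8 ≤
          (n : ℝ)⁻¹ * Real.log d ^ 8 * (16 ^ 8 * √(n / (n - r + 1))) := by
        gcongr
        exact log_pow_eight_le hx
      linarith
  refine (Finset.sum_le_sum hterm).trans ?_
  rw [Finset.sum_add_distrib, ← Finset.mul_sum]
  refine add_le_add ?_ ?_
  · have := sum_inv_mul_sqrt_le hn hR
    linarith
  · calc ∑ r ∈ Finset.Ioc R n, (if r ∈ Finset.Ioc (n - U) n then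
          16 ^ 8 * Real.log d ^ 8 * ((n : ℝ)⁻¹ * √(n / (n - r + 1))) else 0)
        = ∑ r ∈ (Finset.Ioc R n).filter (· ∈ Finset.Ioc (n - U) n),
          16 ^ 8 * Real.log d ^ 8 * ((n : ℝ)⁻¹ * √(n / (n - r + 1))) :=
          (Finset.sum_filter _ _).symm
      _ ≤ ∑ r ∈ Finset.Ioc (n - U) n, 16 ^ 8 * Real.log d ^ 8 *
          ((n : ℝ)⁻¹ * √(n / (n - r + 1))) := by
          refine Finset.sum_le_sum_of_subset_of_nonneg (fun r hr => (Finset.mem_filter.1 hr).2)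
            fun r _ _ => by positivity
      _ = 16 ^ 8 * Real.log d ^ 8 * ∑ r ∈ Finset.Ioc (n - U) n,
          ((n : ℝ)⁻¹ * √(n / (n - r + 1))) := by rw [Finset.mul_sum]
      _ ≤ 16 ^ 8 * Real.log d ^ 8 * (2 * √(2 * v)) := by
          gcongr
          refine (sum_inv_mul_sqrt_le hn (Nat.sub_le n U)).trans ?_
          gcongr
          refine le_trans ?_ hUn
          gcongr
          have : n ≤ (n - U) + U := by omega
          have : (n : ℝ) ≤ ((n - U : ℕ) : ℝ) + U := by exact_mod_cast this
          linarith
      _ = _ := by ring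

variable {p : ℕ → unitInterval} {ε : ℕ → ℝ}

theorem tendsto_sum_stepError (hd : Tendsto (fun n : ℕ => (p n : ℝ) * n) atTop atTop)
    (hε₀ : ∀ᶠ n in atTop, 0 ≤ ε n) (hε : Tendsto ε atTop (𝓝 0)) :
    Tendsto (fun n : ℕ => ∑ r ∈ Finset.Ioc (keptCount n (ε n)) n, stepError n ((p n : ℝ) * n) 1 r)
      atTop (𝓝 0) := by
  have h1 : Tendsto (fun n : ℕ => 32 * √(5 / 4 * ε n + 2 / n)) atTop (𝓝 0) := by
    have h2 := ((hε.const_mul (5 / 4)).add (tendsto_const_div_atTop_nhds_zero_nat 2)).sqrt.const_mul 32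
    simpa using h2
  have h2 : Tendsto (fun d : ℝ => Real.log d ^ 8 * √(2 * d ^ (-(1 / 4 : ℝ)))) atTop (𝓝 0) := by
    have h3 := (isLittleO_log_rpow_rpow_atTop 8 (by norm_num : (0 : ℝ) < 1 / 8)).tendsto_div_nhds_zero
    have h4 := h3.const_mul √2
    rw [mul_zero] at h4
    refine h4.congr' ?_
    filter_upwards [eventually_gt_atTop 1] with d hd1
    have hd0 : 0 < d := by linarith
    have e1 : Real.log d ^ (8 : ℝ) = Real.log d ^ 8 := by
      exact_mod_cast Real.rpow_natCast (Real.log d) 8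
    have e2 : √(2 * d ^ (-(1 / 4 : ℝ))) = √2 * (d ^ (1 / 8 : ℝ))⁻¹ := by
      rw [Real.sqrt_mul (by norm_num), Real.sqrt_eq_rpow (d ^ (-(1 / 4 : ℝ))),
        ← Real.rpow_mul hd0.le, ← Real.rpow_neg hd0.le]
      norm_num
    rw [e1, e2]
    ring
  have h3 := (h2.comp hd).const_mul (2 * 16 ^ 8)
  have h4 := h1.add h3
  rw [mul_zero, add_zero] at h4
  refine tendsto_of_tendsto_of_tendsto_of_le_of_le' tendsto_const_nhds h4
    (Eventually.of_forall fun n => Finset.sum_nonneg fun r _ => stepError_nonneg n _ r) ?_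
  filter_upwards [hε₀, hd.eventually_ge_atTop 1] with n g1 g2
  have hn0 : (0 : ℝ) < n := by linarith [mul_natCast_le (p n) n]
  refine (sum_stepError_le g2 (mul_natCast_le _ _)
    ((keptCount_le_minorSize g1).trans (minorSize_le g1))).trans ?_
  refine add_le_add ?_ le_rfl
  refine mul_le_mul_of_nonneg_left (Real.sqrt_le_sqrt ?_) (by norm_num)
  rw [div_le_iff₀ hn0]
  calc (n : ℝ) - keptCount n (ε n) ≤ 5 / 4 * ε n * n + 2 := sub_keptCount_le g1
    _ = _ := by field_simp

end ErrorSum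

/-! ### The final height and the log potential -/

section Final

/-- No measurability is needed, as the bound only uses subadditivity. -/
theorem tendsto_measure_one_of_compl {Ω : ℕ → Type*} [∀ n, MeasurableSpace (Ω n)]
    {μ : ∀ n, Measure (Ω n)} [∀ n, IsProbabilityMeasure (μ n)] {s : ∀ n, Set (Ω n)}
    (h : Tendsto (fun n => μ n (s n)ᶜ) atTop (𝓝 0)) : Tendsto (fun n => μ n (s n)) atTop (𝓝 1) := by
  have h1 : Tendsto (fun n => 1 - μ n (s n)ᶜ) atTop (𝓝 1) := by
    simpa using ENNReal.Tendsto.sub (tendsto_const_nhds (x := (1 : ENNReal))) h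
      (Or.inl ENNReal.one_ne_top)
  refine tendsto_of_tendsto_of_tendsto_of_le_of_le h1 tendsto_const_nhds (fun n => ?_)
    fun n => prob_le_one
  rw [tsub_le_iff_right, ← measure_univ (μ := μ n), ← Set.union_compl_self (s n)]
  exact measure_union_le _ _

end Final

theorem lemma8p2 (ν : Measure ℂ) [IsProbabilityMeasure ν] (hν : ∫ x, ‖x‖ ^ 2 ∂ν = 1) :
    ∃ C₀ : ℝ, 0 < C₀ ∧
      ∀ p : ℕ → unitInterval, (∀ n, (p n : ℝ) ≤ 1 / 2) →
        Tendsto (fun n : ℕ => (p n : ℝ) * n) atTop atTop →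
        ∃ ε₀ : ℕ → ℝ, (∀ n, 0 < ε₀ n) ∧ Tendsto ε₀ atTop (𝓝 0) ∧
          ∀ ε : ℕ → ℝ, (∀ᶠ n in atTop, ε₀ n ≤ ε n) → Tendsto ε atTop (𝓝 0) →
            ∀ z : ℂ, z ≠ 0 →
              (∀ C : ℝ, C₀ ≤ C →
                Tendsto (fun n : ℕ => sparseArrayLaw n ν (p n)
                  {A | finalHeight A ((p n : ℝ) * n) C (ε n) z = 0}) atTop (𝓝 1)) ∧
              ∃ η : ℕ → ℝ, Tendsto η atTop (𝓝 0) ∧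
                Tendsto (fun n : ℕ => sparseArrayLaw n ν (p n)
                  {A | logPotential A ((p n : ℝ) * n) z ≤
                    truncatedLogPotential A ((p n : ℝ) * n) (ε n) z + (η n : EReal)})
                  atTop (𝓝 1) := by
  obtain ⟨c, hc, hc1, hc₁⟩ := exists_measureReal_le_norm_pos hν
  refine ⟨1, one_pos, fun p hp hd => ⟨minProportion p, minProportion_pos p, tendsto_minProportion hd,
    fun ε hε₀ hε z hz => ?_⟩⟩
  have hheight : ∀ C : ℝ, 1 ≤ C → Tendsto (fun n : ℕ => sparseArrayLaw n ν (p n)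
      {A | finalHeight A ((p n : ℝ) * n) C (ε n) z = 0}) atTop (𝓝 1) := fun C hC =>
    tendsto_measure_one_of_compl
      (tendsto_measure_finalHeight_ne_zero hν hc hc1 hc₁ hp hd hε₀ hε hz hC)
  have hε0 : ∀ᶠ n in atTop, 0 ≤ ε n :=
    hε₀.mono fun n hn => (minProportion_pos p n).le.trans hn
  refine ⟨hheight, _, tendsto_sum_stepError hd hε0 hε, ?_⟩
  refine tendsto_of_tendsto_of_tendsto_of_le_of_le' (hheight 1 le_rfl) tendsto_const_nhds ?_
    (Eventually.of_forall fun n => prob_le_one)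
  filter_upwards [hε0, eventually_gt_atTop 0] with n hn hn0
  exact measure_mono fun A hA =>
    logPotential_le_of_finalHeight_eq_zero hn0 (minorSize_le hn) hA
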